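/- Let $\Omega=(a,b)$ with $-\infty<a<b<\infty$, let $0<\mu<1$, and write $({}_aD_x^{-\sigma}w)(x)=\frac1{\Gamma(\sigma)}\int_a^x(x-s)^{\sigma-1}w(s)\,ds$ and $({}_xD_b^{-\sigma}w)(x)=\frac1{\Gamma(\sigma)}\int_x^b(s-x)^{\sigma-1}w(s)\,ds$ for $\sigma>0$, and ${}_aD_x^{\sigma}w=\frac{d^n}{dx^n}\,{}_aD_x^{-(n-\sigma)}w$, where $n$ is the smallest integer greater than $\sigma>0$. Let $H^*(\Omega)$ be the set of functions $g(x)/\big((x-a)^{1-\epsilon_1}(b-x)^{1-\epsilon_2}\big)$ on $\Omega$ with $\epsilon_1,\epsilon_2>0$ and $g$ Hölder continuous on $[a,b]$ of some exponent in $(0,1]$ with $g(a)=g(b)=0$. Let $\widehat H^s_0(\Omega)$ be the closure of $C_0^\infty(\Omega)$ (functions extended by zero) in the norm $\big(\|w\|_{L^2(\mathbb R)}^2+\||2\pi\xi|^{s}\widehat w\|_{L^2(\mathbb R)}^2\big)^{1/2}$. Consider the problem $L(u)=f$ in $\Omega$, $u(a)=u(b)=0$, with $$L(u)=-D\,k\,(\alpha\,{}_aD_x^{-(1-\mu)}+\beta\,{}_xD_b^{-(1-\mu)})Du+P\,Du+Q\,u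 ,$$ under the conditions: $0<\alpha,\beta<1$, $\alpha+\beta=1$; $f\in H^*(\Omega)$; $P,Q,k\in C^1([a,b])$; $P',k'$ Hölder continuous on $[a,b]$; $k>0$ and $\frac Qk-\frac12(\frac Pk)'\ge0$ on $[a,b]$; $\pi(1-\mu^2)\cot\frac{(1+\mu)\pi}2+4(b-a)\|k'/k\|_{L^\infty(\Omega)}<0$. A true solution is a function $u$, absolutely continuous on $[a,b]$, with $u(a)=u(b)=0$, $Du\in C(\Omega)$, $(\alpha\,{}_aD_x^{-(1-\mu)}+\beta\,{}_xD_b^{-(1-\mu)})Du\in C^1(\Omega)$ and $[L(u)](x)=f(x)$ for every $x\in\Omega$. Let $t>1+\mu$ and let $1+\mu<t_0<\min\{2,t\}$. Then the number $$\rho=\cot((2-t_0)\pi)\sin((1-\mu)\pi)-\cos((1-\mu)\pi)$$ is positive, and for all $\alpha,\beta>0$ with $\alpha+\beta=1$ and $\beta/\alpha<\rho$ the following holds. 1. The data $k\equiv1$, $P\equiv Q\equiv0$, $f\equiv-1$ satisfy the conditions above. 2. There are unique $p,q\in(-1,0)$ with $p+q=-(1-\mu)$ and $\alpha\sin(q\pi)=\beta\sin(p\pi)$.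 With $$c=\frac{(-p-1+\mu)(-p+\mu)\Gamma(1-\mu)}{\mu(1+\mu)\beta\,\Gamma(2-\mu+p)\Gamma(q+2)},$$ the function $u(x)=c\,(x-a)^{p+1}(b-x)^{q+1}$ is a true solution of the problem with these data, it belongs to $\widehat H^{(1+\mu)/2}_0(\Omega)$, and every true solution in $\widehat H^{(1+\mu)/2}_0(\Omega)$ coincides with $u$ on $[a,b]$. 3. ${}_aD_x^{t}u$ exists at every point of $\Omega$ (${}_aD_x^{-(n-t)}u\in C^n(\Omega)$, $n$ the smallest integer greater than $t$), but ${}_aD_x^{t}u\notin L^1(\Omega)$. 4. There is no $J\in H^*(\Omega)$ with $u={}_aD_x^{-t}J$ (even almost everywhere) on $\Omega$. Consequently, for no $t>1+\mu$ is it true that under the above conditions every true solution in $\widehat H^{(1+\mu)/2}_0(\Omega)$ has the form ${}_aD_x^{-t}J_t$ with $J_t\in H^*(\Omega)$; in this sense the exponent $1+\mu$ in a representation result for all $t<1+\mu$ is optimal. -/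

import Mathlib

open MeasureTheory Set
open scoped ENNReal NNReal FourierTransform ContDiff

noncomputable section

namespace FDARE

/-! Throughout, `Ω = (a, b)`. -/

/-- Left Riemann–Liouville fractional integral `ₐD_x^{-σ} w` of order `σ > 0`. -/
def leftInt (a σ : ℝ) (w : ℝ → ℝ) (x : ℝ) : ℝ :=
  1 / Real.Gamma σ * ∫ s in a..x, (x - s) ^ (σ - 1) * w s

/-- Right Riemann–Liouville fractional integral `ₓD_b^{-σ} w` of order `σ > 0`. -/
def rightInt (b σ : ℝ) (w : ℝ → ℝ) (x : ℝ) : ℝ :=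
  1 / Real.Gamma σ * ∫ s in x..b, (s - x) ^ (σ - 1) * w s

/-- The smallest integer greater than `σ` (for `σ > 0`). -/
def rlOrder (σ : ℝ) : ℕ := ⌊σ⌋₊ + 1

/-- The left Riemann–Liouville derivative `ₐD_x^σ w` of order `σ > 0` exists, with continuous
derivatives of all the intermediate orders, at every point of `Ω`. -/
def HasLeftDeriv (a b σ : ℝ) (w : ℝ → ℝ) : Prop :=
  ContDiffOn ℝ (rlOrder σ : ℕ∞) (leftInt a (rlOrder σ - σ) w) (Ioo a b)

/-- Left Riemann–Liouville derivative `ₐD_x^σ w = dⁿ/dxⁿ ₐD_x^{-(n-σ)} w` of order `σ > 0`, where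
`n` is the smallest integer greater than `σ`. -/
def leftDeriv (a σ : ℝ) (w : ℝ → ℝ) (x : ℝ) : ℝ :=
  iteratedDeriv (rlOrder σ) (leftInt a (rlOrder σ - σ) w) x

/-- The Hölder class `H(Ω̄)`, the union of the `H^λ(Ω̄)` over `λ > 0`. -/
def MemHolder (a b : ℝ) (g : ℝ → ℝ) : Prop :=
  ∃ l C : ℝ≥0, 0 < l ∧ HolderOnWith C l g (Icc a b)

/-- `H^λ_0(Ω̄)`: Hölder functions of exponent `λ` on `[a, b]` that vanish at both endpoints. -/
def MemHolderZero (a b : ℝ) (l : ℝ≥0) (g : ℝ → ℝ) : Prop :=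
  (∃ C : ℝ≥0, HolderOnWith C l g (Icc a b)) ∧ g a = 0 ∧ g b = 0

/-- The space `H^*(Ω)`: functions `g(x) / ((x - a)^(1 - ε₁) (b - x)^(1 - ε₂))` on `Ω` with
`ε₁, ε₂ > 0` and `g ∈ H^λ_0(Ω̄)` for some `0 < λ ≤ 1`. -/
def MemHStar (a b : ℝ) (f : ℝ → ℝ) : Prop :=
  ∃ (l : ℝ≥0) (e₁ e₂ : ℝ) (g : ℝ → ℝ), 0 < l ∧ l ≤ 1 ∧ 0 < e₁ ∧ 0 < e₂ ∧ MemHolderZero a b l g ∧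
    ∀ x ∈ Ioo a b, f x = g x / ((x - a) ^ (1 - e₁) * (b - x) ^ (1 - e₂))

/-- The square of the norm of `Ĥ^s(ℝ)`, namely `‖w‖²_{L²} + ‖|2πξ|^s ŵ‖²_{L²}`, as an extended
nonnegative number. It is used only for `w ∈ L¹(ℝ) ∩ L²(ℝ)`. -/
def sobolevNormSq (s : ℝ) (w : ℝ → ℝ) : ℝ≥0∞ :=
  (∫⁻ x, ‖w x‖ₑ ^ 2) +
    ∫⁻ ξ : ℝ, ENNReal.ofReal (|2 * Real.pi * ξ| ^ (2 * s)) * ‖𝓕 (fun x => (w x : ℂ)) ξ‖ₑ ^ 2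

/-- The space `Ĥ^s_0(Ω)`: the closure of `C_0^∞(Ω)` in the norm of `Ĥ^s(ℝ)`, functions on `Ω` being
extended by zero to `ℝ`. -/
def MemSobolevZero (a b s : ℝ) (u : ℝ → ℝ) : Prop :=
  MemLp ((Ioo a b).indicator u) 2 volume ∧
    ∀ ε : ℝ≥0∞, 0 < ε → ∃ φ : ℝ → ℝ, ContDiff ℝ ∞ φ ∧ HasCompactSupport φ ∧
      tsupport φ ⊆ Ioo a b ∧ sobolevNormSq s (fun x => (Ioo a b).indicator u x - φ x) < ε

/-- The standing conditions on the data `α, β, μ, k, p, q, f`. -/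
structure MainConditions (a b α β μ : ℝ) (k p q f : ℝ → ℝ) : Prop where
  alpha_pos : 0 < α
  alpha_lt_one : α < 1
  beta_pos : 0 < β
  beta_lt_one : β < 1
  alpha_add_beta : α + β = 1
  mu_pos : 0 < μ
  mu_lt_one : μ < 1
  f_mem : MemHStar a b f
  p_contDiff : ContDiffOn ℝ 1 p (Icc a b)
  q_contDiff : ContDiffOn ℝ 1 q (Icc a b)
  k_contDiff : ContDiffOn ℝ 1 k (Icc a b)
  p_deriv_holder : MemHolder a b (derivWithin p (Icc a b))
  k_deriv_holder : MemHolder a b (derivWithin k (Icc a b))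
  k_pos : ∀ x ∈ Icc a b, 0 < k x
  coercive : ∀ x ∈ Icc a b,
    0 ≤ q x / k x - 1 / 2 * derivWithin (fun y => p y / k y) (Icc a b) x
  small : Real.pi * (1 - μ ^ 2) * Real.cot ((1 + μ) * Real.pi / 2) +
    4 * (b - a) * (eLpNorm (fun x => derivWithin k (Icc a b) x / k x) ∞
      (volume.restrict (Ioo a b))).toReal < 0

/-- The flux `(α ₐD_x^{-(1-μ)} + β ₓD_b^{-(1-μ)}) Du`. -/
def flux (a b α β μ : ℝ) (u : ℝ → ℝ) (x : ℝ) : ℝ :=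
  α * leftInt a (1 - μ) (deriv u) x + β * rightInt b (1 - μ) (deriv u) x

/-- `[L(u)](x) = -D k(x) (α ₐD_x^{-(1-μ)} + β ₓD_b^{-(1-μ)}) Du + p(x) Du + q(x) u(x)`. -/
def opL (a b α β μ : ℝ) (k p q u : ℝ → ℝ) (x : ℝ) : ℝ :=
  -deriv (fun y => k y * flux a b α β μ u y) x + p x * deriv u x + q x * u x

/-- `u` is a true (classical) solution of `L(u) = f` in `Ω`, `u(a) = u(b) = 0`. -/
structure IsTrueSolution (a b α β μ : ℝ) (k p q f u : ℝ → ℝ) : Prop where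
  ac : AbsolutelyContinuousOnInterval u a b
  left_zero : u a = 0
  right_zero : u b = 0
  contDiff : ContDiffOn ℝ 1 u (Ioo a b)
  flux_contDiff : ContDiffOn ℝ 1 (flux a b α β μ u) (Ioo a b)
  eqn : ∀ x ∈ Ioo a b, opL a b α β μ k p q u x = f x

/-- The conditions that determine the exponents `p, q` of the explicit solution. -/
def ExponentConditions (α β μ p q : ℝ) : Prop :=
  -1 < p ∧ p < 0 ∧ -1 < q ∧ q < 0 ∧ p + q = -(1 - μ) ∧
    α * Real.sin (q * Real.pi) = β * Real.sin (p * Real.pi)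

/-- The constant of the explicit solution. -/
def exampleConst (β μ p q : ℝ) : ℝ :=
  (-p - 1 + μ) * (-p + μ) * Real.Gamma (1 - μ) /
    (μ * (1 + μ) * β * Real.Gamma (2 - μ + p) * Real.Gamma (q + 2))

/-- The explicit solution `c (x - a)^(p+1) (b - x)^(q+1)`. -/
def exampleSolution (a b β μ p q : ℝ) (x : ℝ) : ℝ :=
  exampleConst β μ p q * (x - a) ^ (p + 1) * (b - x) ^ (q + 1)

/-- The threshold for `β / α` attached to `t₀`. -/
def ratioBound (μ t₀ : ℝ) : ℝ :=
  Real.cot ((2 - t₀) * Real.pi) * Real.sin ((1 - μ) * Real.pi) - Real.cos ((1 - μ) * Real.pi)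

end FDARE

end

noncomputable section

namespace FDARE

/-! The whole argument rests on one exact computation. Let w(s) = (s-a)^p (b-s)^q, and let k(x,s) be
α(x-s)^(-μ) to the left of x and β(s-x)^(-μ) to the right. Because p + q = μ - 1, the left Abel
integral of w is a multiple of an incomplete Beta integral over [0, x-a]; by reflection the right
one is a multiple of the same integral over [x-a, b-a]. By the reflection formula for Γ, the sine
condition on p, q is what makes the two coefficients equal, so the operator Tφ(x) = ∫ k(x,s) w(s)
φ(s) ds sends 1 to a positive constant (`abel_weight_eq_const`). Since k(x,s)(x-s) has x-derivative
(1-μ)k(x,s), the difference x·Tφ - T(sφ) is an antiderivative of (1-μ)Tφ. Hence T is triangular on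
polynomials with nonzero diagonal (`weightedAbel_id_mul`, `exists_weightedAbel_eq_pow`).

Existence: u' is w times a polynomial of degree one, so the flux of u is affine, and c is the
constant that makes its slope 1.

Uniqueness: transposing the kernel swaps α with β, hence p with q. Testing the affine flux of a
solution against the swapped weight times φ, where the transposed operator sends φ to xⁿ, determines
every moment of the derivative once the additive constant of the flux is known, and the boundary
values determine that constant. Integration by parts and Weierstrass approximation finish
(`IsTrueSolution.eqOn`).

Failure at order t: sin(ν-r)/sin r is decreasing in r, and both β/α and ρ are values of it, so β/α <
ρ means p + 1 < t₀ - 1 < t - 1. Near a, u has exact order (x-a)^(p+1), while a left integral of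
order t of an element of H^* is O((x-a)^(t-1+e)) with e > 0 (`not_ae_eq_leftInt`). If the derivative
of order t were in L¹, lower derivatives of the fractional integral of u would be bounded; but one
of them blows up, at a if t < 2 and at b if t ≥ 2 (`not_integrableOn_leftDeriv`).

Sobolev membership: u is truncated smoothly according to its own level δ. The discarded part is O(δ)
uniformly, and its Fourier transform is O((1+|ξ|)^(-(1+μ))) uniformly in δ, so dominated convergence
applies (`memSobolevZero_jacobi`). -/

/-! ### The exponents p, q and the threshold for β/α. -/

lemma cot_mul_sin_sub_cos {x ν : ℝ} (hx : Real.sin x ≠ 0) :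
    Real.cot x * Real.sin ν - Real.cos ν = Real.sin (ν - x) / Real.sin x := by
  rw [Real.cot_eq_cos_div_sin, Real.sin_sub]
  field_simp

/-- After cross-multiplication the difference of two values is sin ν · sin(y - x), which is positive
on this range. -/
lemma sin_sub_div_sin_strictAnti {ν : ℝ} (hν₀ : 0 < ν) (hν₁ : ν < Real.pi) :
    StrictAntiOn (fun x => Real.sin (ν - x) / Real.sin x) (Ioo 0 ν) := by
  intro x hx y hy hxy
  have hsx : 0 < Real.sin x := Real.sin_pos_of_pos_of_lt_pi hx.1 (hx.2.trans hν₁)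
  have hsy : 0 < Real.sin y := Real.sin_pos_of_pos_of_lt_pi hy.1 (hy.2.trans hν₁)
  have hs : 0 < Real.sin ν * Real.sin (y - x) :=
    mul_pos (Real.sin_pos_of_pos_of_lt_pi hν₀ hν₁)
      (Real.sin_pos_of_pos_of_lt_pi (sub_pos.2 hxy) (by linarith [hx.1, hy.2]))
  simp only
  rw [div_lt_div_iff₀ hsy hsx]
  have key : Real.sin (ν - x) * Real.sin y - Real.sin (ν - y) * Real.sin x
      = Real.sin ν * Real.sin (y - x) := by
    simp only [Real.sin_sub]; ring
  linarith

lemma ratioBound_eq {μ t₀ : ℝ} (hμ : 0 < μ) (h : 1 + μ < t₀) (h' : t₀ < 2) :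
    ratioBound μ t₀ = Real.sin ((1 - μ) * Real.pi - (2 - t₀) * Real.pi) /
      Real.sin ((2 - t₀) * Real.pi) := by
  refine cot_mul_sin_sub_cos (Real.sin_pos_of_pos_of_lt_pi ?_ ?_).ne'
  · exact mul_pos (by linarith) Real.pi_pos
  · nlinarith [Real.pi_pos]

lemma ratioBound_pos {μ t₀ : ℝ} (hμ : 0 < μ) (h : 1 + μ < t₀) (h' : t₀ < 2) :
    0 < ratioBound μ t₀ := by
  rw [ratioBound_eq hμ h h']
  have hpi := Real.pi_pos
  refine div_pos (Real.sin_pos_of_pos_of_lt_pi ?_ ?_) (Real.sin_pos_of_pos_of_lt_pi ?_ ?_) <;>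
    nlinarith

lemma ExponentConditions.mem {α β μ p q : ℝ} (h : ExponentConditions α β μ p q) :
    -p * Real.pi ∈ Ioo 0 ((1 - μ) * Real.pi) := by
  obtain ⟨_, h1, _, h2, h3, -⟩ := h
  have hpi := Real.pi_pos
  constructor
  · nlinarith
  · exact mul_lt_mul_of_pos_right (by linarith) hpi

lemma ExponentConditions.ratio {α β μ p q : ℝ} (hα : 0 < α)
    (hμ₀ : 0 < μ) (h : ExponentConditions α β μ p q) :
    Real.sin ((1 - μ) * Real.pi - -p * Real.pi) / Real.sin (-p * Real.pi) = β / α := by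
  have hm := h.mem
  have hs : 0 < Real.sin (-p * Real.pi) :=
    Real.sin_pos_of_pos_of_lt_pi hm.1 (hm.2.trans (by nlinarith [Real.pi_pos]))
  obtain ⟨_, h1, _, h2, h3, h4⟩ := h
  rw [div_eq_div_iff hs.ne' hα.ne']
  have e1 : (1 - μ) * Real.pi - -p * Real.pi = -(q * Real.pi) := by
    have : 1 - μ = -p - q := by linarith
    rw [this]; ring
  rw [e1, Real.sin_neg, neg_mul p, Real.sin_neg]
  linarith

lemma ExponentConditions.unique {α β μ p q p' q' : ℝ} (hα : 0 < α)
    (hμ₀ : 0 < μ) (hμ₁ : μ < 1) (h : ExponentConditions α β μ p q)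
    (h' : ExponentConditions α β μ p' q') : p' = p ∧ q' = q := by
  have hpi := Real.pi_pos
  have e := (sin_sub_div_sin_strictAnti (ν := (1 - μ) * Real.pi)
    (mul_pos (by linarith) hpi) (by nlinarith)).injOn h.mem h'.mem
    ((h.ratio hα hμ₀).trans (h'.ratio hα hμ₀).symm)
  have e2 : p' = p := by
    have := mul_right_cancel₀ hpi.ne' e
    linarith
  exact ⟨e2, by linarith [h.2.2.2.2.1, h'.2.2.2.2.1]⟩

/-- Here the smallness of β/α is used. The ratio and the threshold are the values of one decreasing
function at -pπ and (2-t₀)π, so the order of the arguments is reversed. -/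
lemma ExponentConditions.lt_of_ratio {α β μ p q t₀ : ℝ} (hα : 0 < α)
    (hμ₀ : 0 < μ) (ht : 1 + μ < t₀) (ht' : t₀ < 2)
    (h : ExponentConditions α β μ p q) (hr : β / α < ratioBound μ t₀) : p < t₀ - 2 := by
  have hpi := Real.pi_pos
  rw [ratioBound_eq hμ₀ ht ht', ← h.ratio hα hμ₀] at hr
  have := ((sin_sub_div_sin_strictAnti (ν := (1 - μ) * Real.pi)
    (mul_pos (by linarith) hpi) (by nlinarith)).lt_iff_gt h.mem
    (show (2 - t₀) * Real.pi ∈ Ioo 0 ((1 - μ) * Real.pi) from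
      ⟨mul_pos (by linarith) hpi, mul_lt_mul_of_pos_right (by linarith) hpi⟩)).1 hr
  have := lt_of_mul_lt_mul_right this hpi.le
  linarith

lemma exists_exponentConditions {α β μ : ℝ} (hα : 0 < α) (hβ : 0 < β)
    (hμ₀ : 0 < μ) (hμ₁ : μ < 1) : ∃ p q, ExponentConditions α β μ p q := by
  have hpi := Real.pi_pos
  -- With r = -p and q = -(1-μ-r), the equation F r = 0 is the sine condition; F changes sign
  -- between 0 and 1-μ.
  set F : ℝ → ℝ := fun r => α * Real.sin ((1 - μ - r) * Real.pi) - β * Real.sin (r * Real.pi)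
  have hF : Continuous F := by fun_prop
  have hs : 0 < Real.sin ((1 - μ) * Real.pi) :=
    Real.sin_pos_of_pos_of_lt_pi (mul_pos (by linarith) hpi) (by nlinarith)
  have h0 : 0 < F 0 := by simpa [F] using mul_pos hα hs
  have h1 : F (1 - μ) < 0 := by simpa [F] using mul_pos hβ hs
  obtain ⟨r, hr, hr0⟩ := intermediate_value_Ioo' (by linarith : (0 : ℝ) ≤ 1 - μ)
    hF.continuousOn (show (0 : ℝ) ∈ Ioo (F (1 - μ)) (F 0) from ⟨h1, h0⟩)
  refine ⟨-r, -(1 - μ - r), by linarith [hr.2], by linarith [hr.1], by linarith [hr.1],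
    by linarith [hr.2], by ring, ?_⟩
  simp only [F] at hr0
  rw [neg_mul, neg_mul, Real.sin_neg, Real.sin_neg]
  linarith

/-! ### Admissibility of the data. -/

lemma memHStar_neg_one {a b : ℝ} : MemHStar a b (fun _ => -1) := by
  -- For ε₁ = ε₂ = 1/2 the denominator is √((x-a)(b-x)), so the numerator must be its negative:
  -- Hölder of exponent 1/2, as the square root of a Lipschitz function.
  refine ⟨1 / 2, 1 / 2, 1 / 2, fun x => -√((x - a) * (b - x)), by norm_num, ?_, by norm_num,
    by norm_num, ⟨?_, by simp, by simp⟩, ?_⟩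
  · rw [div_le_one (by norm_num)]; norm_num
  · obtain ⟨C, hC⟩ : ∃ C : ℝ≥0, ∀ x ∈ Icc a b, ∀ y ∈ Icc a b,
        |(x - a) * (b - x) - (y - a) * (b - y)| ≤ C * |x - y| := by
      refine ⟨Real.toNNReal (|b - a| + |b - a|), fun x hx y hy => ?_⟩
      rw [Real.coe_toNNReal _ (by positivity)]
      have : (x - a) * (b - x) - (y - a) * (b - y) = ((b - x) - (y - a)) * (x - y) := by ring
      rw [this, abs_mul]
      gcongr
      refine (abs_sub _ _).trans (add_le_add ?_ ?_)
      · exact abs_le_abs_of_nonneg (by linarith [hx.2]) (by linarith [hx.1])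
      · exact abs_le_abs_of_nonneg (by linarith [hy.1]) (by linarith [hy.2])
    refine ⟨NNReal.sqrt C, fun x hx y hy => ?_⟩
    rw [edist_dist, edist_dist, dist_neg_neg, Real.dist_eq, Real.dist_eq]
    have h1 : |√((x - a) * (b - x)) - √((y - a) * (b - y))| ≤ √C * √|x - y| := by
      rw [← Real.sqrt_mul (NNReal.coe_nonneg C)]
      refine le_trans ?_ (Real.sqrt_le_sqrt (hC x hx y hy))
      apply Real.abs_le_sqrt
      have hX : 0 ≤ (x - a) * (b - x) :=
        mul_nonneg (by linarith [hx.1]) (by linarith [hx.2])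
      have hY : 0 ≤ (y - a) * (b - y) :=
        mul_nonneg (by linarith [hy.1]) (by linarith [hy.2])
      set X := (x - a) * (b - x)
      set Y := (y - a) * (b - y)
      have e : |X - Y| = |√X - √Y| * (√X + √Y) := by
        rw [← abs_of_nonneg (add_nonneg (Real.sqrt_nonneg X) (Real.sqrt_nonneg Y)), ← abs_mul]
        congr 1
        nlinarith [Real.mul_self_sqrt hX, Real.mul_self_sqrt hY]
      rw [e, ← sq_abs, sq]
      gcongr
      exact (abs_sub _ _).trans (by
        rw [abs_of_nonneg (Real.sqrt_nonneg _), abs_of_nonneg (Real.sqrt_nonneg _)])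
    calc ENNReal.ofReal |√((x - a) * (b - x)) - √((y - a) * (b - y))|
        ≤ ENNReal.ofReal (√C * √|x - y|) := ENNReal.ofReal_le_ofReal h1
      _ = _ := by
          rw [ENNReal.ofReal_mul (Real.sqrt_nonneg _), Real.sqrt_eq_rpow |x - y|,
            ENNReal.ofReal_rpow_of_nonneg (abs_nonneg _) (by positivity)]
          rw [← Real.coe_sqrt, ENNReal.ofReal_coe_nnreal]
          norm_num
  · intro x hx
    have h1 : 0 < x - a := by linarith [hx.1]
    have h2 : 0 < b - x := by linarith [hx.2]
    simp only
    rw [Real.sqrt_eq_rpow, show (1 : ℝ) - 1 / 2 = 1 / 2 by norm_num, Real.mul_rpow h1.le h2.le,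
      neg_div, div_self (by positivity)]

lemma mainConditions_example {a b α β μ : ℝ} (hμ₀ : 0 < μ) (hμ₁ : μ < 1)
    (hα : 0 < α) (hβ : 0 < β) (hαβ : α + β = 1) :
    MainConditions a b α β μ (fun _ => 1) (fun _ => 0) (fun _ => 0) (fun _ => -1) where
  alpha_pos := hα
  alpha_lt_one := by linarith
  beta_pos := hβ
  beta_lt_one := by linarith
  alpha_add_beta := hαβ
  mu_pos := hμ₀
  mu_lt_one := hμ₁
  f_mem := memHStar_neg_one
  p_contDiff := contDiffOn_const
  q_contDiff := contDiffOn_const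
  k_contDiff := contDiffOn_const
  p_deriv_holder := ⟨1, 0, by norm_num, fun x _ y _ => by simp⟩
  k_deriv_holder := ⟨1, 0, by norm_num, fun x _ y _ => by simp⟩
  k_pos := fun _ _ => one_pos
  coercive := fun x _ => by simp
  small := by
    have hpi := Real.pi_pos
    have hcot : Real.cot ((1 + μ) * Real.pi / 2) < 0 := by
      rw [Real.cot_eq_cos_div_sin]
      refine div_neg_of_neg_of_pos (Real.cos_neg_of_pi_div_two_lt_of_lt ?_ ?_)
        (Real.sin_pos_of_pos_of_lt_pi ?_ ?_) <;> nlinarith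
    have : (fun x => derivWithin (fun _ : ℝ => (1 : ℝ)) (Icc a b) x / 1) = fun _ => 0 := by
      ext x; simp
    simp only [this, eLpNorm_zero', ENNReal.toReal_zero, mul_zero, add_zero]
    exact mul_neg_of_pos_of_neg (mul_pos hpi (by nlinarith)) hcot

/-! ### Parametric integrals ∫ m(y) (B - zy)^r dy and the Beta integral. -/

lemma sub_mul_mem_Icc {B z c d y : ℝ} (hz : z ≤ c) (hd : d ≤ z)
    (hy : y ∈ Icc (0 : ℝ) 1) : B - z * y ∈ Icc (min B (B - c)) (B + |d|) := by
  constructor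
  · rcases le_total 0 c with h | h
    · exact (min_le_right _ _).trans (by nlinarith [hy.1, hy.2])
    · exact (min_le_left _ _).trans (by nlinarith [hy.1, hy.2])
  · nlinarith [hy.1, hy.2, abs_nonneg d, neg_abs_le d]

lemma sub_mul_pos {B z y : ℝ} (hB : 0 < B) (hz : z < B) (hy : y ∈ Icc (0 : ℝ) 1) :
    0 < B - z * y :=
  (lt_min hB (sub_pos.2 hz)).trans_le (sub_mul_mem_Icc le_rfl le_rfl hy).1

lemma continuousOn_sub_mul_rpow {B z : ℝ} (hB : 0 < B) (hz : z < B) (r : ℝ) :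
    ContinuousOn (fun y : ℝ => (B - z * y) ^ r) (Icc 0 1) := by
  refine ContinuousOn.rpow_const (by fun_prop) fun y hy => Or.inl (sub_mul_pos hB hz hy).ne'

lemma intervalIntegrable_mul_sub_mul_rpow {m : ℝ → ℝ} (hm : IntervalIntegrable m volume 0 1)
    {B z : ℝ} (hB : 0 < B) (hz : z < B) (r : ℝ) :
    IntervalIntegrable (fun y => m y * (B - z * y) ^ r) volume 0 1 := by
  refine hm.mul_continuousOn ?_
  rw [uIcc_of_le zero_le_one]
  exact continuousOn_sub_mul_rpow hB hz r

/-- For z in a small neighbourhood below some c < B, the quantity B - zy stays in a compact subset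
of (0, ∞). The derivative is thus dominated by a multiple of |m|, and m may be as singular as
integrability permits. -/
lemma hasDerivAt_integral_mul_sub_mul_rpow {m : ℝ → ℝ} (hm : IntervalIntegrable m volume 0 1)
    {B z : ℝ} (hB : 0 < B) (hz : z < B) (r : ℝ) :
    HasDerivAt (fun z => ∫ y in (0 : ℝ)..1, m y * (B - z * y) ^ r)
      (-r * ∫ y in (0 : ℝ)..1, (m y * y) * (B - z * y) ^ (r - 1)) z := by
  obtain ⟨c, hzc, hcB⟩ := exists_between hz
  have hpos : 0 < min B (B - c) := lt_min hB (sub_pos.2 hcB)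
  obtain ⟨M, hM⟩ := (isCompact_Icc (a := min B (B - c)) (b := B + |z - 1|)).exists_bound_of_continuousOn
    (f := fun t : ℝ => t ^ (r - 1))
    (ContinuousOn.rpow_const continuousOn_id fun t ht => Or.inl (hpos.trans_le ht.1).ne')
  have hs : Ioo (z - 1) c ∈ nhds z := Ioo_mem_nhds (by linarith) hzc
  have hu : uIoc (0 : ℝ) 1 ⊆ Icc 0 1 := by
    rw [uIoc_of_le zero_le_one]; exact Ioc_subset_Icc_self
  have hmy : IntervalIntegrable (fun y => m y * y) volume 0 1 :=
    hm.mul_continuousOn continuousOn_id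
  have key := (intervalIntegral.hasDerivAt_integral_of_dominated_loc_of_deriv_le
    (F := fun z y => m y * (B - z * y) ^ r)
    (F' := fun z y => m y * (-(1 * y) * r * (B - z * y) ^ (r - 1)))
    (bound := fun y => ‖m y‖ * (|r| * M)) (a := 0) (b := 1) (μ := volume) hs ?_
    (intervalIntegrable_mul_sub_mul_rpow hm hB hz r) ?_ ?_ ?_ ?_).2
  · refine key.congr_deriv ?_
    rw [← intervalIntegral.integral_const_mul]
    congr 1; ext y; ring
  · filter_upwards [Iio_mem_nhds hz] with x hx
    exact (intervalIntegrable_mul_sub_mul_rpow hm hB hx r).def'.aestronglyMeasurable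
  · have := ((intervalIntegrable_mul_sub_mul_rpow hmy hB hz (r - 1)).const_mul (-r))
    refine this.def'.aestronglyMeasurable.congr (Filter.Eventually.of_forall fun y => ?_)
    simp only; ring
  · refine Filter.Eventually.of_forall fun y hy x hx => ?_
    have hy := hu hy
    have h1 := hM (B - x * y) (sub_mul_mem_Icc hx.2.le hx.1.le hy)
    rw [norm_mul, norm_mul, norm_mul, norm_neg, one_mul, Real.norm_of_nonneg hy.1,
      Real.norm_eq_abs r]
    have : y * |r| ≤ |r| := mul_le_of_le_one_left (abs_nonneg r) hy.2
    gcongr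
  · exact hm.norm.mul_const _
  · refine Filter.Eventually.of_forall fun y hy x hx => ?_
    have hy := hu hy
    have h0 := sub_mul_pos hB (hx.2.trans hcB) hy
    have := (((hasDerivAt_id x).mul_const y).const_sub B).rpow_const (p := r) (Or.inl h0.ne')
    simpa using this.const_mul (m y)

/-- Differentiation replaces m by y·m and r by r - 1, so the induction runs over all m and r at
once. -/
lemma contDiffOn_integral_mul_sub_mul_rpow {B : ℝ} (hB : 0 < B) (n : ℕ) :
    ∀ {m : ℝ → ℝ}, IntervalIntegrable m volume 0 1 → ∀ r : ℝ,
      ContDiffOn ℝ n (fun z => ∫ y in (0 : ℝ)..1, m y * (B - z * y) ^ r) (Iio B) := by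
  induction n with
  | zero =>
    intro m hm r
    exact contDiffOn_zero.2 fun z hz =>
      (hasDerivAt_integral_mul_sub_mul_rpow hm hB hz r).continuousAt.continuousWithinAt
  | succ n ih =>
    intro m hm r
    rw [Nat.cast_succ, contDiffOn_succ_iff_deriv_of_isOpen isOpen_Iio]
    refine ⟨fun z hz => (hasDerivAt_integral_mul_sub_mul_rpow hm hB hz
      r).differentiableAt.differentiableWithinAt, by simp, ?_⟩
    have hmy : IntervalIntegrable (fun y => m y * y) volume 0 1 :=
      hm.mul_continuousOn continuousOn_id
    exact (contDiffOn_const.mul (ih hmy (r - 1))).congr fun z hz =>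
      (hasDerivAt_integral_mul_sub_mul_rpow hm hB hz r).deriv

lemma cpow_mul_one_sub_cpow {u v y : ℝ} (hy : y ∈ Icc (0 : ℝ) 1) :
    (y : ℂ) ^ ((v : ℂ) - 1) * (1 - (y : ℂ)) ^ ((u : ℂ) - 1) =
      (((1 - y) ^ (u - 1) * y ^ (v - 1) : ℝ) : ℂ) := by
  rw [Complex.ofReal_mul, Complex.ofReal_cpow hy.1, Complex.ofReal_cpow (sub_nonneg.2 hy.2)]
  push_cast
  ring

lemma intervalIntegrable_rpow_mul_one_sub_rpow {u v : ℝ} (hu : 0 < u) (hv : 0 < v) :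
    IntervalIntegrable (fun y : ℝ => (1 - y) ^ (u - 1) * y ^ (v - 1)) volume 0 1 := by
  have h := (Complex.betaIntegral_convergent (u := v) (v := u) (by simpa) (by simpa)).norm
  refine h.congr fun y hy => ?_
  rw [uIoc_of_le zero_le_one] at hy
  simp only [cpow_mul_one_sub_cpow (Ioc_subset_Icc_self hy), Complex.norm_real, Real.norm_eq_abs]
  exact abs_of_nonneg (mul_nonneg (Real.rpow_nonneg (sub_nonneg.2 hy.2) _)
    (Real.rpow_nonneg hy.1.le _))

lemma integral_rpow_mul_one_sub_rpow {u v : ℝ} (hu : 0 < u) (hv : 0 < v) :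
    ∫ y in (0 : ℝ)..1, (1 - y) ^ (u - 1) * y ^ (v - 1) = ProbabilityTheory.beta u v := by
  rw [ProbabilityTheory.beta_eq_betaIntegralReal u v hu hv, Complex.betaIntegral_symm,
    Complex.betaIntegral]
  have : ∫ y in (0 : ℝ)..1, (y : ℂ) ^ ((v : ℂ) - 1) * (1 - (y : ℂ)) ^ ((u : ℂ) - 1)
      = ∫ y in (0 : ℝ)..1, (((1 - y) ^ (u - 1) * y ^ (v - 1) : ℝ) : ℂ) := by
    refine intervalIntegral.integral_congr fun y hy => ?_
    rw [uIcc_of_le zero_le_one] at hy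
    exact cpow_mul_one_sub_cpow hy
  rw [this, intervalIntegral.integral_ofReal, Complex.ofReal_re]

/-! ### Abel integrals of the Jacobi weight. -/

/-- The substitution s = a + (x-a)y separates the singular power at a from a parametric integral
that is smooth in x - a < b - a. -/
lemma integral_left_eq_rpow_mul {a x : ℝ} (hx : a < x) (b σ p r : ℝ) :
    ∫ s in a..x, (x - s) ^ (σ - 1) * ((s - a) ^ p * (b - s) ^ r) =
      (x - a) ^ (σ + p) *
        ∫ y in (0 : ℝ)..1, ((1 - y) ^ (σ - 1) * y ^ p) * (b - a - (x - a) * y) ^ r := by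
  have hz : 0 < x - a := sub_pos.2 hx
  have h := intervalIntegral.integral_comp_mul_add (a := 0) (b := 1)
    (fun s => (x - s) ^ (σ - 1) * ((s - a) ^ p * (b - s) ^ r)) hz.ne' a
  rw [mul_zero, zero_add, mul_one, sub_add_cancel, smul_eq_mul, eq_inv_mul_iff_mul_eq₀ hz.ne'] at h
  rw [← h, show σ + p = 1 + (σ - 1) + p by ring, Real.rpow_add hz, Real.rpow_add hz,
    Real.rpow_one, mul_assoc, mul_assoc]
  congr 1
  rw [← mul_assoc, ← intervalIntegral.integral_const_mul]
  refine intervalIntegral.integral_congr fun y hy => ?_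
  rw [uIcc_of_le zero_le_one] at hy
  have e1 : x - ((x - a) * y + a) = (x - a) * (1 - y) := by ring
  have e2 : (x - a) * y + a - a = (x - a) * y := by ring
  have e3 : b - ((x - a) * y + a) = b - a - (x - a) * y := by ring
  simp only [e1, e2, e3]
  rw [Real.mul_rpow hz.le (sub_nonneg.2 hy.2), Real.mul_rpow hz.le hy.1]
  ring

lemma intervalIntegrable_left {a b x σ p : ℝ} (hx : a < x) (hxb : x < b) (hσ : 0 < σ)
    (hp : -1 < p) (r : ℝ) :
    IntervalIntegrable (fun s => (x - s) ^ (σ - 1) * ((s - a) ^ p * (b - s) ^ r)) volume a x := by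
  have hz : 0 < x - a := sub_pos.2 hx
  have h0 := intervalIntegrable_rpow_mul_one_sub_rpow hσ (by linarith : 0 < p + 1)
  rw [add_sub_cancel_right] at h0
  have h1 := (((intervalIntegrable_mul_sub_mul_rpow (B := b - a) (z := x - a) h0 (by linarith)
    (by linarith) r).const_mul ((x - a) ^ (σ - 1) * (x - a) ^ p)).comp_mul_left
      (c := (x - a)⁻¹)).comp_sub_right a
  rw [zero_div, one_div, inv_inv, zero_add, sub_add_cancel] at h1
  refine h1.congr fun s hs => ?_
  rw [uIoc_of_le hx.le] at hs
  have hsa : 0 ≤ (x - a)⁻¹ * (s - a) := mul_nonneg (inv_nonneg.2 hz.le) (by linarith [hs.1])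
  have hs1 : 0 ≤ 1 - (x - a)⁻¹ * (s - a) := by
    rw [sub_nonneg, inv_mul_le_one₀ hz]; linarith [hs.2]
  rw [show (x - s) = (x - a) * (1 - (x - a)⁻¹ * (s - a)) by field_simp; ring,
    Real.mul_rpow hz.le hs1, show (s - a) ^ p = ((x - a) * ((x - a)⁻¹ * (s - a))) ^ p by
      congr 1; field_simp, Real.mul_rpow hz.le hsa,
    show b - a - (x - a) * ((x - a)⁻¹ * (s - a)) = b - s by field_simp; ring]
  ring

/-- This is the degenerate hypergeometric identity ₂F₁(1-q, p+1; 1-q; z/B) = (1 - z/B)^(-(p+1)); the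
parameters coincide because p + q = μ - 1. The integral χ satisfies (p+1)χ = (B-z)χ', so (B-z)^(p+1)
χ is constant and can be evaluated at z = 0. -/
lemma integral_beta_mul_rpow {μ p q B z : ℝ} (hμ : μ < 1) (hp : -1 < p) (hpq : p + q = -(1 - μ))
    (hB : 0 < B) (hz₀ : 0 ≤ z) (hz : z < B) :
    ∫ y in (0 : ℝ)..1, ((1 - y) ^ (-μ) * y ^ p) * (B - z * y) ^ (q - 1) =
      ProbabilityTheory.beta (1 - μ) (p + 1) * B ^ (μ - 1) * (B - z) ^ (-p - 1) := by
  have hm : IntervalIntegrable (fun y : ℝ => (1 - y) ^ (-μ) * y ^ p) volume 0 1 := by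
    have := intervalIntegrable_rpow_mul_one_sub_rpow (sub_pos.2 hμ) (by linarith : 0 < p + 1)
    rwa [add_sub_cancel_right, sub_sub_cancel_left] at this
  have hmy : IntervalIntegrable (fun y : ℝ => (1 - y) ^ (-μ) * y ^ p * y) volume 0 1 :=
    hm.mul_continuousOn continuousOn_id
  set χ : ℝ → ℝ := fun z => ∫ y in (0 : ℝ)..1, ((1 - y) ^ (-μ) * y ^ p) * (B - z * y) ^ (q - 1)
  have hχ : ∀ z < B, HasDerivAt χ _ z := fun z hz =>
    hasDerivAt_integral_mul_sub_mul_rpow hm hB hz (q - 1)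
  have hode : ∀ z < B, (p + 1) * χ z + (q - 1) * (B - z) *
      ∫ y in (0 : ℝ)..1, ((1 - y) ^ (-μ) * y ^ p * y) * (B - z * y) ^ (q - 1 - 1) = 0 := by
    intro z hz
    have hi1 := (intervalIntegrable_mul_sub_mul_rpow hm hB hz (q - 1)).const_mul (p + 1)
    have hi2 := (intervalIntegrable_mul_sub_mul_rpow hmy hB hz (q - 1 - 1)).const_mul
      ((q - 1) * (B - z))
    -- The combination in the differential equation is the integral of an exact derivative. Its
    -- primitive vanishes at y = 0 and y = 1, and μ = p + q + 1 makes the coefficients match.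
    have := intervalIntegral.integral_eq_sub_of_hasDerivAt_of_le zero_le_one
      (f := fun y : ℝ => (1 - y) ^ (1 - μ) * y ^ (p + 1) * (B - z * y) ^ (q - 1)) ?_ ?_
      (hi1.add hi2)
    · rw [← intervalIntegral.integral_const_mul, ← intervalIntegral.integral_const_mul,
        ← intervalIntegral.integral_add hi1 hi2]
      refine this.trans ?_
      rw [sub_self, Real.zero_rpow (by linarith), Real.zero_rpow (by linarith)]
      ring
    · refine ContinuousOn.mul (ContinuousOn.mul ?_ ?_) (continuousOn_sub_mul_rpow hB hz _)
      · exact ContinuousOn.rpow_const (by fun_prop) fun y _ => Or.inr (by linarith)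
      · exact ContinuousOn.rpow_const (by fun_prop) fun y _ => Or.inr (by linarith)
    · intro y hy
      have h1 : 0 < 1 - y := sub_pos.2 hy.2
      have h2 : 0 < B - z * y := sub_mul_pos hB hz (Ioo_subset_Icc_self hy)
      have d1 := ((hasDerivAt_id y).const_sub 1).rpow_const (p := 1 - μ) (Or.inl h1.ne')
      have d2 := (hasDerivAt_id y).rpow_const (p := p + 1) (Or.inl hy.1.ne')
      have d3 := (((hasDerivAt_id y).const_mul z).const_sub B).rpow_const (p := q - 1)
        (Or.inl h2.ne')
      refine ((d1.mul d2).mul d3).congr_deriv ?_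
      simp only [id, Pi.mul_apply, sub_sub_cancel_left, add_sub_cancel_right]
      rw [show 1 - μ = -μ + 1 by ring, Real.rpow_add_one h1.ne', Real.rpow_add_one hy.1.ne',
        show q - 1 = q - 1 - 1 + 1 by ring, Real.rpow_add_one h2.ne', add_sub_cancel_right]
      have hμ' : μ = p + q + 1 := by linarith
      generalize (1 - y) ^ (-μ) = X
      generalize y ^ p = Y
      generalize (B - z * y) ^ (q - 1 - 1) = Z
      subst hμ'
      ring
  have hconst := constant_of_has_deriv_right_zero (f := fun z => (B - z) ^ (p + 1) * χ z)
    (a := 0) (b := z) ?_ ?_ z ⟨hz₀, le_rfl⟩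
  · have h0 : χ 0 = ProbabilityTheory.beta (1 - μ) (p + 1) * B ^ (q - 1) := by
      rw [← integral_rpow_mul_one_sub_rpow (sub_pos.2 hμ) (by linarith : 0 < p + 1),
        ← intervalIntegral.integral_mul_const]
      simp [χ]
    simp only [sub_zero, h0] at hconst
    have hBz : 0 < B - z := sub_pos.2 hz
    rw [show -p - 1 = -(p + 1) by ring, Real.rpow_neg hBz.le,
      eq_mul_inv_iff_mul_eq₀ (Real.rpow_pos_of_pos hBz _).ne', mul_comm]
    refine hconst.trans ?_
    rw [mul_left_comm, ← Real.rpow_add hB]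
    congr 2
    linarith
  · intro w hw
    have hw' : w < B := hw.2.trans_lt hz
    exact ((ContinuousAt.rpow_const (by fun_prop) (Or.inl (sub_pos.2 hw').ne')).mul
      (hχ w hw').continuousAt).continuousWithinAt
  · intro w hw
    have hw' : w < B := hw.2.trans hz
    have hBw : 0 < B - w := sub_pos.2 hw'
    have := (((hasDerivAt_id w).const_sub B).rpow_const (p := p + 1) (Or.inl hBw.ne')).mul
      (hχ w hw')
    refine (this.congr_deriv ?_).hasDerivWithinAt
    have hh := hode w hw'
    simp only [id, add_sub_cancel_right]
    rw [Real.rpow_add_one hBw.ne']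
    linear_combination -(B - w) ^ p * hh

/-- With z = x - a, the left side is z^(-q) ψ(z). In its derivative, the splitting (B-zy)^q =
(B-zy)(B-zy)^(q-1) reduces everything to the closed form of `integral_beta_mul_rpow`. Integration
starts from 0, where z^(-q) vanishes. -/
lemma integral_left_weight {μ p q a b x : ℝ} (hμ : μ < 1) (hp : -1 < p) (hq : q < 0)
    (hpq : p + q = -(1 - μ)) (hx : x ∈ Ioo a b) :
    ∫ s in a..x, (x - s) ^ (-μ) * ((s - a) ^ p * (b - s) ^ q) =
      Real.Gamma (1 - μ) * Real.Gamma (p + 1) / Real.Gamma (-q) * (b - a) ^ μ *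
        ∫ t in (0 : ℝ)..(x - a), t ^ (-q - 1) * (b - a - t) ^ (-p - 1) := by
  have hz : 0 < x - a := sub_pos.2 hx.1
  have hzB : x - a < b - a := sub_lt_sub_right hx.2 a
  have hB : 0 < b - a := hz.trans hzB
  have hm : IntervalIntegrable (fun y : ℝ => (1 - y) ^ (-μ) * y ^ p) volume 0 1 := by
    have := intervalIntegrable_rpow_mul_one_sub_rpow (sub_pos.2 hμ) (by linarith : 0 < p + 1)
    rwa [add_sub_cancel_right, sub_sub_cancel_left] at this
  have hmy : IntervalIntegrable (fun y : ℝ => (1 - y) ^ (-μ) * y ^ p * y) volume 0 1 :=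
    hm.mul_continuousOn continuousOn_id
  have hL := integral_left_eq_rpow_mul hx.1 b (1 - μ) p q
  rw [sub_sub_cancel_left, show 1 - μ + p = -q by linarith] at hL
  rw [hL]
  set B := b - a
  set ψ : ℝ → ℝ := fun z => ∫ y in (0 : ℝ)..1, ((1 - y) ^ (-μ) * y ^ p) * (B - z * y) ^ q
  set A := Real.Gamma (1 - μ) * Real.Gamma (p + 1) / Real.Gamma (-q) * B ^ μ
  have hA : -q * B * (ProbabilityTheory.beta (1 - μ) (p + 1) * B ^ (μ - 1)) = A := by
    simp only [A, ProbabilityTheory.beta]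
    rw [show 1 - μ + (p + 1) = -q + 1 by linarith, Real.Gamma_add_one (s := -q) (by linarith),
      Real.rpow_sub_one hB.ne']
    have : Real.Gamma (-q) ≠ 0 := (Real.Gamma_pos_of_pos (by linarith)).ne'
    have : q ≠ 0 := hq.ne
    field_simp
  have hψ : ∀ z < B, HasDerivAt ψ _ z := fun z hz =>
    hasDerivAt_integral_mul_sub_mul_rpow hm hB hz q
  have := intervalIntegral.integral_eq_sub_of_hasDerivAt_of_le (hz.le)
    (f := fun z : ℝ => z ^ (-q) * ψ z)
    (f' := fun t => A * (t ^ (-q - 1) * (B - t) ^ (-p - 1))) ?_ ?_ ?_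
  · rw [intervalIntegral.integral_const_mul, Real.zero_rpow (by linarith), zero_mul,
      sub_zero] at this
    exact this.symm
  · refine ContinuousOn.mul (ContinuousOn.rpow_const (by fun_prop) fun y _ =>
      Or.inr (by linarith)) fun w hw => (hψ w (hw.2.trans_lt hzB)).continuousAt.continuousWithinAt
  · intro w hw
    have hwB : w < B := hw.2.trans hzB
    refine (((hasDerivAt_id w).rpow_const (p := -q) (Or.inl hw.1.ne')).mul (hψ w hwB)).congr_deriv ?_
    have e := integral_beta_mul_rpow hμ hp hpq hB hw.1.le hwB
    have e2 : ∫ y in (0 : ℝ)..1, ((1 - y) ^ (-μ) * y ^ p) * (B - w * y) ^ (q - 1) =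
        B⁻¹ * (ψ w + w * ∫ y in (0 : ℝ)..1, ((1 - y) ^ (-μ) * y ^ p * y) * (B - w * y) ^ (q - 1)) := by
      rw [eq_inv_mul_iff_mul_eq₀ hB.ne', ← intervalIntegral.integral_const_mul,
        ← intervalIntegral.integral_const_mul, ← intervalIntegral.integral_add
          (intervalIntegrable_mul_sub_mul_rpow hm hB hwB q)
          ((intervalIntegrable_mul_sub_mul_rpow hmy hB hwB (q - 1)).const_mul w)]
      refine intervalIntegral.integral_congr fun y hy => ?_
      rw [uIcc_of_le zero_le_one] at hy
      have h2 := (sub_mul_pos hB hwB hy).ne'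
      conv_rhs => rw [show q = q - 1 + 1 by ring, Real.rpow_add_one h2, add_sub_cancel_right]
      ring
    rw [e2, inv_mul_eq_iff_eq_mul₀ hB.ne'] at e
    simp only [id]
    have hw1 : w ^ (-q) = w ^ (-q - 1) * w := by
      rw [← Real.rpow_add_one hw.1.ne', sub_add_cancel]
    rw [hw1, ← hA]
    linear_combination -q * w ^ (-q - 1) * e
  · refine IntervalIntegrable.const_mul ?_ _
    refine (intervalIntegral.intervalIntegrable_rpow' (by linarith)).mul_continuousOn ?_
    rw [uIcc_of_le hz.le]
    exact ContinuousOn.rpow_const (by fun_prop) fun y hy =>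
      Or.inl (sub_pos.2 (hy.2.trans_lt hzB)).ne'

lemma integral_right_eq_left (a b x : ℝ) (k : ℝ → ℝ) (p q : ℝ) :
    ∫ s in x..b, k (s - x) * ((s - a) ^ p * (b - s) ^ q) =
      ∫ s in a..(a + b - x), k (a + b - x - s) * ((s - a) ^ q * (b - s) ^ p) := by
  have h := intervalIntegral.integral_comp_sub_left (a := a) (b := a + b - x)
    (fun s => k (s - x) * ((s - a) ^ p * (b - s) ^ q)) (a + b)
  rw [show a + b - (a + b - x) = x by ring, add_sub_cancel_left] at h
  rw [← h]
  congr 1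
  ext s
  rw [show a + b - s - x = a + b - x - s by ring, show a + b - s - a = b - s by ring,
    show b - (a + b - s) = s - a by ring, mul_comm ((b - s) ^ p)]

/-- Since Γ(r+1)Γ(-r) = -π / sin(rπ), this is the sine condition in disguise. -/
lemma gamma_reflection_eq {α β μ p q : ℝ} (h : ExponentConditions α β μ p q) :
    α * (Real.Gamma (p + 1) * Real.Gamma (-p)) = β * (Real.Gamma (q + 1) * Real.Gamma (-q)) := by
  obtain ⟨h1, h2, h3, h4, -, h6⟩ := h
  have e : ∀ r : ℝ, Real.Gamma (r + 1) * Real.Gamma (-r) = -(Real.pi / Real.sin (r * Real.pi)) := by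
    intro r
    have := Real.Gamma_mul_Gamma_one_sub (-r)
    rw [mul_comm, add_comm, ← sub_neg_eq_add 1 r, this, mul_neg, Real.sin_neg, div_neg, mul_comm r]
  have hs : ∀ r : ℝ, -1 < r → r < 0 → Real.sin (r * Real.pi) ≠ 0 := by
    intro r hr hr'
    refine (Real.sin_neg_of_neg_of_neg_pi_lt ?_ ?_).ne <;> nlinarith [Real.pi_pos]
  have hp := hs p h1 h2
  have hq := hs q h3 h4
  rw [e, e, mul_neg, mul_neg, neg_inj, mul_div_assoc', mul_div_assoc', div_eq_div_iff hp hq]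
  linear_combination Real.pi * h6

/-- The two terms become incomplete Beta integrals over complementary intervals with equal
coefficients, so x drops out of the sum. -/
theorem abel_weight_eq_const {α β μ p q a b x : ℝ} (hμ : μ < 1)
    (h : ExponentConditions α β μ p q) (hx : x ∈ Ioo a b) :
    α * (∫ s in a..x, (x - s) ^ (-μ) * ((s - a) ^ p * (b - s) ^ q)) +
      β * (∫ s in x..b, (s - x) ^ (-μ) * ((s - a) ^ p * (b - s) ^ q)) =
    α * (Real.Gamma (p + 1) * Real.Gamma (-p)) := by
  have hg := gamma_reflection_eq h
  obtain ⟨h1, h2, h3, h4, h5, -⟩ := h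
  have hab : a < b := hx.1.trans hx.2
  have hB : 0 < b - a := sub_pos.2 hab
  have hz : 0 < x - a := sub_pos.2 hx.1
  rw [integral_left_weight hμ h1 h4 h5 hx,
    integral_right_eq_left a b x (fun t => t ^ (-μ)) p q,
    integral_left_weight hμ h3 h2 (by linarith) ⟨by linarith [hx.2], by linarith [hx.1]⟩]
  have hsub : ∫ t in (0 : ℝ)..(a + b - x - a), t ^ (-p - 1) * (b - a - t) ^ (-q - 1) =
      ∫ t in (x - a)..(b - a), t ^ (-q - 1) * (b - a - t) ^ (-p - 1) := by
    have := intervalIntegral.integral_comp_sub_left (a := 0) (b := a + b - x - a)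
      (fun t => t ^ (-q - 1) * (b - a - t) ^ (-p - 1)) (b - a)
    rw [show b - a - (a + b - x - a) = x - a by ring, sub_zero] at this
    rw [← this]
    congr 1
    ext t
    rw [sub_sub_cancel, mul_comm]
  have hint : ∀ u v : ℝ, 0 ≤ u → u ≤ b - a → 0 ≤ v → v ≤ b - a →
      IntervalIntegrable (fun t : ℝ => t ^ (-q - 1) * (b - a - t) ^ (-p - 1)) volume u v := by
    intro u v hu hu' hv hv'
    -- The third factor is switched off by the exponent 0, so the right endpoint b - a + 1 is a
    -- dummy.
    have := intervalIntegrable_left hB (lt_add_one (b - a)) (by linarith : 0 < -p)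
      (by linarith : -1 < -q - 1) 0
    simp only [sub_zero, Real.rpow_zero, mul_one] at this
    refine (this.mono_set ?_).congr fun t _ => mul_comm _ _
    rw [uIcc_of_le hB.le]
    exact uIcc_subset_Icc ⟨hu, hu'⟩ ⟨hv, hv'⟩
  have hfull : ∫ t in (0 : ℝ)..(b - a), t ^ (-q - 1) * (b - a - t) ^ (-p - 1) =
      (b - a) ^ (-μ) * (Real.Gamma (-p) * Real.Gamma (-q) / Real.Gamma (1 - μ)) := by
    have := integral_left_eq_rpow_mul hB 0 (-p) (-q - 1) 0
    simp only [sub_zero, Real.rpow_zero, mul_one] at this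
    have e := integral_rpow_mul_one_sub_rpow (by linarith : 0 < -p) (by linarith : 0 < -q)
    rw [ProbabilityTheory.beta, show -p + -q = 1 - μ by linarith] at e
    rw [e, show -p + (-q - 1) = -μ by linarith] at this
    rw [← this]
    congr 1
    ext t
    rw [mul_comm]
  have hadj := intervalIntegral.integral_add_adjacent_intervals
    (hint 0 (x - a) le_rfl hB.le hz.le (by linarith [hx.2]))
    (hint (x - a) (b - a) hz.le (by linarith [hx.2]) hB.le le_rfl)
  rw [hfull] at hadj
  rw [hsub]
  have hG1 : Real.Gamma (-q) ≠ 0 := (Real.Gamma_pos_of_pos (by linarith)).ne'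
  have hG2 : Real.Gamma (-p) ≠ 0 := (Real.Gamma_pos_of_pos (by linarith)).ne'
  have hG3 : Real.Gamma (1 - μ) ≠ 0 := (Real.Gamma_pos_of_pos (by linarith)).ne'
  have hBμ : (b - a) ^ μ * (b - a) ^ (-μ) = 1 := by
    rw [← Real.rpow_add hB, add_neg_cancel, Real.rpow_zero]
  have hc : β * (Real.Gamma (1 - μ) * Real.Gamma (q + 1) / Real.Gamma (-p)) =
      α * (Real.Gamma (1 - μ) * Real.Gamma (p + 1) / Real.Gamma (-q)) := by
    field_simp
    linear_combination -hg
  set I₁ := ∫ t in (0 : ℝ)..(x - a), t ^ (-q - 1) * (b - a - t) ^ (-p - 1)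
  set I₂ := ∫ t in (x - a)..(b - a), t ^ (-q - 1) * (b - a - t) ^ (-p - 1)
  have hA : α * (Real.Gamma (1 - μ) * Real.Gamma (p + 1) / Real.Gamma (-q)) *
      (Real.Gamma (-p) * Real.Gamma (-q) / Real.Gamma (1 - μ)) =
      α * (Real.Gamma (p + 1) * Real.Gamma (-p)) := by
    field_simp
  linear_combination (b - a) ^ μ * I₂ * hc +
    α * (Real.Gamma (1 - μ) * Real.Gamma (p + 1) / Real.Gamma (-q)) * (b - a) ^ μ * hadj +
    α * (Real.Gamma (1 - μ) * Real.Gamma (p + 1) / Real.Gamma (-q)) *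
      (Real.Gamma (-p) * Real.Gamma (-q) / Real.Gamma (1 - μ)) * hBμ + hA

/-! ### The weighted two-sided Abel operator and its action on polynomials. -/

/-- The two-sided Abel kernel: `α (x - s)^(-μ)` for `s < x` and `β (s - x)^(-μ)` for `s ≥ x`. -/
def abelKernel (α β μ x s : ℝ) : ℝ :=
  if s < x then α * (x - s) ^ (-μ) else β * (s - x) ^ (-μ)

/-- The Jacobi weight `(s - a)^p (b - s)^q`. -/
def jacobiWeight (a b p q s : ℝ) : ℝ := (s - a) ^ p * (b - s) ^ q

lemma abelKernel_nonneg {α β μ : ℝ} (hα : 0 < α) (hβ : 0 < β) (x s : ℝ) :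
    0 ≤ abelKernel α β μ x s := by
  unfold abelKernel
  split_ifs with h
  · exact mul_nonneg hα.le (Real.rpow_nonneg (by linarith) _)
  · exact mul_nonneg hβ.le (Real.rpow_nonneg (by linarith) _)

lemma abelKernel_swap (α β μ : ℝ) {x s : ℝ} (h : x ≠ s) :
    abelKernel β α μ s x = abelKernel α β μ x s := by
  unfold abelKernel
  rcases h.lt_or_gt with h | h
  · rw [if_pos h, if_neg (not_lt.2 h.le)]
  · rw [if_neg (not_lt.2 h.le), if_pos h]

lemma measurable_abelKernel (α β μ : ℝ) :
    Measurable fun z : ℝ × ℝ => abelKernel α β μ z.1 z.2 := by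
  unfold abelKernel
  exact Measurable.ite (measurableSet_lt measurable_snd measurable_fst) (by fun_prop) (by fun_prop)

lemma measurable_jacobiWeight (a b p q : ℝ) : Measurable (jacobiWeight a b p q) := by
  unfold jacobiWeight; fun_prop

lemma jacobiWeight_pos {a b s : ℝ} (p q : ℝ) (hs : s ∈ Ioo a b) : 0 < jacobiWeight a b p q s :=
  mul_pos (Real.rpow_pos_of_pos (sub_pos.2 hs.1) _) (Real.rpow_pos_of_pos (sub_pos.2 hs.2) _)

lemma integral_abelKernel_mul {α β μ a b x : ℝ} {f : ℝ → ℝ} (hx : x ∈ Ioo a b)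
    (hf : IntegrableOn (fun s => abelKernel α β μ x s * f s) (Ioo a b)) :
    ∫ s in Ioo a b, abelKernel α β μ x s * f s =
      α * (∫ s in a..x, (x - s) ^ (-μ) * f s) + β * (∫ s in x..b, (s - x) ^ (-μ) * f s) := by
  have hab := hx.1.trans hx.2
  rw [← integral_Ioc_eq_integral_Ioo, ← intervalIntegral.integral_of_le hab.le]
  have hf' : IntervalIntegrable (fun s => abelKernel α β μ x s * f s) volume a b := by
    rw [intervalIntegrable_iff_integrableOn_Ioo_of_le hab.le]; exact hf
  rw [← intervalIntegral.integral_add_adjacent_intervals (b := x)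
    (hf'.mono_set (by rw [uIcc_of_le hx.1.le, uIcc_of_le hab.le]; exact Icc_subset_Icc_right hx.2.le))
    (hf'.mono_set (by rw [uIcc_of_le hx.2.le, uIcc_of_le hab.le]; exact Icc_subset_Icc_left hx.1.le)),
    ← intervalIntegral.integral_const_mul, ← intervalIntegral.integral_const_mul]
  congr 1
  · rw [intervalIntegral.integral_of_le hx.1.le, intervalIntegral.integral_of_le hx.1.le,
      integral_Ioc_eq_integral_Ioo, integral_Ioc_eq_integral_Ioo]
    refine setIntegral_congr_fun measurableSet_Ioo fun s hs => ?_
    simp only [abelKernel, if_pos hs.2, mul_assoc]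
  · refine intervalIntegral.integral_congr fun s hs => ?_
    rw [uIcc_of_le hx.2.le] at hs
    simp only [abelKernel, if_neg (not_lt.2 hs.1), mul_assoc]

lemma intervalIntegrable_right {a b x μ p q : ℝ} (hx : x ∈ Ioo a b) (hμ : μ < 1) (hq : -1 < q) :
    IntervalIntegrable (fun s => (s - x) ^ (-μ) * ((s - a) ^ p * (b - s) ^ q)) volume x b := by
  have h := (intervalIntegrable_left (a := a) (b := b) (x := a + b - x) (σ := 1 - μ) (p := q)
    (by linarith [hx.2]) (by linarith [hx.1]) (by linarith) hq p).comp_sub_left (a + b)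
  rw [add_sub_cancel_left, sub_sub_cancel] at h
  refine h.symm.congr fun s _ => ?_
  rw [show a + b - x - (a + b - s) = s - x by ring, show a + b - s - a = b - s by ring,
    show b - (a + b - s) = s - a by ring, sub_sub_cancel_left, mul_comm ((b - s) ^ q)]

lemma integrableOn_abelKernel_weight {α β μ a b x p q : ℝ} (hx : x ∈ Ioo a b) (hμ : μ < 1)
    (hp : -1 < p) (hq : -1 < q) :
    IntegrableOn (fun s => abelKernel α β μ x s * jacobiWeight a b p q s) (Ioo a b) := by
  have hab := hx.1.trans hx.2
  rw [← intervalIntegrable_iff_integrableOn_Ioo_of_le hab.le]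
  refine IntervalIntegrable.trans (b := x) ?_ ?_
  · have := (intervalIntegrable_left hx.1 hx.2 (sub_pos.2 hμ) hp q).const_mul α
    rw [intervalIntegrable_iff_integrableOn_Ioo_of_le hx.1.le] at this ⊢
    refine this.congr_fun (fun s hs => ?_) measurableSet_Ioo
    simp only [abelKernel, if_pos hs.2, jacobiWeight, sub_sub_cancel_left]
    ring
  · refine ((intervalIntegrable_right (p := p) hx hμ hq).const_mul β).congr fun s hs => ?_
    rw [uIoc_of_le hx.2.le] at hs
    simp only [abelKernel, if_neg (not_lt.2 hs.1.le), jacobiWeight]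
    ring

/-- The two-sided Abel operator with the Jacobi weight. -/
def weightedAbel (a b α β μ p q : ℝ) (φ : ℝ → ℝ) (x : ℝ) : ℝ :=
  ∫ s in Ioo a b, abelKernel α β μ x s * jacobiWeight a b p q s * φ s

/-- The value of the weighted Abel operator at the constant function `1`. -/
def abelConst (α p : ℝ) : ℝ := α * (Real.Gamma (p + 1) * Real.Gamma (-p))

lemma abelConst_pos {α p : ℝ} (hα : 0 < α) (h1 : -1 < p) (h2 : p < 0) : 0 < abelConst α p :=
  mul_pos hα (mul_pos (Real.Gamma_pos_of_pos (by linarith)) (Real.Gamma_pos_of_pos (by linarith)))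

section

variable {a b α β μ p q : ℝ}

lemma integral_abelKernel_weight (hμ : μ < 1) (h : ExponentConditions α β μ p q) {x : ℝ}
    (hx : x ∈ Ioo a b) :
    ∫ s in Ioo a b, abelKernel α β μ x s * jacobiWeight a b p q s = abelConst α p := by
  rw [integral_abelKernel_mul hx (integrableOn_abelKernel_weight hx hμ h.1 h.2.2.1)]
  exact abel_weight_eq_const hμ h hx

lemma integrableOn_abelKernel_weight_mul (hμ : μ < 1) (h : ExponentConditions α β μ p q) {x : ℝ}
    (hx : x ∈ Ioo a b) {φ : ℝ → ℝ} (hφ : Continuous φ) :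
    IntegrableOn (fun s => abelKernel α β μ x s * jacobiWeight a b p q s * φ s) (Ioo a b) := by
  obtain ⟨M, hM⟩ := (isCompact_Icc (a := a) (b := b)).exists_bound_of_continuousOn hφ.continuousOn
  refine Integrable.mul_bdd (c := M) (integrableOn_abelKernel_weight hx hμ h.1 h.2.2.1)
    hφ.aestronglyMeasurable ?_
  filter_upwards [ae_restrict_mem measurableSet_Ioo] with s hs using hM s (Ioo_subset_Icc_self hs)

/-- The kernel and the weight are nonnegative and their product has constant integral in s. That
constant, times a bound for φ, dominates the inner integral, so Fubini becomes available despite the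
singularities on the diagonal and at the endpoints. -/
lemma integrable_prod_abelKernel (hα : 0 < α) (hβ : 0 < β) (hμ : μ < 1)
    (h : ExponentConditions α β μ p q) {c d : ℝ} (hcd : Ioo c d ⊆ Ioo a b) {g φ : ℝ → ℝ}
    (hg : IntegrableOn g (Ioo c d)) (hφ : Continuous φ) :
    Integrable (fun z : ℝ × ℝ =>
        g z.1 * (abelKernel α β μ z.1 z.2 * jacobiWeight a b p q z.2 * φ z.2))
      ((volume.restrict (Ioo c d)).prod (volume.restrict (Ioo a b))) := by
  obtain ⟨M, hM⟩ := (isCompact_Icc (a := a) (b := b)).exists_bound_of_continuousOn hφ.continuousOn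
  have hmeas : AEStronglyMeasurable (fun z : ℝ × ℝ =>
      g z.1 * (abelKernel α β μ z.1 z.2 * jacobiWeight a b p q z.2 * φ z.2))
      ((volume.restrict (Ioo c d)).prod (volume.restrict (Ioo a b))) := by
    refine hg.aestronglyMeasurable.comp_fst.mul (Measurable.aestronglyMeasurable ?_)
    exact ((measurable_abelKernel α β μ).mul
      ((measurable_jacobiWeight a b p q).comp measurable_snd)).mul
      (hφ.measurable.comp measurable_snd)
  rw [integrable_prod_iff hmeas]
  constructor
  · filter_upwards [ae_restrict_mem measurableSet_Ioo] with x hx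
    exact (integrableOn_abelKernel_weight_mul hμ h (hcd hx) hφ).const_mul (g x)
  · refine (hg.norm.mul_const (M * abelConst α p)).mono' hmeas.norm.integral_prod_right' ?_
    filter_upwards [ae_restrict_mem measurableSet_Ioo] with x hx
    rw [Real.norm_of_nonneg (integral_nonneg fun _ => norm_nonneg _)]
    simp only [norm_mul, integral_const_mul]
    refine mul_le_mul_of_nonneg_left ?_ (norm_nonneg _)
    rw [mul_comm M, ← integral_abelKernel_weight hμ h (hcd hx), ← integral_mul_const]
    refine integral_mono_of_nonneg (Filter.Eventually.of_forall fun s => by positivity)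
      ((integrableOn_abelKernel_weight (hcd hx) hμ h.1 h.2.2.1).mul_const M) ?_
    filter_upwards [ae_restrict_mem measurableSet_Ioo] with s hs
    rw [Real.norm_of_nonneg (abelKernel_nonneg hα hβ x s),
      Real.norm_of_nonneg (jacobiWeight_pos p q hs).le]
    exact mul_le_mul_of_nonneg_left (hM s (Ioo_subset_Icc_self hs))
      (mul_nonneg (abelKernel_nonneg hα hβ x s) (jacobiWeight_pos p q hs).le)

lemma intervalIntegrable_abelKernel (hμ : μ < 1) (s x y : ℝ) :
    IntervalIntegrable (fun τ => abelKernel α β μ τ s) volume x y := by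
  have key : ∀ y, IntervalIntegrable (fun τ => abelKernel α β μ τ s) volume s y := by
    intro y
    rcases le_total s y with hy | hy
    · have := ((intervalIntegral.intervalIntegrable_rpow' (a := 0) (b := y - s)
        (by linarith : -1 < -μ)).comp_sub_right s).const_mul α
      rw [zero_add, sub_add_cancel] at this
      refine this.congr fun τ hτ => ?_
      rw [uIoc_of_le hy] at hτ
      simp only [abelKernel, if_pos hτ.1]
    · have := ((intervalIntegral.intervalIntegrable_rpow' (a := 0) (b := s - y)
        (by linarith : -1 < -μ)).comp_sub_left s).const_mul β
      rw [sub_zero, sub_sub_cancel] at this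
      refine this.congr fun τ hτ => ?_
      rw [uIoc_of_ge hy] at hτ
      simp only [abelKernel, if_neg (not_lt.2 hτ.2)]
  exact (key x).symm.trans (key y)

/-- The primitive k(τ,s)(τ-s) equals α(τ-s)₊^(1-μ) - β(s-τ)₊^(1-μ), which is continuous across τ =
s. The single point where it may fail to be differentiable is harmless. -/
lemma integral_abelKernel_eq (hμ : μ < 1) (s x y : ℝ) :
    (1 - μ) * ∫ τ in x..y, abelKernel α β μ τ s =
      abelKernel α β μ y s * (y - s) - abelKernel α β μ x s * (x - s) := by
  have hμ' : 1 - μ ≠ 0 := by linarith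
  rw [← intervalIntegral.integral_const_mul]
  refine integral_eq_of_hasDerivAt_off_countable (s := {s})
    (f := fun τ => abelKernel α β μ τ s * (τ - s)) (fun τ => (1 - μ) * abelKernel α β μ τ s)
    (countable_singleton s) ?_ ?_ ((intervalIntegrable_abelKernel hμ s x y).const_mul _)
  · have e : (fun τ => abelKernel α β μ τ s * (τ - s)) =
        fun τ => α * (max (τ - s) 0) ^ (1 - μ) - β * (max (s - τ) 0) ^ (1 - μ) := by
      ext τ
      unfold abelKernel
      rcases lt_trichotomy s τ with h | h | h
      · rw [if_pos h, max_eq_left (by linarith), max_eq_right (by linarith), Real.zero_rpow hμ',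
          show 1 - μ = -μ + 1 by ring, Real.rpow_add_one (by linarith)]
        ring
      · subst h
        simp [Real.zero_rpow hμ']
      · rw [if_neg (not_lt.2 h.le), max_eq_right (by linarith), max_eq_left (by linarith),
          Real.zero_rpow hμ', show 1 - μ = -μ + 1 by ring, Real.rpow_add_one (by linarith)]
        ring
    rw [e]
    refine Continuous.continuousOn (Continuous.sub (Continuous.mul continuous_const ?_)
      (Continuous.mul continuous_const ?_)) <;>
    exact Continuous.rpow_const (by fun_prop) fun _ => Or.inr (by linarith)
  · intro τ hτ
    have hne : τ ≠ s := hτ.2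
    rcases hne.lt_or_gt with h | h
    · have h0 : 0 < s - τ := sub_pos.2 h
      have d := ((((hasDerivAt_id τ).const_sub s).rpow_const (p := 1 - μ)
        (Or.inl h0.ne')).const_mul (-β))
      refine (d.congr_deriv ?_).congr_of_eventuallyEq ?_
      · simp only [abelKernel, if_neg (not_lt.2 h.le), id, sub_sub_cancel_left]
        ring
      · filter_upwards [Iio_mem_nhds h] with t ht
        have ht' : 0 < s - t := sub_pos.2 ht
        simp only [abelKernel, if_neg (not_lt.2 (show t < s from ht).le), id]
        rw [show 1 - μ = -μ + 1 by ring, Real.rpow_add_one ht'.ne']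
        ring
    · have h0 : 0 < τ - s := sub_pos.2 h
      have d := ((((hasDerivAt_id τ).sub_const s).rpow_const (p := 1 - μ)
        (Or.inl h0.ne')).const_mul α)
      refine (d.congr_deriv ?_).congr_of_eventuallyEq ?_
      · simp only [abelKernel, if_pos h, id, sub_sub_cancel_left]
        ring
      · filter_upwards [Ioi_mem_nhds h] with t ht
        have ht' : 0 < t - s := sub_pos.2 ht
        simp only [abelKernel, if_pos (show s < t from ht), id]
        rw [show 1 - μ = -μ + 1 by ring, Real.rpow_add_one ht'.ne']
        ring

/-- The integrated form of (x·Tφ - T(sφ))' = (1-μ)Tφ. Fubini replaces differentiation of a singular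
integral. -/
lemma weightedAbel_sub_eq_integral (hα : 0 < α) (hβ : 0 < β) (hμ : μ < 1)
    (h : ExponentConditions α β μ p q) {φ : ℝ → ℝ} (hφ : Continuous φ) {x y : ℝ}
    (hx : x ∈ Ioo a b) (hy : y ∈ Ioo a b) (hxy : x ≤ y) :
    (y * weightedAbel a b α β μ p q φ y - weightedAbel a b α β μ p q (fun s => s * φ s) y) -
      (x * weightedAbel a b α β μ p q φ x - weightedAbel a b α β μ p q (fun s => s * φ s) x) =
      (1 - μ) * ∫ τ in x..y, weightedAbel a b α β μ p q φ τ := by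
  have hi := fun z hz => integrableOn_abelKernel_weight_mul (a := a) (b := b) (x := z) hμ h hz hφ
  have hi' := fun z hz => integrableOn_abelKernel_weight_mul (a := a) (b := b) (x := z) hμ h hz
    (φ := fun s => s * φ s) (by fun_prop)
  have hS : ∀ z ∈ Ioo a b,
      z * weightedAbel a b α β μ p q φ z - weightedAbel a b α β μ p q (fun s => s * φ s) z =
      ∫ s in Ioo a b, abelKernel α β μ z s * (z - s) * (jacobiWeight a b p q s * φ s) := by
    intro z hz
    unfold weightedAbel
    rw [← integral_const_mul, ← integral_sub ((hi z hz).const_mul z) (hi' z hz)]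
    congr 1; ext s; ring
  have hSi : ∀ z ∈ Ioo a b, IntegrableOn (fun s =>
      abelKernel α β μ z s * (z - s) * (jacobiWeight a b p q s * φ s)) (Ioo a b) := by
    intro z hz
    refine (((hi z hz).const_mul z).sub (hi' z hz)).congr (Filter.Eventually.of_forall fun s => ?_)
    simp only [Pi.sub_apply]
    ring
  rw [hS y hy, hS x hx, ← integral_sub (hSi y hy) (hSi x hx)]
  have hsub : Ioo x y ⊆ Ioo a b := Ioo_subset_Ioo hx.1.le hy.2.le
  have hprod := integrable_prod_abelKernel (g := fun _ => (1 : ℝ)) (c := x) (d := y)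
    hα hβ hμ h hsub (integrable_const _) hφ
  simp only [one_mul] at hprod
  rw [intervalIntegral.integral_of_le hxy, integral_Ioc_eq_integral_Ioo]
  unfold weightedAbel
  rw [integral_integral_swap hprod, ← integral_const_mul]
  congr 1; ext s
  have := integral_abelKernel_eq (α := α) (β := β) hμ s x y
  rw [intervalIntegral.integral_of_le hxy, integral_Ioc_eq_integral_Ioo] at this
  simp only [mul_assoc]
  rw [integral_mul_const]
  linear_combination -(jacobiWeight a b p q s * φ s) * this

/-- If Tφ = xⁿ, the previous identity gives T(sφ) leading coefficient 1 - (1-μ)/(n+1), and leaves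
only an additive constant undetermined. -/
lemma weightedAbel_id_mul (hα : 0 < α) (hβ : 0 < β) (hμ : μ < 1) (hab : a < b)
    (h : ExponentConditions α β μ p q) {φ : ℝ → ℝ} (hφ : Continuous φ) {n : ℕ}
    (hn : ∀ x ∈ Ioo a b, weightedAbel a b α β μ p q φ x = x ^ n) :
    ∃ c, ∀ x ∈ Ioo a b, weightedAbel a b α β μ p q (fun s => s * φ s) x =
      (n + μ) / (n + 1) * x ^ (n + 1) + c := by
  have hn1 : (n : ℝ) + 1 ≠ 0 := by positivity
  have key : ∀ x ∈ Ioo a b, ∀ y ∈ Ioo a b, x ≤ y →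
      weightedAbel a b α β μ p q (fun s => s * φ s) y - (n + μ) / (n + 1) * y ^ (n + 1) =
      weightedAbel a b α β μ p q (fun s => s * φ s) x - (n + μ) / (n + 1) * x ^ (n + 1) := by
    intro x hx y hy hxy
    have e := weightedAbel_sub_eq_integral hα hβ hμ h hφ hx hy hxy
    have e2 : ∫ τ in x..y, weightedAbel a b α β μ p q φ τ = ∫ τ in x..y, τ ^ n := by
      refine intervalIntegral.integral_congr fun τ hτ => hn τ ?_
      rw [uIcc_of_le hxy] at hτ
      exact ⟨hx.1.trans_le hτ.1, hτ.2.trans_lt hy.2⟩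
    rw [e2, integral_pow, hn x hx, hn y hy] at e
    have : (n + μ) / (n + 1) = 1 - (1 - μ) / (n + 1) := by field_simp; ring
    rw [this]
    linear_combination -e
  have hm : (a + b) / 2 ∈ Ioo a b := ⟨by linarith, by linarith⟩
  refine ⟨weightedAbel a b α β μ p q (fun s => s * φ s) ((a + b) / 2) -
    (n + μ) / (n + 1) * ((a + b) / 2) ^ (n + 1), fun x hx => ?_⟩
  rcases le_total x ((a + b) / 2) with hle | hle
  · linarith [key x hx _ hm hle]
  · linarith [key _ hm x hx hle]

lemma weightedAbel_const (hμ : μ < 1) (h : ExponentConditions α β μ p q) {x : ℝ}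
    (hx : x ∈ Ioo a b) (c : ℝ) :
    weightedAbel a b α β μ p q (fun _ => c) x = abelConst α p * c := by
  unfold weightedAbel
  rw [integral_mul_const, integral_abelKernel_weight hμ h hx]

lemma weightedAbel_add_mul (hμ : μ < 1) (h : ExponentConditions α β μ p q) {x : ℝ}
    (hx : x ∈ Ioo a b) {φ ψ : ℝ → ℝ} (hφ : Continuous φ) (hψ : Continuous ψ) (c d : ℝ) :
    weightedAbel a b α β μ p q (fun s => c * φ s + d * ψ s) x =
      c * weightedAbel a b α β μ p q φ x + d * weightedAbel a b α β μ p q ψ x := by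
  unfold weightedAbel
  rw [← integral_const_mul, ← integral_const_mul, ← integral_add
    ((integrableOn_abelKernel_weight_mul hμ h hx hφ).const_mul c)
    ((integrableOn_abelKernel_weight_mul hμ h hx hψ).const_mul d)]
  congr 1; ext s; ring

/-- The triangular recursion is inverted by dividing by n + μ, nonzero even at n = 0 since μ > 0;
the additive constant is removed with a multiple of T1. -/
lemma exists_weightedAbel_eq_pow (hα : 0 < α) (hβ : 0 < β) (hμ₀ : 0 < μ) (hμ : μ < 1)
    (hab : a < b) (h : ExponentConditions α β μ p q) (n : ℕ) :
    ∃ φ : ℝ → ℝ, Continuous φ ∧ ∀ x ∈ Ioo a b, weightedAbel a b α β μ p q φ x = x ^ n := by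
  have hK := (abelConst_pos hα h.1 h.2.1).ne'
  induction n with
  | zero =>
    refine ⟨fun _ => (abelConst α p)⁻¹, continuous_const, fun x hx => ?_⟩
    rw [weightedAbel_const hμ h hx, pow_zero, mul_inv_cancel₀ hK]
  | succ n ih =>
    obtain ⟨φ, hφ, hn⟩ := ih
    obtain ⟨c, hc⟩ := weightedAbel_id_mul hα hβ hμ hab h hφ hn
    have h1 : (n : ℝ) + μ ≠ 0 := by positivity
    have h2 : (n : ℝ) + 1 ≠ 0 := by positivity
    refine ⟨fun s => (n + 1) / (n + μ) * (s * φ s) + (-c * (n + 1) / (n + μ)) *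
      (abelConst α p)⁻¹, by fun_prop, fun x hx => ?_⟩
    rw [weightedAbel_add_mul hμ h hx (φ := fun s => s * φ s) (ψ := fun _ => (abelConst α p)⁻¹)
      (by fun_prop) continuous_const, hc x hx, weightedAbel_const hμ h hx]
    field_simp
    ring

end

/-! ### The explicit function is a true solution. -/

lemma integrableOn_jacobiWeight {a b p q : ℝ} (hab : a < b) (hp : -1 < p) (hq : -1 < q) :
    IntegrableOn (jacobiWeight a b p q) (Ioo a b) := by
  have := intervalIntegrable_left hab (lt_add_one b) (by linarith : 0 < q + 1) hp 0
  rw [intervalIntegrable_iff_integrableOn_Ioo_of_le hab.le] at this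
  refine this.congr_fun (fun s _ => ?_) measurableSet_Ioo
  simp only [jacobiWeight, add_sub_cancel_right, Real.rpow_zero, mul_one, mul_comm]

lemma _root_.AbsolutelyContinuousOnInterval.congr_of_eqOn {f g : ℝ → ℝ} {a b : ℝ}
    (hf : AbsolutelyContinuousOnInterval f a b) (hfg : EqOn f g (uIcc a b)) :
    AbsolutelyContinuousOnInterval g a b := by
  rw [absolutelyContinuousOnInterval_iff] at hf ⊢
  intro ε hε
  obtain ⟨δ, hδ, H⟩ := hf ε hε
  refine ⟨δ, hδ, fun E hE hd => ?_⟩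
  have := H E hE hd
  rwa [Finset.sum_congr rfl fun i hi => by rw [hfg (hE.1 i hi).1, hfg (hE.1 i hi).2]] at this

lemma absolutelyContinuousOnInterval_of_hasDerivAt {f f' : ℝ → ℝ} {a b : ℝ} (hab : a ≤ b)
    (hc : ContinuousOn f (Icc a b)) (hd : ∀ x ∈ Ioo a b, HasDerivAt f (f' x) x)
    (hi : IntegrableOn f' (Ioo a b)) : AbsolutelyContinuousOnInterval f a b := by
  rw [← intervalIntegrable_iff_integrableOn_Ioo_of_le hab] at hi
  have h1 := hi.absolutelyContinuousOnInterval_intervalIntegral (c := a) left_mem_uIcc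
  have h2 : AbsolutelyContinuousOnInterval (fun _ : ℝ => f a) a b :=
    ((LipschitzWith.const (f a)).lipschitzOnWith).absolutelyContinuousOnInterval
  refine (h1.add h2).congr_of_eqOn fun x hx => ?_
  rw [uIcc_of_le hab] at hx
  have := intervalIntegral.integral_eq_sub_of_hasDerivAt_of_le hx.1
    (hc.mono (Icc_subset_Icc_right hx.2)) (fun y hy => hd y ⟨hy.1, hy.2.trans_le hx.2⟩)
    (hi.mono_set (by rw [uIcc_of_le hx.1, uIcc_of_le hab]; exact Icc_subset_Icc_right hx.2))
  simp only [Pi.add_apply, this, sub_add_cancel]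

section

variable {a b α β μ p q : ℝ}

lemma continuous_exampleSolution (hp : -1 < p) (hq : -1 < q) :
    Continuous (exampleSolution a b β μ p q) := by
  unfold exampleSolution
  exact (continuous_const.mul (Continuous.rpow_const (by fun_prop) fun _ => Or.inr (by linarith))).mul
    (Continuous.rpow_const (by fun_prop) fun _ => Or.inr (by linarith))

lemma hasDerivAt_exampleSolution {x : ℝ} (hx : x ∈ Ioo a b) :
    HasDerivAt (exampleSolution a b β μ p q)
      (jacobiWeight a b p q x *
        (exampleConst β μ p q * ((p + 1) * (b - x) - (q + 1) * (x - a)))) x := by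
  have h1 : 0 < x - a := sub_pos.2 hx.1
  have h2 : 0 < b - x := sub_pos.2 hx.2
  have d1 := (((hasDerivAt_id x).sub_const a).rpow_const (p := p + 1) (Or.inl h1.ne')).const_mul
    (exampleConst β μ p q)
  have d2 := ((hasDerivAt_id x).const_sub b).rpow_const (p := q + 1) (Or.inl h2.ne')
  refine (d1.mul d2).congr_deriv ?_
  simp only [id, jacobiWeight, add_sub_cancel_right]
  rw [Real.rpow_add_one h1.ne', Real.rpow_add_one h2.ne']
  ring

lemma contDiffOn_exampleSolution (n : WithTop ℕ∞) :
    ContDiffOn ℝ n (exampleSolution a b β μ p q) (Ioo a b) := by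
  unfold exampleSolution
  refine (contDiffOn_const.mul ?_).mul ?_
  · exact ContDiffOn.rpow_const_of_ne (by fun_prop) fun x hx => (sub_pos.2 hx.1).ne'
  · exact ContDiffOn.rpow_const_of_ne (by fun_prop) fun x hx => (sub_pos.2 hx.2).ne'

lemma absolutelyContinuous_exampleSolution (hab : a < b) (hp : -1 < p) (hq : -1 < q) :
    AbsolutelyContinuousOnInterval (exampleSolution a b β μ p q) a b := by
  refine absolutelyContinuousOnInterval_of_hasDerivAt hab.le
    (continuous_exampleSolution hp hq).continuousOn (fun x hx => hasDerivAt_exampleSolution hx) ?_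
  have : IntervalIntegrable (jacobiWeight a b p q) volume a b := by
    rw [intervalIntegrable_iff_integrableOn_Ioo_of_le hab.le]
    exact integrableOn_jacobiWeight hab hp hq
  rw [← intervalIntegrable_iff_integrableOn_Ioo_of_le hab.le]
  exact this.mul_continuousOn (by fun_prop)

lemma flux_eq_integral {v : ℝ → ℝ} {x : ℝ} (hx : x ∈ Ioo a b)
    (hf : IntegrableOn (fun s => abelKernel α β μ x s * deriv v s) (Ioo a b)) :
    flux a b α β μ v x =
      1 / Real.Gamma (1 - μ) * ∫ s in Ioo a b, abelKernel α β μ x s * deriv v s := by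
  rw [integral_abelKernel_mul hx hf]
  simp only [flux, leftInt, rightInt, sub_sub_cancel_left]
  ring

/-- This normalisation gives the flux slope 1. The Γ reflection identity trades the α in `abelConst`
for the β in the denominator of c. -/
lemma exampleConst_mul_abelConst (hβ : 0 < β) (hμ₀ : 0 < μ)
    (h : ExponentConditions α β μ p q) :
    exampleConst β μ p q * ((1 + μ) * μ * abelConst α p) = -Real.Gamma (1 - μ) := by
  have hg := gamma_reflection_eq h
  obtain ⟨h1, h2, h3, h4, h5, -⟩ := h
  have hq0 : q + 1 ≠ 0 := by linarith
  rw [abelConst, hg, exampleConst, show -p - 1 + μ = q by linarith,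
    show -p + μ = q + 1 by linarith, show 2 - μ + p = -q + 1 by linarith,
    show q + 2 = q + 1 + 1 by ring, Real.Gamma_add_one (s := -q) (by linarith),
    Real.Gamma_add_one (s := q + 1) hq0]
  have := (Real.Gamma_pos_of_pos (by linarith : 0 < -q)).ne'
  have := (Real.Gamma_pos_of_pos (by linarith : 0 < q + 1)).ne'
  have : 1 + μ ≠ 0 := by linarith
  have := h4.ne
  field_simp

lemma flux_exampleSolution (hα : 0 < α) (hβ : 0 < β) (hμ₀ : 0 < μ) (hμ : μ < 1) (hab : a < b)
    (h : ExponentConditions α β μ p q) :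
    ∃ C, ∀ x ∈ Ioo a b, flux a b α β μ (exampleSolution a b β μ p q) x = x + C := by
  have hK := (abelConst_pos hα h.1 h.2.1).ne'
  set K := abelConst α p with hKdef
  set c := exampleConst β μ p q with hc
  obtain ⟨C, hC⟩ := weightedAbel_id_mul hα hβ hμ hab h (φ := fun _ => K⁻¹) continuous_const (n := 0)
    fun x hx => by rw [weightedAbel_const hμ h hx, ← hKdef, mul_inv_cancel₀ hK, pow_zero]
  set φ : ℝ → ℝ := fun s => c * ((p + 1) * (b - s) - (q + 1) * (s - a)) with hφ
  refine ⟨1 / Real.Gamma (1 - μ) * (c * ((p + 1) * b + (q + 1) * a) * K - c * (1 + μ) * K * C),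
    fun x hx => ?_⟩
  have hcongr : EqOn (fun s => abelKernel α β μ x s * jacobiWeight a b p q s * φ s)
      (fun s => abelKernel α β μ x s * deriv (exampleSolution a b β μ p q) s) (Ioo a b) := by
    intro s hs
    simp only
    rw [(hasDerivAt_exampleSolution hs).deriv, mul_assoc]
  have hφc : Continuous φ := by fun_prop
  rw [flux_eq_integral hx ((integrableOn_abelKernel_weight_mul hμ h hx hφc).congr_fun hcongr
    measurableSet_Ioo), ← setIntegral_congr_fun measurableSet_Ioo hcongr]
  -- The slope of φ is -c(p+q+2) = -c(1+μ), and T sends K⁻¹s to μx + C.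
  have hT : ∫ s in Ioo a b, abelKernel α β μ x s * jacobiWeight a b p q s * φ s =
      -(c * (1 + μ) * K) * weightedAbel a b α β μ p q (fun s => s * K⁻¹) x +
        1 * weightedAbel a b α β μ p q (fun _ => c * ((p + 1) * b + (q + 1) * a)) x := by
    rw [← weightedAbel_add_mul hμ h hx (by fun_prop) (by fun_prop)]
    unfold weightedAbel
    congr 1; ext s
    have : p = -(1 - μ) - q := by linarith [h.2.2.2.2.1]
    simp only [hφ]
    field_simp
    rw [this]
    ring
  have hcK := exampleConst_mul_abelConst hβ hμ₀ h
  rw [← hc, ← hKdef] at hcK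
  have hG : Real.Gamma (1 - μ) ≠ 0 := (Real.Gamma_pos_of_pos (by linarith)).ne'
  rw [hT, hC x hx, weightedAbel_const hμ h hx, ← hKdef]
  push_cast
  field_simp
  linear_combination -x * hcK

lemma isTrueSolution_exampleSolution (hα : 0 < α) (hβ : 0 < β) (hμ₀ : 0 < μ) (hμ : μ < 1)
    (hab : a < b) (h : ExponentConditions α β μ p q) :
    IsTrueSolution a b α β μ (fun _ => 1) (fun _ => 0) (fun _ => 0) (fun _ => -1)
      (exampleSolution a b β μ p q) := by
  obtain ⟨C, hC⟩ := flux_exampleSolution hα hβ hμ₀ hμ hab h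
  have hp1 : p + 1 ≠ 0 := by linarith [h.1]
  have hq1 : q + 1 ≠ 0 := by linarith [h.2.2.1]
  refine ⟨absolutelyContinuous_exampleSolution hab h.1 h.2.2.1, ?_, ?_,
    contDiffOn_exampleSolution _, ?_, ?_⟩
  · simp [exampleSolution, Real.zero_rpow hp1]
  · simp [exampleSolution, Real.zero_rpow hq1]
  · exact ContDiffOn.congr (f := fun x => x + C) (by fun_prop) hC
  · intro x hx
    simp only [opL, one_mul, zero_mul, add_zero]
    have : (fun y => flux a b α β μ (exampleSolution a b β μ p q) y) =ᶠ[nhds x]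
        fun y => y + C := by
      filter_upwards [isOpen_Ioo.mem_nhds hx] with y hy using hC y hy
    rw [this.deriv_eq]
    simp

/-! ### Uniqueness by duality and moments. -/

lemma IsTrueSolution.flux_eq {v : ℝ → ℝ} (hab : a < b)
    (hv : IsTrueSolution a b α β μ (fun _ => 1) (fun _ => 0) (fun _ => 0) (fun _ => -1) v) :
    ∃ C, ∀ x ∈ Ioo a b, flux a b α β μ v x = x + C := by
  have hm : (a + b) / 2 ∈ Ioo a b := ⟨by linarith, by linarith⟩
  have hd : ∀ x ∈ Ioo a b, deriv (flux a b α β μ v) x = 1 := by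
    intro x hx
    have := hv.eqn x hx
    simp only [opL, one_mul, zero_mul, add_zero] at this
    exact neg_inj.1 this
  have hdiff := hv.flux_contDiff.differentiableOn one_ne_zero
  refine ⟨flux a b α β μ v ((a + b) / 2) - (a + b) / 2, fun x hx => ?_⟩
  have := isOpen_Ioo.is_const_of_deriv_eq_zero isPreconnected_Ioo
    (f := fun x => flux a b α β μ v x - x) (hdiff.sub differentiableOn_id) (fun y hy => ?_) hx hm
  · linarith
  · have hdy := ((hdiff y hy).differentiableAt (isOpen_Ioo.mem_nhds hy)).hasDerivAt
    rw [hd y hy] at hdy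
    exact (hdy.sub (hasDerivAt_id y)).deriv.trans (sub_self 1)

lemma ExponentConditions.symm (h : ExponentConditions α β μ p q) :
    ExponentConditions β α μ q p :=
  ⟨h.2.2.1, h.2.2.2.1, h.1, h.2.1, by rw [add_comm]; exact h.2.2.2.2.1, h.2.2.2.2.2.symm⟩

/-- Fubini: the transposed kernel has α and β interchanged off the diagonal, so the weight adapted
to it has p and q interchanged. -/
lemma integral_mul_weightedAbel (hα : 0 < α) (hβ : 0 < β) (hμ : μ < 1)
    (h : ExponentConditions α β μ p q) {v φ : ℝ → ℝ} (hv : IntegrableOn (deriv v) (Ioo a b))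
    (hφ : Continuous φ) :
    ∫ x in Ioo a b, deriv v x * weightedAbel a b β α μ q p φ x =
      Real.Gamma (1 - μ) *
        ∫ s in Ioo a b, jacobiWeight a b q p s * φ s * flux a b α β μ v s := by
  have hprod := integrable_prod_abelKernel hβ hα hμ h.symm (subset_refl (Ioo a b)) hv hφ
  -- Since φ may vanish, integrability of the kernel slices is read off from the constant function
  -- 1.
  have hprod1 := integrable_prod_abelKernel hβ hα hμ h.symm (subset_refl (Ioo a b)) hv
    (φ := fun _ => 1) continuous_const
  have hG : Real.Gamma (1 - μ) ≠ 0 := (Real.Gamma_pos_of_pos (by linarith)).ne'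
  simp only [weightedAbel, ← integral_const_mul]
  rw [integral_integral_swap hprod]
  refine integral_congr_ae ?_
  filter_upwards [hprod1.prod_left_ae, ae_restrict_mem measurableSet_Ioo] with s hs hsm
  have hw := (jacobiWeight_pos q p hsm).ne'
  have hae : ∀ᵐ x ∂(volume.restrict (Ioo a b)),
      abelKernel β α μ x s = abelKernel α β μ s x := by
    refine ae_restrict_of_ae ?_
    filter_upwards [(measure_singleton (μ := volume) s : volume {s} = 0) |> compl_mem_ae_iff.2]
      with x hx
    exact abelKernel_swap α β μ (x := s) (s := x) (Ne.symm hx)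
  have hint : IntegrableOn (fun x => abelKernel α β μ s x * deriv v x) (Ioo a b) := by
    refine (hs.const_mul (jacobiWeight a b q p s)⁻¹).congr ?_
    filter_upwards [hae] with x hx
    rw [hx]
    field_simp
  rw [flux_eq_integral hsm hint]
  have : ∫ x in Ioo a b, deriv v x * (abelKernel β α μ x s * jacobiWeight a b q p s * φ s) =
      ∫ x in Ioo a b, jacobiWeight a b q p s * φ s * (abelKernel α β μ s x * deriv v x) := by
    refine integral_congr_ae ?_
    filter_upwards [hae] with x hx
    rw [hx]; ring
  rw [this, integral_const_mul]
  field_simp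

/-- The difference f - g is orthogonal to all polynomials. Subtracting P·(f-g), with P uniformly
close to f - g, makes the integral of (f-g)² arbitrarily small. -/
lemma eqOn_of_integral_mul_pow_eq {f g : ℝ → ℝ} (hab : a < b) (hf : ContinuousOn f (Icc a b))
    (hg : ContinuousOn g (Icc a b))
    (H : ∀ n : ℕ, ∫ x in a..b, x ^ n * f x = ∫ x in a..b, x ^ n * g x) :
    EqOn f g (Icc a b) := by
  have hd : ContinuousOn (fun x => f x - g x) (Icc a b) := hf.sub hg
  have hii : ∀ k : ℝ → ℝ, ContinuousOn k (Icc a b) → IntervalIntegrable k volume a b :=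
    fun k hk => ContinuousOn.intervalIntegrable (by rwa [uIcc_of_le hab.le])
  have hP : ∀ P : Polynomial ℝ, ∫ x in a..b, P.eval x * (f x - g x) = 0 := by
    intro P
    induction P using Polynomial.induction_on' with
    | add P Q hP hQ =>
      simp only [Polynomial.eval_add, add_mul]
      rw [intervalIntegral.integral_add (hii _ (by fun_prop)) (hii _ (by fun_prop)), hP, hQ,
        add_zero]
    | monomial n c =>
      simp only [Polynomial.eval_monomial, mul_assoc, mul_sub]
      rw [intervalIntegral.integral_sub (hii _ (by fun_prop)) (hii _ (by fun_prop)),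
        intervalIntegral.integral_const_mul, intervalIntegral.integral_const_mul, H, sub_self]
  have hzero : ∫ x in a..b, (f x - g x) ^ 2 = 0 := by
    set M := ∫ x in a..b, |f x - g x|
    have hM : 0 ≤ M := intervalIntegral.integral_nonneg hab.le fun x _ => abs_nonneg _
    have hle : ∀ ε > 0, ∫ x in a..b, (f x - g x) ^ 2 ≤ ε * M := by
      intro ε hε
      obtain ⟨P, hPe⟩ := exists_polynomial_near_of_continuousOn a b _ hd ε hε
      have : ∫ x in a..b, (f x - g x) ^ 2 =
          ∫ x in a..b, ((f x - g x) ^ 2 - P.eval x * (f x - g x)) := by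
        rw [intervalIntegral.integral_sub (hii _ (by fun_prop)) (hii _ (by fun_prop)), hP, sub_zero]
      rw [this, ← intervalIntegral.integral_const_mul]
      refine intervalIntegral.integral_mono_on hab.le (hii _ (by fun_prop)) (hii _ (by fun_prop))
        fun x hx => ?_
      rw [show (f x - g x) ^ 2 - P.eval x * (f x - g x) =
        -(P.eval x - (f x - g x)) * (f x - g x) by ring]
      refine (le_abs_self _).trans ?_
      rw [abs_mul, abs_neg]
      exact mul_le_mul_of_nonneg_right (hPe x hx).le (abs_nonneg _)
    refine le_antisymm (le_of_forall_pos_le_add fun ε hε => ?_)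
      (intervalIntegral.integral_nonneg hab.le fun x _ => sq_nonneg _)
    refine (hle (ε / (M + 1)) (by positivity)).trans ?_
    rw [zero_add, div_mul_eq_mul_div, div_le_iff₀ (by positivity)]
    nlinarith
  intro x hx
  by_contra hne
  refine (intervalIntegral.integral_pos hab (f := fun x => (f x - g x) ^ 2) (by fun_prop)
    (fun y _ => sq_nonneg _) ⟨x, hx, ?_⟩).ne' hzero
  exact sq_pos_of_ne_zero (sub_ne_zero.2 hne)

lemma integral_pow_succ_mul_deriv {v : ℝ → ℝ} (hv : AbsolutelyContinuousOnInterval v a b)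
    (ha : v a = 0) (hb : v b = 0) (n : ℕ) :
    ∫ x in a..b, x ^ (n + 1) * deriv v x = -((n + 1) * ∫ x in a..b, x ^ n * v x) := by
  have hf : AbsolutelyContinuousOnInterval (fun x : ℝ => x ^ (n + 1)) a b :=
    ContDiffOn.absolutelyContinuousOnInterval (by fun_prop)
  rw [hf.integral_mul_deriv_eq_deriv_mul hv, ha, hb, ← intervalIntegral.integral_const_mul]
  simp [mul_assoc]

theorem IsTrueSolution.eqOn {u v : ℝ → ℝ} (hα : 0 < α) (hβ : 0 < β) (hμ₀ : 0 < μ) (hμ : μ < 1)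
    (hab : a < b) (h : ExponentConditions α β μ p q)
    (hu : IsTrueSolution a b α β μ (fun _ => 1) (fun _ => 0) (fun _ => 0) (fun _ => -1) u)
    (hv : IsTrueSolution a b α β μ (fun _ => 1) (fun _ => 0) (fun _ => 0) (fun _ => -1) v) :
    EqOn v u (Icc a b) := by
  have hK := abelConst_pos hβ h.2.2.1 h.2.2.2.1
  have hG : Real.Gamma (1 - μ) ≠ 0 := (Real.Gamma_pos_of_pos (by linarith)).ne'
  obtain ⟨Cu, hCu⟩ := hu.flux_eq hab
  obtain ⟨Cv, hCv⟩ := hv.flux_eq hab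
  have hint : ∀ {w : ℝ → ℝ}, AbsolutelyContinuousOnInterval w a b →
      IntegrableOn (deriv w) (Ioo a b) := fun hw => by
    rw [← intervalIntegrable_iff_integrableOn_Ioo_of_le hab.le]
    exact hw.intervalIntegrable_deriv
  have hwi : ∀ {φ : ℝ → ℝ}, Continuous φ →
      IntegrableOn (fun s => jacobiWeight a b q p s * φ s) (Ioo a b) := fun {φ} hφ => by
    have : IntervalIntegrable (jacobiWeight a b q p) volume a b := by
      rw [intervalIntegrable_iff_integrableOn_Ioo_of_le hab.le]
      exact integrableOn_jacobiWeight hab h.2.2.1 h.1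
    rw [← intervalIntegrable_iff_integrableOn_Ioo_of_le hab.le]
    exact this.mul_continuousOn hφ.continuousOn
  have hdual : ∀ {w : ℝ → ℝ} {C : ℝ}, AbsolutelyContinuousOnInterval w a b →
      (∀ x ∈ Ioo a b, flux a b α β μ w x = x + C) → ∀ {φ : ℝ → ℝ}, Continuous φ →
      ∫ x in Ioo a b, deriv w x * weightedAbel a b β α μ q p φ x = Real.Gamma (1 - μ) *
        ((∫ s in Ioo a b, jacobiWeight a b q p s * (φ s * s)) +
          (∫ s in Ioo a b, jacobiWeight a b q p s * φ s) * C) := by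
    intro w C hw hC φ hφ
    rw [integral_mul_weightedAbel hα hβ hμ h (hint hw) hφ, ← integral_mul_const,
      ← integral_add (hwi (by fun_prop)) ((hwi hφ).mul_const C)]
    congr 1
    refine setIntegral_congr_fun measurableSet_Ioo fun s hs => ?_
    simp only [hC s hs]
    ring
  have hderiv : ∀ {w : ℝ → ℝ}, AbsolutelyContinuousOnInterval w a b → w a = 0 → w b = 0 →
      ∫ x in Ioo a b, deriv w x = 0 := by
    intro w hw ha hb
    rw [← integral_Ioc_eq_integral_Ioo, ← intervalIntegral.integral_of_le hab.le,
      hw.integral_deriv_eq_sub, ha, hb, sub_self]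
  -- For φ = 1 the transposed operator gives a constant, and the derivative has integral zero by the
  -- boundary values. The weight has positive mass, so the additive constant of the flux is forced.
  have hCC : Cu = Cv := by
    have h1 : ∀ {w : ℝ → ℝ}, AbsolutelyContinuousOnInterval w a b → w a = 0 → w b = 0 →
        ∫ x in Ioo a b, deriv w x * weightedAbel a b β α μ q p (fun _ => 1) x = 0 := by
      intro w hw ha hb
      rw [setIntegral_congr_fun (g := fun x => deriv w x * (abelConst β q * 1)) measurableSet_Ioo
        fun x hx => by simp only [weightedAbel_const hμ h.symm hx], integral_mul_const,
        hderiv hw ha hb, zero_mul]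
    have hu1 := hdual hu.ac hCu (φ := fun _ => 1) continuous_const
    have hv1 := hdual hv.ac hCv (φ := fun _ => 1) continuous_const
    rw [h1 hu.ac hu.left_zero hu.right_zero] at hu1
    rw [h1 hv.ac hv.left_zero hv.right_zero, hu1] at hv1
    have hpos : 0 < ∫ s in Ioo a b, jacobiWeight a b q p s * 1 := by
      simp only [mul_one]
      rw [setIntegral_pos_iff_support_of_nonneg_ae]
      · have : Function.support (jacobiWeight a b q p) ∩ Ioo a b = Ioo a b :=
          inter_eq_right.2 fun s hs => (jacobiWeight_pos q p hs).ne'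
        rw [this, Real.volume_Ioo]
        simpa using hab
      · filter_upwards [ae_restrict_mem measurableSet_Ioo] with s hs
          using (jacobiWeight_pos q p hs).le
      · exact integrableOn_jacobiWeight hab h.2.2.1 h.1
    exact mul_left_cancel₀ hpos.ne' (add_left_cancel (mul_left_cancel₀ hG hv1))
  have hmom : ∀ n : ℕ, ∫ x in a..b, x ^ n * deriv v x = ∫ x in a..b, x ^ n * deriv u x := by
    intro n
    obtain ⟨φ, hφ, hn⟩ := exists_weightedAbel_eq_pow hβ hα hμ₀ hμ hab h.symm n
    have h1 : ∀ w : ℝ → ℝ, ∫ x in a..b, x ^ n * deriv w x =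
        ∫ x in Ioo a b, deriv w x * weightedAbel a b β α μ q p φ x := by
      intro w
      rw [intervalIntegral.integral_of_le hab.le, integral_Ioc_eq_integral_Ioo]
      refine setIntegral_congr_fun measurableSet_Ioo fun x hx => ?_
      simp only [hn x hx, mul_comm]
    rw [h1, h1, hdual hu.ac hCu hφ, hdual hv.ac hCv hφ, hCC]
  have huIcc : uIcc a b = Icc a b := uIcc_of_le hab.le
  refine eqOn_of_integral_mul_pow_eq hab (huIcc ▸ hv.ac.continuousOn) (huIcc ▸ hu.ac.continuousOn)
    fun n => ?_
  have := hmom (n + 1)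
  rw [integral_pow_succ_mul_deriv hv.ac hv.left_zero hv.right_zero,
    integral_pow_succ_mul_deriv hu.ac hu.left_zero hu.right_zero, neg_inj] at this
  exact mul_left_cancel₀ (by positivity) this

end

/-! ### No representation as a fractional integral of order t. -/

lemma MemHStar.exists_bound {a b : ℝ} (hab : a < b) {J : ℝ → ℝ} (hJ : MemHStar a b J) :
    ∃ e D : ℝ, 0 < e ∧ ∀ x ∈ Ioc a ((a + b) / 2), |J x| ≤ D * (x - a) ^ (e - 1) := by
  obtain ⟨l, e₁, e₂, g, hl, -, he₁, -, ⟨⟨C, hC⟩, -, -⟩, hJ⟩ := hJ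
  obtain ⟨M, hM⟩ := isCompact_Icc.exists_bound_of_continuousOn (hC.continuousOn hl)
  obtain ⟨N, hN⟩ := (isCompact_Icc (a := a) (b := (a + b) / 2)).exists_bound_of_continuousOn
    (f := fun x => (b - x) ^ (e₂ - 1)) (ContinuousOn.rpow_const (by fun_prop) fun x hx =>
      Or.inl (by linarith [hx.2] : 0 < b - x).ne')
  refine ⟨e₁, M * N, he₁, fun x hx => ?_⟩
  have hx' : x ∈ Ioo a b := ⟨hx.1, by linarith [hx.2]⟩
  have h1 : 0 < x - a := sub_pos.2 hx.1
  have h2 : 0 < b - x := sub_pos.2 hx'.2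
  have hM' := hM x (Ioo_subset_Icc_self hx')
  rw [hJ x hx', div_eq_mul_inv, mul_inv, ← Real.rpow_neg h1.le, ← Real.rpow_neg h2.le, neg_sub,
    neg_sub, abs_mul, abs_mul, abs_of_pos (Real.rpow_pos_of_pos h1 _), mul_assoc M, mul_comm N]
  exact mul_le_mul hM' (mul_le_mul_of_nonneg_left (hN x (Ioc_subset_Icc_self hx)) (by positivity))
    (by positivity) ((norm_nonneg _).trans hM')

/-- As t > 1, the kernel is at most (x-a)^(t-1), and integrating the bound on J contributes a
further (x-a)^e / e. -/
lemma exists_abs_leftInt_le {a c t e D : ℝ} {J : ℝ → ℝ} (ht : 1 < t) (he : 0 < e)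
    (hJ : ∀ x ∈ Ioc a c, |J x| ≤ D * (x - a) ^ (e - 1)) :
    ∃ D', ∀ x ∈ Ioc a c, |leftInt a t J x| ≤ D' * (x - a) ^ (t - 1 + e) := by
  refine ⟨|1 / Real.Gamma t| * (D / e), fun x hx => ?_⟩
  have h1 : 0 < x - a := sub_pos.2 hx.1
  rw [leftInt, abs_mul, mul_assoc]
  refine mul_le_mul_of_nonneg_left ?_ (abs_nonneg _)
  have hint : IntervalIntegrable (fun s => (x - a) ^ (t - 1) * (D * (s - a) ^ (e - 1)))
      volume a x := by
    have := ((intervalIntegral.intervalIntegrable_rpow' (a := 0) (b := x - a)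
        (by linarith : -1 < e - 1)).comp_sub_right a)
    rw [zero_add, sub_add_cancel] at this
    exact (this.const_mul D).const_mul _
  rw [← Real.norm_eq_abs]
  refine (intervalIntegral.norm_integral_le_of_norm_le hx.1.le
    (Filter.Eventually.of_forall fun s hs => ?_) hint).trans_eq ?_
  · rw [norm_mul]
    have h2 : 0 ≤ x - s := sub_nonneg.2 hs.2
    rw [Real.norm_of_nonneg (Real.rpow_nonneg h2 _)]
    refine mul_le_mul (Real.rpow_le_rpow h2 (by linarith [hs.1]) (by linarith))
      (hJ s ⟨hs.1, hs.2.trans hx.2⟩) (abs_nonneg _) (by positivity)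
  · rw [intervalIntegral.integral_const_mul, intervalIntegral.integral_const_mul,
      intervalIntegral.integral_comp_sub_right (fun s => s ^ (e - 1)), sub_self,
      integral_rpow (Or.inl (by linarith)), sub_add_cancel, Real.zero_rpow he.ne',
      Real.rpow_add h1]
    ring

lemma exampleConst_ne_zero {α β μ p q : ℝ} (hβ : 0 < β) (hμ₀ : 0 < μ) (hμ : μ < 1)
    (h : ExponentConditions α β μ p q) : exampleConst β μ p q ≠ 0 := by
  intro h0
  have := exampleConst_mul_abelConst hβ hμ₀ h
  rw [h0, zero_mul, eq_comm, neg_eq_zero] at this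
  exact (Real.Gamma_pos_of_pos (by linarith)).ne' this

theorem not_ae_eq_leftInt {a b t β μ p q : ℝ} (hab : a < b) (ht : 1 < t) (hq : -1 < q)
    (hpt : p + 1 < t - 1) (hc : exampleConst β μ p q ≠ 0) {J : ℝ → ℝ} (hJ : MemHStar a b J) :
    ¬ ∀ᵐ x ∂(volume.restrict (Ioo a b)), exampleSolution a b β μ p q x = leftInt a t J x := by
  intro hae
  obtain ⟨e, D, he, hD⟩ := hJ.exists_bound hab
  obtain ⟨D', hD'⟩ := exists_abs_leftInt_le ht he hD
  -- κ > 0 is the gap between the order of vanishing at a that a fractional integral must have and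
  -- the order p + 1 of the explicit function.
  set κ := t - 1 + e - (p + 1)
  have hκ : 0 < κ := by simp only [κ]; linarith
  set c₀ := |exampleConst β μ p q| * ((b - a) / 2) ^ (q + 1)
  have hc₀ : 0 < c₀ := mul_pos (abs_pos.2 hc) (Real.rpow_pos_of_pos (by linarith) _)
  have hlim : Filter.Tendsto (fun x => D' * (x - a) ^ κ) (nhds a) (nhds (D' * (a - a) ^ κ)) :=
    (continuous_const.mul (Continuous.rpow_const (by fun_prop) fun _ => Or.inr hκ.le)).tendsto a
  rw [sub_self, Real.zero_rpow hκ.ne', mul_zero] at hlim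
  have hev := hlim.eventually (gt_mem_nhds hc₀)
  obtain ⟨d, hd, hsub⟩ := (mem_nhdsGE_iff_exists_Ico_subset).1 (mem_nhdsWithin_of_mem_nhds hev)
  have hd : a < d := hd
  set m := min d ((a + b) / 2)
  have ham : a < m := lt_min hd (by linarith)
  have hF : ∀ᵐ x ∂(volume.restrict (Ioo a m)), False := by
    filter_upwards [ae_restrict_of_ae_restrict_of_subset
      (Ioo_subset_Ioo_right ((min_le_right _ _).trans (by linarith))) hae,
      ae_restrict_mem measurableSet_Ioo] with x hx hxm
    have hxd : x < d := hxm.2.trans_le (min_le_left _ _)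
    have hx2 : x < (a + b) / 2 := hxm.2.trans_le (min_le_right _ _)
    have h1 : 0 < x - a := sub_pos.2 hxm.1
    have hb := hD' x ⟨hxm.1, hx2.le⟩
    have hlt : D' * (x - a) ^ κ < c₀ := hsub ⟨hxm.1.le, hxd⟩
    rw [← hx, exampleSolution, abs_mul, abs_mul, abs_of_pos (Real.rpow_pos_of_pos h1 _),
      abs_of_pos (Real.rpow_pos_of_pos (by linarith) _)] at hb
    have hge : c₀ * (x - a) ^ (p + 1) ≤
        |exampleConst β μ p q| * (x - a) ^ (p + 1) * (b - x) ^ (q + 1) := by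
      have : ((b - a) / 2) ^ (q + 1) ≤ (b - x) ^ (q + 1) :=
        Real.rpow_le_rpow (by linarith) (by linarith) (by linarith)
      simp only [c₀]
      rw [mul_right_comm]
      exact mul_le_mul_of_nonneg_left this (by positivity)
    have he : (x - a) ^ (t - 1 + e) = (x - a) ^ κ * (x - a) ^ (p + 1) := by
      rw [← Real.rpow_add h1]; congr 1; simp only [κ]; ring
    rw [he, ← mul_assoc] at hb
    exact absurd (le_of_mul_le_mul_right (hge.trans hb) (Real.rpow_pos_of_pos h1 _)) (not_le.2 hlt)
  rw [ae_iff] at hF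
  simp only [not_false_eq_true, ofPred_true, Measure.restrict_apply_univ, Real.volume_Ioo,
    ENNReal.ofReal_eq_zero] at hF
  linarith

/-! ### The derivative of order t is not integrable. -/

lemma exists_abs_le_of_integrableOn_deriv {F F' : ℝ → ℝ} {a b : ℝ} (hab : a < b)
    (hd : ∀ x ∈ Ioo a b, HasDerivAt F (F' x) x) (hi : IntegrableOn F' (Ioo a b)) :
    ∃ M, ∀ x ∈ Ioo a b, |F x| ≤ M := by
  have hm : (a + b) / 2 ∈ Ioo a b := ⟨by linarith, by linarith⟩
  refine ⟨|F ((a + b) / 2)| + ∫ x in Ioo a b, ‖F' x‖, fun x hx => ?_⟩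
  have hsub : uIcc ((a + b) / 2) x ⊆ Ioo a b := ordConnected_Ioo.uIcc_subset hm hx
  have hsub' := uIoc_subset_uIcc.trans hsub
  have e := intervalIntegral.integral_eq_sub_of_hasDerivAt (fun y hy => hd y (hsub hy))
    (intervalIntegrable_iff.2 (hi.mono_set hsub'))
  have h1 : |F x - F ((a + b) / 2)| ≤ ∫ x in Ioo a b, ‖F' x‖ := by
    rw [← e, ← Real.norm_eq_abs]
    refine (intervalIntegral.norm_integral_le_integral_norm_uIoc).trans ?_
    exact setIntegral_mono_set hi.norm (Filter.Eventually.of_forall fun _ => norm_nonneg _)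
      (Filter.Eventually.of_forall hsub')
  have := abs_add_le (F ((a + b) / 2)) (F x - F ((a + b) / 2))
  rw [add_sub_cancel] at this
  linarith

lemma integrableOn_of_integrableOn_deriv {F F' : ℝ → ℝ} {a b : ℝ} (hab : a < b)
    (hd : ∀ x ∈ Ioo a b, HasDerivAt F (F' x) x) (hi : IntegrableOn F' (Ioo a b)) :
    IntegrableOn F (Ioo a b) := by
  obtain ⟨M, hM⟩ := exists_abs_le_of_integrableOn_deriv hab hd hi
  refine IntegrableOn.of_bound (C := M) (by simp) ?_ ?_
  · exact ContinuousOn.aestronglyMeasurable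
      (fun x hx => (hd x hx).continuousAt.continuousWithinAt) measurableSet_Ioo
  · filter_upwards [ae_restrict_mem measurableSet_Ioo] with x hx using hM x hx

lemma hasDerivAt_iteratedDeriv_of_contDiffOn {g : ℝ → ℝ} {s : Set ℝ} (hs : IsOpen s)
    (hg : ∀ n : ℕ, ContDiffOn ℝ n g s) (k : ℕ) {x : ℝ} (hx : x ∈ s) :
    HasDerivAt (iteratedDeriv k g) (iteratedDeriv (k + 1) g x) x := by
  rw [iteratedDeriv_succ]
  have h := (hg (k + 1)).differentiableOn_iteratedDerivWithin (m := k) (by norm_cast; omega)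
    hs.uniqueDiffOn
  exact ((h.congr fun y hy => (iteratedDerivWithin_of_isOpen hs hy).symm).differentiableAt
    (hs.mem_nhds hx)).hasDerivAt

/-- An integrable derivative bounds its primitive, which is then integrable on the bounded interval;
this descends through all intermediate orders. -/
lemma exists_abs_iteratedDeriv_le {g : ℝ → ℝ} {a b : ℝ} (hab : a < b)
    (hg : ∀ n : ℕ, ContDiffOn ℝ n g (Ioo a b)) (k j : ℕ)
    (hi : IntegrableOn (iteratedDeriv (k + 1 + j) g) (Ioo a b)) :
    ∃ M, ∀ x ∈ Ioo a b, |iteratedDeriv k g x| ≤ M := by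
  have hd := fun (k : ℕ) (x : ℝ) (hx : x ∈ Ioo a b) =>
    hasDerivAt_iteratedDeriv_of_contDiffOn isOpen_Ioo hg k hx
  induction j with
  | zero => exact exists_abs_le_of_integrableOn_deriv hab (hd k) hi
  | succ j ih => exact ih (integrableOn_of_integrableOn_deriv hab (hd _) hi)

/-- The parametric integral that describes left fractional integrals of Jacobi weights. -/
def jacobiParam (σ p B r : ℝ) (j : ℕ) (z : ℝ) : ℝ :=
  ∫ y in (0 : ℝ)..1, ((1 - y) ^ (σ - 1) * y ^ p * y ^ j) * (B - z * y) ^ r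

lemma intervalIntegrable_jacobi_pow {σ p : ℝ} (hσ : 0 < σ) (hp : -1 < p) (j : ℕ) :
    IntervalIntegrable (fun y : ℝ => (1 - y) ^ (σ - 1) * y ^ p * y ^ j) volume 0 1 := by
  have := intervalIntegrable_rpow_mul_one_sub_rpow hσ (by linarith : 0 < p + 1)
  rw [add_sub_cancel_right] at this
  exact this.mul_continuousOn (by fun_prop)

section

variable {σ p B r : ℝ}

lemma hasDerivAt_jacobiParam (hσ : 0 < σ) (hp : -1 < p) (hB : 0 < B) (r : ℝ) (j : ℕ) {z : ℝ}
    (hz : z < B) :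
    HasDerivAt (jacobiParam σ p B r j) (-r * jacobiParam σ p B (r - 1) (j + 1) z) z := by
  have := hasDerivAt_integral_mul_sub_mul_rpow (intervalIntegrable_jacobi_pow hσ hp j) hB hz r
  refine HasDerivAt.congr_deriv (f := jacobiParam σ p B r j) this ?_
  simp only [jacobiParam, pow_succ, mul_assoc]

lemma contDiffOn_jacobiParam (hσ : 0 < σ) (hp : -1 < p) (hB : 0 < B) (r : ℝ) (j n : ℕ) :
    ContDiffOn ℝ n (jacobiParam σ p B r j) (Iio B) :=
  contDiffOn_integral_mul_sub_mul_rpow hB n (intervalIntegrable_jacobi_pow hσ hp j) r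

lemma jacobiParam_zero_zero (hσ : 0 < σ) (hp : -1 < p) :
    jacobiParam σ p B r 0 0 = ProbabilityTheory.beta σ (p + 1) * B ^ r := by
  rw [← integral_rpow_mul_one_sub_rpow hσ (by linarith : 0 < p + 1),
    ← intervalIntegral.integral_mul_const]
  simp [jacobiParam]

lemma jacobiParam_nonneg (hB : 0 < B) {z : ℝ} (hz : z < B) (j : ℕ) :
    0 ≤ jacobiParam σ p B r j z := by
  refine intervalIntegral.integral_nonneg zero_le_one fun y hy => ?_
  have h1 := sub_mul_pos hB hz hy
  have h2 : 0 ≤ 1 - y := sub_nonneg.2 hy.2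
  have h3 : 0 ≤ y := hy.1
  positivity

lemma jacobiParam_le (hσ : 0 < σ) (hp : -1 < p) (hB : 0 < B) (hr : 0 ≤ r) {z : ℝ} (hz₀ : 0 ≤ z)
    (hz : z < B) : jacobiParam σ p B r 0 z ≤ jacobiParam σ p B r 0 0 := by
  refine intervalIntegral.integral_mono_on zero_le_one
    (intervalIntegrable_mul_sub_mul_rpow (intervalIntegrable_jacobi_pow hσ hp 0) hB hz r)
    (intervalIntegrable_mul_sub_mul_rpow (intervalIntegrable_jacobi_pow hσ hp 0) hB hB r)
    fun y hy => ?_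
  have h1 := sub_mul_pos hB hz hy
  have h2 : 0 ≤ 1 - y := sub_nonneg.2 hy.2
  have h3 : 0 ≤ y := hy.1
  refine mul_le_mul_of_nonneg_left (Real.rpow_le_rpow h1.le ?_ hr) (by positivity)
  nlinarith

/-- At z = B(1-ε), the window 1-2ε < y ≤ 1-ε has length ε, and there 1 - y ≤ 2ε and B - zy ≤ 3Bε. As
both exponents are nonpositive, the window contributes at least a constant times ε^(σ+r), which
tends to ∞. Taking ε < 1/4 keeps y ≥ 1/2, away from the singularity at 0. -/
lemma exists_lt_jacobiParam (hσ : 0 < σ) (hσ₁ : σ ≤ 1) (hp : -1 < p) (hB : 0 < B) (hr : r < 0)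
    (hσr : σ + r < 0) (j : ℕ) (M : ℝ) :
    ∃ z ∈ Ioo (B / 2) B, M < jacobiParam σ p B r j z := by
  obtain ⟨w, hw, hwle⟩ : ∃ w : ℝ, 0 < w ∧ ∀ y ∈ Icc (1 / 2 : ℝ) 1, w ≤ y ^ p * y ^ j := by
    obtain ⟨y₀, hy₀, hmin⟩ := (isCompact_Icc (a := (1 / 2 : ℝ)) (b := 1)).exists_isMinOn
      ⟨1, by norm_num, le_rfl⟩ (f := fun y : ℝ => y ^ p * y ^ j)
      (ContinuousOn.mul (ContinuousOn.rpow_const continuousOn_id fun y hy =>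
        Or.inl (by linarith [hy.1] : 0 < y).ne') (by fun_prop))
    have : 0 < y₀ := by linarith [hy₀.1]
    exact ⟨_, by positivity, fun y hy => hmin hy⟩
  set D := 2 ^ (σ - 1) * w * (3 * B) ^ r
  have hD : 0 < D := by positivity
  have hlim := (tendsto_rpow_neg_nhdsGT_zero hσr).eventually_gt_atTop (M / D)
  obtain ⟨ε, hε, hε0, hε4⟩ :=
    (hlim.and (Ioo_mem_nhdsGT (by norm_num : (0 : ℝ) < 1 / 4))).exists
  have hz : B * (1 - ε) < B := by nlinarith
  refine ⟨B * (1 - ε), ⟨by nlinarith, hz⟩, ?_⟩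
  rw [div_lt_iff₀ hD] at hε
  refine hε.trans_le ?_
  have hint := intervalIntegrable_mul_sub_mul_rpow (intervalIntegrable_jacobi_pow hσ hp j) hB hz r
  have hsub : Ioc (1 - 2 * ε) (1 - ε) ⊆ Ioc 0 1 := Ioc_subset_Ioc (by linarith) (by linarith)
  rw [intervalIntegrable_iff_integrableOn_Ioc_of_le zero_le_one] at hint
  have hnonneg : ∀ y ∈ Ioc (0 : ℝ) 1,
      0 ≤ ((1 - y) ^ (σ - 1) * y ^ p * y ^ j) * (B - B * (1 - ε) * y) ^ r := by
    intro y hy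
    have h1 := sub_mul_pos hB hz (Ioc_subset_Icc_self hy)
    have h2 : 0 ≤ 1 - y := sub_nonneg.2 hy.2
    have h3 : 0 ≤ y := hy.1.le
    positivity
  calc ε ^ (σ + r) * D
      = ∫ y in Ioc (1 - 2 * ε) (1 - ε), (2 * ε) ^ (σ - 1) * w * (3 * B * ε) ^ r := by
        rw [setIntegral_const, Real.volume_real_Ioc, smul_eq_mul,
          show max (1 - ε - (1 - 2 * ε)) 0 = ε by rw [max_eq_left] <;> linarith,
          Real.mul_rpow two_pos.le hε0.le, Real.mul_rpow (by positivity) hε0.le,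
          show σ + r = 1 + (σ - 1) + r by ring, Real.rpow_add hε0, Real.rpow_add hε0,
          Real.rpow_one]
        simp only [D]
        ring
    _ ≤ ∫ y in Ioc (1 - 2 * ε) (1 - ε),
          ((1 - y) ^ (σ - 1) * y ^ p * y ^ j) * (B - B * (1 - ε) * y) ^ r := by
        refine setIntegral_mono_on (integrable_const _) (hint.mono_set hsub) measurableSet_Ioc fun y hy => ?_
        have hy1 : 0 < 1 - y := by linarith [hy.2]
        have hyI : y ∈ Icc (0 : ℝ) 1 := Ioc_subset_Icc_self (hsub hy)
        have e1 : (2 * ε) ^ (σ - 1) ≤ (1 - y) ^ (σ - 1) :=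
          Real.rpow_le_rpow_of_nonpos hy1 (by linarith [hy.1]) (by linarith)
        have e2 := hwle y ⟨by linarith [hy.1], hyI.2⟩
        have e3 : (3 * B * ε) ^ r ≤ (B - B * (1 - ε) * y) ^ r := by
          refine Real.rpow_le_rpow_of_nonpos (sub_mul_pos hB hz hyI) ?_ hr.le
          have : B * (1 - y) ≤ B * (2 * ε) := by
            apply mul_le_mul_of_nonneg_left _ hB.le; linarith [hy.1]
          have : B * ε * y ≤ B * ε := mul_le_of_le_one_right (by positivity) hyI.2
          nlinarith
        rw [mul_assoc ((1 - y) ^ (σ - 1))]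
        have : 0 < (2 * ε) ^ (σ - 1) := by positivity
        have : 0 ≤ (3 * B * ε) ^ r := by positivity
        have : 0 ≤ y := hyI.1
        gcongr
    _ ≤ ∫ y in Ioc 0 1, ((1 - y) ^ (σ - 1) * y ^ p * y ^ j) * (B - B * (1 - ε) * y) ^ r := by
        refine setIntegral_mono_set hint ?_ (Filter.Eventually.of_forall hsub)
        filter_upwards [ae_restrict_mem measurableSet_Ioc] with y hy using hnonneg y hy
    _ = jacobiParam σ p B r j (B * (1 - ε)) := by
        rw [jacobiParam, intervalIntegral.integral_of_le zero_le_one]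

end

lemma leftInt_exampleSolution {a b β μ p q σ x : ℝ} (hx : a < x) :
    leftInt a σ (exampleSolution a b β μ p q) x =
      exampleConst β μ p q / Real.Gamma σ *
        ((x - a) ^ (σ + (p + 1)) * jacobiParam σ (p + 1) (b - a) (q + 1) 0 (x - a)) := by
  have h := integral_left_eq_rpow_mul hx b σ (p + 1) (q + 1)
  simp only [jacobiParam, pow_zero, mul_one]
  rw [← h, leftInt]
  have : ∫ s in a..x, (x - s) ^ (σ - 1) * exampleSolution a b β μ p q s =
      ∫ s in a..x, exampleConst β μ p q *
        ((x - s) ^ (σ - 1) * ((s - a) ^ (p + 1) * (b - s) ^ (q + 1))) := by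
    congr 1; ext s; rw [exampleSolution]; ring
  rw [this, intervalIntegral.integral_const_mul]
  ring

lemma contDiffOn_leftInt_exampleSolution {a b β μ p q σ : ℝ} (hab : a < b) (hσ : 0 < σ)
    (hp : -1 < p) (n : ℕ) :
    ContDiffOn ℝ n (leftInt a σ (exampleSolution a b β μ p q)) (Ioo a b) := by
  refine ContDiffOn.congr (contDiffOn_const.mul (ContDiffOn.mul ?_ ?_))
    fun x hx => leftInt_exampleSolution hx.1
  · exact ContDiffOn.rpow_const_of_ne (by fun_prop) fun x hx => (sub_pos.2 hx.1).ne'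
  · refine (contDiffOn_jacobiParam hσ (by linarith) (sub_pos.2 hab) (q + 1) 0 n).comp
      (g := jacobiParam σ (p + 1) (b - a) (q + 1) 0) (f := fun x => x - a) (by fun_prop) ?_
    intro x hx
    exact sub_lt_sub_right hx.2 a

lemma rlOrder_sub_mem {t : ℝ} (ht : 0 ≤ t) : (rlOrder t : ℝ) - t ∈ Ioc (0 : ℝ) 1 := by
  have h1 := Nat.floor_le ht
  have h2 := Nat.lt_floor_add_one t
  simp only [rlOrder]
  push_cast
  exact ⟨by linarith, by linarith⟩

theorem hasLeftDeriv_exampleSolution {a b t β μ p q : ℝ} (hab : a < b) (ht : 0 ≤ t)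
    (hp : -1 < p) : HasLeftDeriv a b t (exampleSolution a b β μ p q) :=
  contDiffOn_leftInt_exampleSolution hab (rlOrder_sub_mem ht).1 hp _

section

variable {C a b σ P r : ℝ}

lemma hasDerivAt_rpow_mul_jacobiParam (hσ : 0 < σ) (hP : -1 < P) (hab : a < b) (e r : ℝ) (j : ℕ)
    {x : ℝ} (hx : x ∈ Ioo a b) :
    HasDerivAt (fun x => (x - a) ^ e * jacobiParam σ P (b - a) r j (x - a))
      (e * ((x - a) ^ (e - 1) * jacobiParam σ P (b - a) r j (x - a)) +
        -r * ((x - a) ^ e * jacobiParam σ P (b - a) (r - 1) (j + 1) (x - a))) x := by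
  have h1 : 0 < x - a := sub_pos.2 hx.1
  have d1 := ((hasDerivAt_id x).sub_const a).rpow_const (p := e) (Or.inl h1.ne')
  have d2 := HasDerivAt.comp_sub_const x a
    (hasDerivAt_jacobiParam hσ hP (sub_pos.2 hab) r j (sub_lt_sub_right hx.2 a))
  refine (d1.mul d2).congr_deriv ?_
  simp only [id]
  ring

lemma iteratedDeriv_one_rpow_mul_jacobiParam (hσ : 0 < σ) (hP : -1 < P) (hab : a < b)
    {g : ℝ → ℝ} {e r : ℝ}
    (hg : ∀ x ∈ Ioo a b, g x = C * ((x - a) ^ e * jacobiParam σ P (b - a) r 0 (x - a)))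
    {x : ℝ} (hx : x ∈ Ioo a b) :
    iteratedDeriv 1 g x = C * (e * ((x - a) ^ (e - 1) * jacobiParam σ P (b - a) r 0 (x - a)) +
        -r * ((x - a) ^ e * jacobiParam σ P (b - a) (r - 1) 1 (x - a))) := by
  rw [iteratedDeriv_one]
  have : g =ᶠ[nhds x] fun x => C * ((x - a) ^ e * jacobiParam σ P (b - a) r 0 (x - a)) := by
    filter_upwards [isOpen_Ioo.mem_nhds hx] with y hy using hg y hy
  rw [this.deriv_eq]
  exact ((hasDerivAt_rpow_mul_jacobiParam hσ hP hab e r 0 hx).const_mul C).deriv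

lemma iteratedDeriv_two_rpow_mul_jacobiParam (hσ : 0 < σ) (hP : -1 < P) (hab : a < b)
    {g : ℝ → ℝ} {e r : ℝ}
    (hg : ∀ x ∈ Ioo a b, g x = C * ((x - a) ^ e * jacobiParam σ P (b - a) r 0 (x - a)))
    {x : ℝ} (hx : x ∈ Ioo a b) :
    iteratedDeriv 2 g x =
      C * (e * (e - 1) * ((x - a) ^ (e - 2) * jacobiParam σ P (b - a) r 0 (x - a)) -
        2 * e * r * ((x - a) ^ (e - 1) * jacobiParam σ P (b - a) (r - 1) 1 (x - a)) +
        r * (r - 1) * ((x - a) ^ e * jacobiParam σ P (b - a) (r - 2) 2 (x - a))) := by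
  rw [iteratedDeriv_succ]
  have : iteratedDeriv 1 g =ᶠ[nhds x] fun x =>
      C * (e * ((x - a) ^ (e - 1) * jacobiParam σ P (b - a) r 0 (x - a)) +
        -r * ((x - a) ^ e * jacobiParam σ P (b - a) (r - 1) 1 (x - a))) := by
    filter_upwards [isOpen_Ioo.mem_nhds hx] with y hy
      using iteratedDeriv_one_rpow_mul_jacobiParam hσ hP hab hg hy
  rw [this.deriv_eq]
  have d := (((hasDerivAt_rpow_mul_jacobiParam hσ hP hab (e - 1) r 0 hx).const_mul e).add
    ((hasDerivAt_rpow_mul_jacobiParam hσ hP hab e (r - 1) 1 hx).const_mul (-r))).const_mul C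
  refine d.deriv.trans ?_
  rw [show e - 1 - 1 = e - 2 by ring, show r - 1 - 1 = r - 2 by ring]
  ring

/-- The singularity at the left endpoint. -/
lemma not_bounded_iteratedDeriv_one (hσ : 0 < σ) (hP : -1 < P) (hab : a < b) (hC : C ≠ 0)
    {g : ℝ → ℝ} {e r : ℝ} (he₀ : 0 < e) (he₁ : e < 1)
    (hg : ∀ x ∈ Ioo a b, g x = C * ((x - a) ^ e * jacobiParam σ P (b - a) r 0 (x - a))) :
    ¬ ∃ M, ∀ x ∈ Ioo a b, |iteratedDeriv 1 g x| ≤ M := by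
  rintro ⟨M, hM⟩
  have hB : 0 < b - a := sub_pos.2 hab
  -- F is (x-a)^(1-e) times the first derivative, rewritten so that it extends continuously to a
  -- with a nonzero value. A bounded derivative would force the limit 0.
  set F : ℝ → ℝ := fun x => C * (e * jacobiParam σ P (b - a) r 0 (x - a) +
    -r * ((x - a) * jacobiParam σ P (b - a) (r - 1) 1 (x - a)))
  have hFe : ∀ x ∈ Ioo a b, F x = (x - a) ^ (1 - e) * iteratedDeriv 1 g x := by
    intro x hx
    have h1 : 0 < x - a := sub_pos.2 hx.1
    rw [iteratedDeriv_one_rpow_mul_jacobiParam hσ hP hab hg hx]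
    have e1 : (x - a) ^ (1 - e) * (x - a) ^ (e - 1) = 1 := by
      rw [← Real.rpow_add h1]; simp
    have e2 : (x - a) ^ (1 - e) * (x - a) ^ e = x - a := by
      rw [← Real.rpow_add h1]; simp
    simp only [F]
    linear_combination -C * e * jacobiParam σ P (b - a) r 0 (x - a) * e1 +
      C * r * jacobiParam σ P (b - a) (r - 1) 1 (x - a) * e2
  have hc : ∀ r j, ContinuousAt (fun x => jacobiParam σ P (b - a) r j (x - a)) a := by
    intro r j
    refine ContinuousAt.comp (f := fun x => x - a) (g := jacobiParam σ P (b - a) r j) ?_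
      (by fun_prop)
    rw [sub_self]
    exact (hasDerivAt_jacobiParam hσ hP hB r j hB).continuousAt
  have hFc : ContinuousAt F a := by
    have h1 := hc r 0
    have h2 := hc (r - 1) 1
    fun_prop
  have hF0 : F a ≠ 0 := by
    simp only [F, sub_self, zero_mul, mul_zero, add_zero]
    rw [jacobiParam_zero_zero hσ hP]
    have := ProbabilityTheory.beta_pos hσ (by linarith : 0 < P + 1)
    positivity
  have hlim0 : Filter.Tendsto F (nhdsWithin a (Ioi a)) (nhds 0) := by
    have hr : Filter.Tendsto (fun x => M * (x - a) ^ (1 - e)) (nhdsWithin a (Ioi a)) (nhds 0) := by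
      have : ContinuousAt (fun x => M * (x - a) ^ (1 - e)) a :=
        continuousAt_const.mul (ContinuousAt.rpow_const (by fun_prop) (Or.inr (by linarith)))
      have := this.tendsto
      rw [sub_self, Real.zero_rpow (by linarith), mul_zero] at this
      exact this.mono_left nhdsWithin_le_nhds
    refine squeeze_zero_norm' ?_ hr
    filter_upwards [Ioo_mem_nhdsGT hab] with x hx
    have h1 : 0 < x - a := sub_pos.2 hx.1
    rw [hFe x hx, norm_mul, Real.norm_of_nonneg (by positivity), mul_comm]
    exact mul_le_mul_of_nonneg_right (hM x hx) (by positivity)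
  exact hF0 (tendsto_nhds_unique (hFc.tendsto.mono_left nhdsWithin_le_nhds) hlim0)

/-- The singularity at the right endpoint. -/
lemma not_bounded_iteratedDeriv_two (hσ : 0 < σ) (hσ₁ : σ ≤ 1) (hP : -1 < P) (hab : a < b)
    (hC : C ≠ 0) {g : ℝ → ℝ} {e r : ℝ} (he : 0 < e) (hr₀ : 0 < r) (hr₁ : r < 1)
    (hg : ∀ x ∈ Ioo a b, g x = C * ((x - a) ^ e * jacobiParam σ P (b - a) r 0 (x - a))) :
    ¬ ∃ M, ∀ x ∈ Ioo a b, |iteratedDeriv 2 g x| ≤ M := by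
  rintro ⟨M, hM⟩
  have hB : 0 < b - a := sub_pos.2 hab
  set B := b - a
  obtain ⟨N, hN⟩ := (isCompact_Icc (a := B / 2) (b := B)).exists_bound_of_continuousOn
    (f := fun z : ℝ => z ^ (e - 2)) (ContinuousOn.rpow_const continuousOn_id fun z hz =>
      Or.inl (by linarith [hz.1] : 0 < z).ne')
  set ψ₀ := jacobiParam σ P B r 0 0
  have hψ₀ : 0 ≤ ψ₀ := jacobiParam_nonneg hB hB 0
  set D := r * (1 - r) * (B / 2) ^ e
  have hD : 0 < D := mul_pos (mul_pos hr₀ (by linarith)) (by positivity)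
  obtain ⟨z, hz, hlt⟩ := exists_lt_jacobiParam hσ hσ₁ hP hB (by linarith : r - 2 < 0)
    (by linarith) 2 ((M / |C| + |e * (e - 1)| * (N * ψ₀)) / D)
  have hz0 : 0 < z := by linarith [hz.1]
  have hxm : z + a ∈ Ioo a b := ⟨by linarith, by have := hz.2; simp only [B] at this; linarith⟩
  have hMz := hM _ hxm
  rw [iteratedDeriv_two_rpow_mul_jacobiParam hσ hP hab hg hxm, add_sub_cancel_right, abs_mul,
    mul_comm, ← le_div_iff₀ (abs_pos.2 hC)] at hMz
  rw [div_lt_iff₀ hD] at hlt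
  have h2 := jacobiParam_nonneg (σ := σ) (p := P) (r := r - 2) hB hz.2 2
  have h1 := jacobiParam_nonneg (σ := σ) (p := P) (r := r - 1) hB hz.2 1
  have h0 := jacobiParam_nonneg (σ := σ) (p := P) (r := r) hB hz.2 0
  have h0' : jacobiParam σ P B r 0 z ≤ ψ₀ := jacobiParam_le hσ hP hB hr₀.le hz0.le hz.2
  have hN' := hN z (Ioo_subset_Icc_self hz)
  rw [Real.norm_of_nonneg (by positivity)] at hN'
  -- Near b the first term stays bounded, while the other two are both nonpositive because 0 < r <
  -- 1. The divergence of the last one therefore cannot be cancelled.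
  have t1 : e * (e - 1) * (z ^ (e - 2) * jacobiParam σ P B r 0 z) ≤ |e * (e - 1)| * (N * ψ₀) := by
    refine (mul_le_mul_of_nonneg_right (le_abs_self _) (by positivity)).trans ?_
    gcongr
    exact le_trans (by positivity) hN'
  have t2 : 0 ≤ 2 * e * r * (z ^ (e - 1) * jacobiParam σ P B (r - 1) 1 z) := by positivity
  have t3 : jacobiParam σ P B (r - 2) 2 z * D ≤
      r * (1 - r) * (z ^ e * jacobiParam σ P B (r - 2) 2 z) := by
    have : (B / 2) ^ e ≤ z ^ e := Real.rpow_le_rpow (by positivity) hz.1.le he.le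
    simp only [D]
    rw [mul_comm, mul_assoc]
    have h1r : 0 ≤ 1 - r := by linarith
    gcongr
  have := (abs_le.1 hMz).1
  linarith

end

/-- For t < 2 the fractional integral of u behaves at a like a power with exponent 3 - t + p in
(0,1), so its first derivative is unbounded. For t ≥ 2 that exponent may equal 1 and the leading
term of the second derivative at a disappears; the exponent q + 1 in (0,1) at b is used instead. -/
theorem not_integrableOn_leftDeriv {a b t β μ p q : ℝ} (hab : a < b) (ht : 1 < t)
    (hp : -1 < p) (hq : -1 < q) (hq₀ : q < 0) (hpt : p + 1 < t - 1)
    (hc : exampleConst β μ p q ≠ 0) :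
    ¬ IntegrableOn (leftDeriv a t (exampleSolution a b β μ p q)) (Ioo a b) := by
  intro hi
  obtain ⟨hσ, hσ₁⟩ := rlOrder_sub_mem (by linarith : 0 ≤ t)
  set σ := (rlOrder t : ℝ) - t with hσdef
  have hn : t = rlOrder t - σ := by rw [hσdef]; ring
  have hG := (Real.Gamma_pos_of_pos hσ).ne'
  have hC : exampleConst β μ p q / Real.Gamma σ ≠ 0 := div_ne_zero hc hG
  have hg := fun n => contDiffOn_leftInt_exampleSolution (β := β) (μ := μ) (q := q) hab hσ hp n
  have hge : ∀ x ∈ Ioo a b, leftInt a σ (exampleSolution a b β μ p q) x = _ :=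
    fun x hx => leftInt_exampleSolution hx.1
  change IntegrableOn (iteratedDeriv (rlOrder t) (leftInt a σ (exampleSolution a b β μ p q))) _ at hi
  obtain hlt | hle := lt_or_ge t 2
  · have h2 : rlOrder t = 2 := by
      have : ⌊t⌋₊ = 1 := (Nat.floor_eq_iff (by linarith)).2 ⟨by simpa using ht.le, by norm_num; exact hlt⟩
      simp [rlOrder, this]
    rw [h2] at hi hn
    push_cast at hn
    exact not_bounded_iteratedDeriv_one hσ (by linarith) hab hC (by linarith) (by linarith) hge
      (exists_abs_iteratedDeriv_le hab hg 1 0 hi)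
  · obtain ⟨j, hj⟩ : ∃ j, rlOrder t = 2 + 1 + j := by
      have : 2 ≤ ⌊t⌋₊ := Nat.le_floor (by exact_mod_cast hle)
      exact ⟨⌊t⌋₊ - 2, by simp only [rlOrder]; omega⟩
    rw [hj] at hi
    exact not_bounded_iteratedDeriv_two hσ hσ₁ (by linarith) hab hC (by linarith) (by linarith)
      (by linarith) hge (exists_abs_iteratedDeriv_le hab hg 2 j hi)

/-! ### Fourier decay of functions with power singularities at the endpoints. -/

/-- The Fourier character `x ↦ exp(-2πixξ)`. -/
def fourierExp (ξ x : ℝ) : ℂ := Complex.exp (↑(-2 * Real.pi * x * ξ) * Complex.I)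

lemma norm_fourierExp (ξ x : ℝ) : ‖fourierExp ξ x‖ = 1 := Complex.norm_exp_ofReal_mul_I _

lemma continuous_fourierExp (ξ : ℝ) : Continuous (fourierExp ξ) := by
  unfold fourierExp; fun_prop

lemma hasDerivAt_fourierExp (ξ x : ℝ) :
    HasDerivAt (fourierExp ξ) (↑(-2 * Real.pi * ξ) * Complex.I * fourierExp ξ x) x := by
  have h1 : HasDerivAt (fun x : ℝ => -2 * Real.pi * x * ξ) (-2 * Real.pi * ξ) x := by
    simpa using ((hasDerivAt_id x).const_mul (-2 * Real.pi)).mul_const ξ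
  have := (h1.ofReal_comp.mul_const Complex.I).cexp
  refine this.congr_deriv ?_
  rw [fourierExp, mul_comm]

lemma norm_integral_mul_fourierExp_le_of_bound {c d : ℝ} (hcd : c ≤ d) {F G : ℝ → ℝ} (ξ : ℝ)
    (hFG : ∀ x ∈ Ioo c d, |F x| ≤ G x) (hG : IntervalIntegrable G volume c d) :
    ‖∫ x in c..d, (F x : ℂ) * fourierExp ξ x‖ ≤ ∫ x in c..d, G x := by
  refine intervalIntegral.norm_integral_le_of_norm_le hcd ?_ hG
  filter_upwards [compl_mem_ae_iff.2 (measure_singleton (μ := volume) d)] with x hx hxc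
  rw [norm_mul, norm_fourierExp, mul_one, Complex.norm_real]
  exact hFG x ⟨hxc.1, lt_of_le_of_ne hxc.2 hx⟩

/-- One integration by parts; the factor 1/(2π) is discarded. -/
lemma norm_integral_mul_fourierExp_le {c d : ℝ} (hcd : c ≤ d) {W W₁ : ℝ → ℝ} {ξ : ℝ}
    (hξ : ξ ≠ 0) (hW : ContinuousOn W (Icc c d)) (h1 : ∀ x ∈ Ioo c d, HasDerivAt W (W₁ x) x)
    (hi : IntervalIntegrable W₁ volume c d) :
    ‖∫ x in c..d, (W x : ℂ) * fourierExp ξ x‖ ≤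
      |ξ|⁻¹ * (|W d| + |W c| + ‖∫ x in c..d, (W₁ x : ℂ) * fourierExp ξ x‖) := by
  set l : ℂ := ↑(-2 * Real.pi * ξ) * Complex.I
  have hlr : -2 * Real.pi * ξ ≠ 0 := mul_ne_zero (by simp) hξ
  have hl : l ≠ 0 := mul_ne_zero (by exact_mod_cast hlr) Complex.I_ne_zero
  have hln : ‖l⁻¹‖ ≤ |ξ|⁻¹ := by
    rw [norm_inv]
    refine inv_anti₀ (abs_pos.2 hξ) ?_
    simp only [l, norm_mul, Complex.norm_real, Complex.norm_I, mul_one, Real.norm_eq_abs, abs_neg,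
      Nat.abs_ofNat, abs_of_pos Real.pi_pos]
    nlinarith [Real.pi_gt_three, abs_nonneg ξ]
  have hE := continuous_fourierExp ξ
  have hu : uIcc c d = Icc c d := uIcc_of_le hcd
  have hp := intervalIntegral.integral_mul_deriv_eq_deriv_mul_of_hasDerivAt (a := c) (b := d)
    (u := fun x => (W x : ℂ)) (u' := fun x => (W₁ x : ℂ)) (v := fun x => l⁻¹ * fourierExp ξ x)
    (v' := fun x => fourierExp ξ x) ?_ (by fun_prop) ?_ ?_ ?_ (hE.intervalIntegrable _ _)
  · rw [hp]
    have e : ∫ x in c..d, (W₁ x : ℂ) * (l⁻¹ * fourierExp ξ x) =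
        l⁻¹ * ∫ x in c..d, (W₁ x : ℂ) * fourierExp ξ x := by
      rw [← intervalIntegral.integral_const_mul]
      congr 1; ext x; ring
    rw [e, show (W d : ℂ) * (l⁻¹ * fourierExp ξ d) - W c * (l⁻¹ * fourierExp ξ c) -
      l⁻¹ * (∫ x in c..d, (W₁ x : ℂ) * fourierExp ξ x) = l⁻¹ * (W d * fourierExp ξ d -
        W c * fourierExp ξ c - ∫ x in c..d, (W₁ x : ℂ) * fourierExp ξ x) by ring, norm_mul]
    refine mul_le_mul hln ?_ (norm_nonneg _) (by positivity)
    refine (norm_sub_le _ _).trans (add_le_add_left ((norm_sub_le _ _).trans ?_) _)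
    simp [norm_fourierExp]
  · rw [hu]
    exact Complex.continuous_ofReal.comp_continuousOn hW
  · intro x hx
    rw [min_eq_left hcd, max_eq_right hcd] at hx
    exact (h1 x hx).ofReal_comp
  · intro x _
    refine ((hasDerivAt_fourierExp ξ x).const_mul l⁻¹).congr_deriv ?_
    rw [← mul_assoc]
    simp only [l] at hl ⊢
    rw [inv_mul_cancel₀ hl, one_mul]
  · exact ⟨hi.1.ofReal, hi.2.ofReal⟩

lemma intervalIntegrable_sub_left_rpow {θ : ℝ} (hθ : -1 < θ) (a c d : ℝ) :
    IntervalIntegrable (fun x => (x - a) ^ θ) volume c d := by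
  have := (intervalIntegral.intervalIntegrable_rpow' (a := c - a) (b := d - a) hθ).comp_sub_right a
  simpa using this

lemma intervalIntegrable_sub_right_rpow {θ : ℝ} (hθ : -1 < θ) (b c d : ℝ) :
    IntervalIntegrable (fun x => (b - x) ^ θ) volume c d := by
  have := (intervalIntegral.intervalIntegrable_rpow' (a := b - c) (b := b - d) hθ).comp_sub_left b
  simpa using this

/-- The singular endpoint contributes h^θ/θ. The other power contributes no more, by subadditivity
of y ↦ y^θ. -/
lemma integral_boundary_le {a b θ h : ℝ} (hθ₀ : 0 < θ) (hθ₁ : θ < 1) (hh : 0 ≤ h)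
    (hb : h ≤ b - a) :
    (∫ x in a..(a + h), ((x - a) ^ (θ - 1) + (b - x) ^ (θ - 1)) ≤ 2 * h ^ θ / θ) ∧
    ∫ x in (b - h)..b, ((x - a) ^ (θ - 1) + (b - x) ^ (θ - 1)) ≤ 2 * h ^ θ / θ := by
  have hsub := Real.rpow_add_le_add_rpow hh (sub_nonneg.2 hb) hθ₀.le hθ₁.le
  rw [add_sub_cancel] at hsub
  have e : ∀ c d, ∫ x in c..d, ((x - a) ^ (θ - 1) + (b - x) ^ (θ - 1)) =
      (((d - a) ^ θ - (c - a) ^ θ) + ((b - c) ^ θ - (b - d) ^ θ)) / θ := by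
    intro c d
    rw [intervalIntegral.integral_add (intervalIntegrable_sub_left_rpow (by linarith) _ _ _)
      (intervalIntegrable_sub_right_rpow (by linarith) _ _ _),
      intervalIntegral.integral_comp_sub_right (fun x => x ^ (θ - 1)),
      intervalIntegral.integral_comp_sub_left (fun x => x ^ (θ - 1)),
      integral_rpow (Or.inl (by linarith)), integral_rpow (Or.inl (by linarith)), sub_add_cancel]
    ring
  rw [e, e]
  constructor
  · rw [add_sub_cancel_left, sub_self, Real.zero_rpow hθ₀.ne', ← sub_sub]
    gcongr
    linarith
  · rw [sub_self, sub_sub_cancel, Real.zero_rpow hθ₀.ne', sub_right_comm b h a]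
    gcongr
    linarith

lemma integral_interior_le {a b θ h : ℝ} (hθ₁ : θ < 1) (hh : 0 < h) (hb : h < b - a) :
    ∫ x in (a + h)..(b - h), ((x - a) ^ (θ - 2) + (b - x) ^ (θ - 2)) ≤
      2 * h ^ (θ - 1) / (1 - θ) := by
  have h0 : (0 : ℝ) ∉ uIcc h (b - h - a) := by
    intro hm
    rcases le_total h (b - h - a) with hle | hle
    · rw [uIcc_of_le hle] at hm; linarith [hm.1]
    · rw [uIcc_of_ge hle] at hm; linarith [hm.1]
  have h0' : (0 : ℝ) ∉ uIcc (b - h - a) h := by rwa [uIcc_comm]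
  have i0 := intervalIntegral.intervalIntegrable_rpow (μ := volume) (r := θ - 2) (Or.inr h0)
  have i1 := i0.comp_sub_right a
  have i2 := i0.comp_sub_left b
  rw [sub_add_cancel, add_comm h a] at i1
  rw [show b - (b - h - a) = a + h by ring] at i2
  rw [intervalIntegral.integral_add i1 i2.symm,
      intervalIntegral.integral_comp_sub_right (fun x => x ^ (θ - 2)),
      intervalIntegral.integral_comp_sub_left (fun x => x ^ (θ - 2)), add_sub_cancel_left,
      sub_sub_cancel, ← sub_sub, sub_right_comm b a h,
      integral_rpow (Or.inr ⟨by linarith, h0⟩), show θ - 2 + 1 = θ - 1 by ring]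
  have hpos : 0 < (b - h - a) ^ (θ - 1) := Real.rpow_pos_of_pos (by linarith) _
  rw [← add_div, ← neg_div_neg_eq, neg_sub]
  gcongr
  linarith

/-- After one integration by parts the interval is cut at distance h ~ 1/|ξ| from the ends. Near the
ends W₁ is integrated in absolute value and gives h^θ; in the interior a second integration by parts
gives |ξ|⁻¹ h^(θ-1), again of order h^θ. The bound is linear in C, with K independent of W. -/
lemma exists_fourier_decay {a b θ : ℝ} (hab : a < b) (hθ₀ : 0 < θ) (hθ₁ : θ < 1) :
    ∃ K : ℝ, ∀ (C : ℝ) (W W₁ W₂ : ℝ → ℝ) (ξ : ℝ), ContinuousOn W (Icc a b) → W a = 0 → W b = 0 →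
      (∀ x ∈ Ioo a b, HasDerivAt W (W₁ x) x) → (∀ x ∈ Ioo a b, HasDerivAt W₁ (W₂ x) x) →
      ContinuousOn W₂ (Ioo a b) →
      (∀ x ∈ Ioo a b, |W₁ x| ≤ C * ((x - a) ^ (θ - 1) + (b - x) ^ (θ - 1))) →
      (∀ x ∈ Ioo a b, |W₂ x| ≤ C * ((x - a) ^ (θ - 2) + (b - x) ^ (θ - 2))) → 1 ≤ |ξ| →
      ‖∫ x in a..b, (W x : ℂ) * fourierExp ξ x‖ ≤ C * K * (1 + |ξ|) ^ (-(1 + θ)) := by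
  set B := b - a with hBdef
  have hB : 0 < B := sub_pos.2 hab
  refine ⟨8 / B * (4 / θ + 8 / B * (4 + 2 / (1 - θ))) * (B / 4) ^ (1 + θ), ?_⟩
  intro C W W₁ W₂ ξ hW ha hb h1 h2 hc2 b1 b2 hξ
  have hξ0 : ξ ≠ 0 := by rintro rfl; simp at hξ; linarith
  set T := 1 + |ξ|
  have hT : 2 ≤ T := by simp only [T]; linarith
  -- With T ≥ 2 this yields both 8h ≤ B, so that the three pieces fit, and |ξ|⁻¹ ≤ 8h/B.
  set h := B / (4 * T) with hhdef
  have hh : 0 < h := by positivity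
  have hhB : 8 * h ≤ B := by
    rw [hhdef, ← mul_div_assoc, div_le_iff₀ (by positivity)]; nlinarith
  have hinv : |ξ|⁻¹ ≤ 8 / B * h := by
    rw [hhdef, inv_le_iff_one_le_mul₀ (by linarith)]
    field_simp
    simp only [T]; linarith
  have hC : 0 ≤ C := by
    have hm : (a + b) / 2 ∈ Ioo a b := ⟨by linarith, by linarith⟩
    have := (abs_nonneg _).trans (b1 _ hm)
    refine nonneg_of_mul_nonneg_left this (add_pos ?_ ?_) <;>
      exact Real.rpow_pos_of_pos (by linarith) _
  have hE : ∀ c d, IntervalIntegrable (fun x => C * ((x - a) ^ (θ - 1) + (b - x) ^ (θ - 1)))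
      volume c d := fun c d =>
    ((intervalIntegrable_sub_left_rpow (by linarith) a c d).add
      (intervalIntegrable_sub_right_rpow (by linarith) b c d)).const_mul C
  have hc1 : ContinuousOn W₁ (Ioo a b) := fun x hx => (h2 x hx).continuousAt.continuousWithinAt
  have hi1 : IntervalIntegrable W₁ volume a b := by
    have hE' := hE a b
    rw [intervalIntegrable_iff_integrableOn_Ioo_of_le hab.le] at hE' ⊢
    refine hE'.mono' (hc1.aestronglyMeasurable measurableSet_Ioo) ?_
    filter_upwards [ae_restrict_mem measurableSet_Ioo] with x hx using b1 x hx
  have step1 := norm_integral_mul_fourierExp_le hab.le hξ0 hW h1 hi1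
  rw [ha, hb, abs_zero, add_zero, zero_add] at step1
  have hi1E : ∀ c ∈ Icc a b, ∀ d ∈ Icc a b,
      IntervalIntegrable (fun x => (W₁ x : ℂ) * fourierExp ξ x) volume c d := by
    intro c hc d hd
    have : IntervalIntegrable (fun x => (W₁ x : ℂ)) volume a b := ⟨hi1.1.ofReal, hi1.2.ofReal⟩
    refine (this.mono_set ?_).mul_continuousOn (continuous_fourierExp ξ).continuousOn
    rw [uIcc_of_le hab.le]
    exact uIcc_subset_Icc hc hd
  have hma : a ∈ Icc a b := left_mem_Icc.2 hab.le
  have hmb : b ∈ Icc a b := right_mem_Icc.2 hab.le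
  have hmc : a + h ∈ Ioo a b := ⟨by linarith, by linarith⟩
  have hmd : b - h ∈ Ioo a b := ⟨by linarith, by linarith⟩
  have hcd : a + h ≤ b - h := by linarith
  have hmc' := Ioo_subset_Icc_self hmc
  have hmd' := Ioo_subset_Icc_self hmd
  have hIcc : Icc (a + h) (b - h) ⊆ Ioo a b := fun x hx => ⟨by linarith [hx.1], by linarith [hx.2]⟩
  rw [← intervalIntegral.integral_add_adjacent_intervals (hi1E a hma _ hmd') (hi1E _ hmd' b hmb),
    ← intervalIntegral.integral_add_adjacent_intervals (hi1E a hma _ hmc') (hi1E _ hmc' _ hmd')]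
    at step1
  obtain ⟨hl, hr⟩ := integral_boundary_le (a := a) (b := b) hθ₀ hθ₁ hh.le (by linarith)
  have s1 : ‖∫ x in a..(a + h), (W₁ x : ℂ) * fourierExp ξ x‖ ≤ C * (2 * h ^ θ / θ) := by
    refine (norm_integral_mul_fourierExp_le_of_bound hmc.1.le ξ
      (fun x hx => b1 x ⟨hx.1, hx.2.trans hmc.2⟩) (hE _ _)).trans ?_
    rw [intervalIntegral.integral_const_mul]
    exact mul_le_mul_of_nonneg_left hl hC
  have s3 : ‖∫ x in (b - h)..b, (W₁ x : ℂ) * fourierExp ξ x‖ ≤ C * (2 * h ^ θ / θ) := by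
    refine (norm_integral_mul_fourierExp_le_of_bound hmd.2.le ξ
      (fun x hx => b1 x ⟨hmd.1.trans hx.1, hx.2⟩) (hE _ _)).trans ?_
    rw [intervalIntegral.integral_const_mul]
    exact mul_le_mul_of_nonneg_left hr hC
  have hcont2 : ContinuousOn (fun x => (x - a) ^ (θ - 2) + (b - x) ^ (θ - 2))
      (Icc (a + h) (b - h)) :=
    ContinuousOn.add
      (ContinuousOn.rpow_const (by fun_prop) fun x hx => Or.inl (sub_pos.2 (hIcc hx).1).ne')
      (ContinuousOn.rpow_const (by fun_prop) fun x hx => Or.inl (sub_pos.2 (hIcc hx).2).ne')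
  have s2 : ‖∫ x in (a + h)..(b - h), (W₁ x : ℂ) * fourierExp ξ x‖ ≤
      8 / B * h * (C * (4 * h ^ (θ - 1)) + C * (2 * h ^ (θ - 1) / (1 - θ))) := by
    refine (norm_integral_mul_fourierExp_le hcd hξ0 (hc1.mono hIcc)
      (fun x hx => h2 x (hIcc (Ioo_subset_Icc_self hx)))
      (ContinuousOn.intervalIntegrable (by rw [uIcc_of_le hcd]; exact hc2.mono hIcc))).trans ?_
    have hBh : (B - h) ^ (θ - 1) ≤ h ^ (θ - 1) :=
      Real.rpow_le_rpow_of_nonpos hh (by linarith) (by linarith)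
    have m1 := b1 _ hmc
    have m2 := b1 _ hmd
    rw [add_sub_cancel_left, ← sub_sub, ← hBdef] at m1
    rw [sub_sub_cancel, sub_right_comm, ← hBdef] at m2
    have m3 : C * (B - h) ^ (θ - 1) ≤ C * h ^ (θ - 1) := mul_le_mul_of_nonneg_left hBh hC
    refine mul_le_mul hinv (add_le_add (by linarith) ?_) (by positivity) (by positivity)
    refine (norm_integral_mul_fourierExp_le_of_bound hcd ξ
      (fun x hx => b2 x (hIcc (Ioo_subset_Icc_self hx)))
      ((ContinuousOn.intervalIntegrable (by rwa [uIcc_of_le hcd])).const_mul C)).trans ?_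
    rw [intervalIntegral.integral_const_mul]
    exact mul_le_mul_of_nonneg_left (integral_interior_le hθ₁ hh (by linarith)) hC
  have hhθ : h ^ θ = h ^ (θ - 1) * h := by rw [← Real.rpow_add_one hh.ne', sub_add_cancel]
  have hfin : h ^ (1 + θ) = (B / 4) ^ (1 + θ) * T ^ (-(1 + θ)) := by
    rw [hhdef, ← div_div, Real.div_rpow (by positivity) (by positivity), Real.rpow_neg (by positivity),
      div_eq_mul_inv]
  refine step1.trans ((mul_le_mul hinv ((norm_add_le _ _).trans (add_le_add
    ((norm_add_le _ _).trans (add_le_add s1 s2)) s3)) (norm_nonneg _) (by positivity)).trans_eq ?_)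
  rw [mul_assoc C, mul_assoc _ ((B / 4) ^ (1 + θ)), ← hfin, Real.rpow_add hh, Real.rpow_one, hhθ]
  ring

/-! ### Truncation by level and membership in the Sobolev space. -/

/-- A smooth profile equal to `y` for `y ≤ 1` and to `0` for `y ≥ 2`. -/
def cutProfile (y : ℝ) : ℝ := y * (1 - Real.smoothTransition (y - 1))

lemma contDiff_cutProfile : ContDiff ℝ ∞ cutProfile := by
  unfold cutProfile
  exact contDiff_id.mul (contDiff_const.sub
    (Real.smoothTransition.contDiff.comp (contDiff_id.sub contDiff_const)))

lemma contDiff_deriv_cutProfile : ContDiff ℝ ∞ (deriv cutProfile) :=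
  (contDiff_infty_iff_deriv.1 contDiff_cutProfile).2

lemma continuous_deriv_deriv_cutProfile : Continuous (deriv (deriv cutProfile)) :=
  contDiff_deriv_cutProfile.continuous_deriv (by norm_num)

lemma cutProfile_of_two_le {y : ℝ} (hy : 2 ≤ y) : cutProfile y = 0 := by
  rw [cutProfile, Real.smoothTransition.one_of_one_le (by linarith), sub_self, mul_zero]

lemma abs_cutProfile_le {y : ℝ} (hy : 0 ≤ y) : |cutProfile y| ≤ 2 := by
  rcases le_total 2 y with h | h
  · rw [cutProfile_of_two_le h, abs_zero]; norm_num
  · have h0 := Real.smoothTransition.nonneg (y - 1)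
    have h1 := Real.smoothTransition.le_one (y - 1)
    rw [cutProfile, abs_of_nonneg (mul_nonneg hy (by linarith))]
    nlinarith

/-- For H = `cutProfile`, these are the quantities entering the first two derivatives of δH(v/δ).
Bounding y·H''(y) rather than H''(y) alone is what makes the estimates uniform in δ. -/
lemma exists_cutProfile_bound : ∃ M, ∀ y, 0 ≤ y →
    |deriv cutProfile y| ≤ M ∧ |y * deriv (deriv cutProfile) y| ≤ M := by
  obtain ⟨M₁, h₁⟩ := (isCompact_Icc (a := (0 : ℝ)) (b := 2)).exists_bound_of_continuousOn
    contDiff_deriv_cutProfile.continuous.continuousOn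
  obtain ⟨M₂, h₂⟩ := (isCompact_Icc (a := (0 : ℝ)) (b := 2)).exists_bound_of_continuousOn
    (continuous_id.mul continuous_deriv_deriv_cutProfile).continuousOn
  refine ⟨max M₁ M₂, fun y hy => ?_⟩
  rcases le_or_gt y 2 with h | h
  · exact ⟨(h₁ y ⟨hy, h⟩).trans (le_max_left _ _), (h₂ y ⟨hy, h⟩).trans (le_max_right _ _)⟩
  · have hz : ∀ x, 2 < x → deriv cutProfile x = 0 := by
      intro x hx
      have : cutProfile =ᶠ[nhds x] fun _ => 0 := by
        filter_upwards [Ioi_mem_nhds hx] with t ht using cutProfile_of_two_le (le_of_lt ht)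
      rw [this.deriv_eq, deriv_const]
    have hz2 : deriv (deriv cutProfile) y = 0 := by
      have : deriv cutProfile =ᶠ[nhds y] fun _ => 0 := by
        filter_upwards [Ioi_mem_nhds h] with t ht using hz t ht
      rw [this.deriv_eq, deriv_const]
    have hM : 0 ≤ max M₁ M₂ :=
      ((norm_nonneg _).trans (h₁ 0 ⟨le_rfl, two_pos.le⟩)).trans (le_max_left _ _)
    rw [hz y h, hz2]
    simpa using hM

/-- The Jacobi weight `(x - a)^P (b - x)^Q`, extended by zero. -/
def jacobiExt (a b P Q x : ℝ) : ℝ := max (x - a) 0 ^ P * max (b - x) 0 ^ Q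

section

variable {a b P Q : ℝ}

lemma continuous_jacobiExt (hP : 0 < P) (hQ : 0 < Q) : Continuous (jacobiExt a b P Q) := by
  unfold jacobiExt
  exact (Continuous.rpow_const (by fun_prop) fun _ => Or.inr hP.le).mul
    (Continuous.rpow_const (by fun_prop) fun _ => Or.inr hQ.le)

lemma jacobiExt_nonneg (x : ℝ) : 0 ≤ jacobiExt a b P Q x := by
  unfold jacobiExt; positivity

lemma jacobiExt_of_mem {x : ℝ} (hx : x ∈ Ioo a b) : jacobiExt a b P Q x = jacobiWeight a b P Q x := by
  rw [jacobiExt, max_eq_left (sub_nonneg.2 hx.1.le), max_eq_left (sub_nonneg.2 hx.2.le),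
    jacobiWeight]

lemma jacobiExt_of_notMem (hP : 0 < P) (hQ : 0 < Q) {x : ℝ} (hx : x ∉ Ioo a b) :
    jacobiExt a b P Q x = 0 := by
  rw [mem_Ioo, not_and_or, not_lt, not_lt] at hx
  rcases hx with h | h
  · rw [jacobiExt, max_eq_right (by linarith), Real.zero_rpow hP.ne', zero_mul]
  · rw [jacobiExt, max_eq_right (by linarith : b - x ≤ 0), Real.zero_rpow hQ.ne', mul_zero]

lemma hasDerivAt_jacobiWeight {x : ℝ} (hx : x ∈ Ioo a b) :
    HasDerivAt (jacobiWeight a b P Q)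
      (jacobiWeight a b P Q x * (P / (x - a) - Q / (b - x))) x := by
  have h1 : 0 < x - a := sub_pos.2 hx.1
  have h2 : 0 < b - x := sub_pos.2 hx.2
  have d1 := ((hasDerivAt_id x).sub_const a).rpow_const (p := P) (Or.inl h1.ne')
  have d2 := ((hasDerivAt_id x).const_sub b).rpow_const (p := Q) (Or.inl h2.ne')
  refine (d1.mul d2).congr_deriv ?_
  simp only [id, jacobiWeight, Real.rpow_sub_one h1.ne', Real.rpow_sub_one h2.ne']
  ring

lemma contDiffOn_jacobiWeight (n : WithTop ℕ∞) : ContDiffOn ℝ n (jacobiWeight a b P Q) (Ioo a b) :=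
  ContDiffOn.mul (ContDiffOn.rpow_const_of_ne (by fun_prop) fun x hx => (sub_pos.2 hx.1).ne')
    (ContDiffOn.rpow_const_of_ne (by fun_prop) fun x hx => (sub_pos.2 hx.2).ne')

lemma rpow_mul_rpow_le {B θ y z : ℝ} (hy : 0 < y) (hyB : y ≤ B) (hz : 0 < z) (hzB : z ≤ B)
    (hθ : θ ≤ P) (hQ : 0 ≤ Q) : y ^ P * z ^ Q ≤ B ^ (P - θ) * B ^ Q * y ^ θ := by
  have e : y ^ P = y ^ (P - θ) * y ^ θ := by rw [← Real.rpow_add hy, sub_add_cancel]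
  have h1 : y ^ (P - θ) ≤ B ^ (P - θ) := Real.rpow_le_rpow hy.le hyB (by linarith)
  have h2 : z ^ Q ≤ B ^ Q := Real.rpow_le_rpow hz.le hzB hQ
  have hB : 0 < B := hy.trans_le hyB
  rw [e, mul_right_comm]
  gcongr

/-- If g is the logarithmic derivative of the weight v, then v' = vg and v'' = v(g² + g'). The
factor 2 leaves room for the extra g² produced by truncation. -/
lemma exists_jacobiWeight_bound (hab : a < b) (hP₁ : P ≤ 1) (hQ₁ : Q ≤ 1) {θ : ℝ}
    (hθ₀ : 0 < θ) (hθP : θ ≤ P) (hθQ : θ ≤ Q) :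
    ∃ D, 0 ≤ D ∧ ∀ x ∈ Ioo a b,
      jacobiWeight a b P Q x * |P / (x - a) - Q / (b - x)| ≤
        D * ((x - a) ^ (θ - 1) + (b - x) ^ (θ - 1)) ∧
      jacobiWeight a b P Q x * (2 * (P / (x - a) - Q / (b - x)) ^ 2 +
        |-(P / (x - a) ^ 2) - Q / (b - x) ^ 2|) ≤
        D * ((x - a) ^ (θ - 2) + (b - x) ^ (θ - 2)) := by
  have hB : 0 < b - a := sub_pos.2 hab
  set B := b - a
  set D := B ^ (P - θ) * B ^ Q + B ^ (Q - θ) * B ^ P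
  have hD : 0 ≤ D := by positivity
  refine ⟨5 * D, by positivity, fun x hx => ?_⟩
  have hy : 0 < x - a := sub_pos.2 hx.1
  have hz : 0 < b - x := sub_pos.2 hx.2
  have hyB : x - a ≤ B := by simp only [B]; linarith [hx.2]
  have hzB : b - x ≤ B := by simp only [B]; linarith [hx.1]
  have hv := jacobiWeight_pos P Q hx
  have v1 : jacobiWeight a b P Q x ≤ D * (x - a) ^ θ := by
    refine (rpow_mul_rpow_le hy hyB hz hzB hθP (hθ₀.le.trans hθQ)).trans ?_
    gcongr
    exact le_add_of_nonneg_right (by positivity)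
  have v2 : jacobiWeight a b P Q x ≤ D * (b - x) ^ θ := by
    rw [jacobiWeight, mul_comm]
    refine (rpow_mul_rpow_le hz hzB hy hyB hθQ (hθ₀.le.trans hθP)).trans ?_
    gcongr
    exact le_add_of_nonneg_left (by positivity)
  set v := jacobiWeight a b P Q x
  set y := x - a
  set z := b - x
  have ey1 : y ^ (θ - 1) = y ^ θ / y := Real.rpow_sub_one hy.ne' θ
  have ez1 : z ^ (θ - 1) = z ^ θ / z := Real.rpow_sub_one hz.ne' θ
  have ey2 : y ^ (θ - 2) = y ^ θ / y ^ 2 := Real.rpow_sub_natCast hy.ne' θ 2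
  have ez2 : z ^ (θ - 2) = z ^ θ / z ^ 2 := Real.rpow_sub_natCast hz.ne' θ 2
  have hP₀ : 0 < P := hθ₀.trans_le hθP
  have hQ₀ : 0 < Q := hθ₀.trans_le hθQ
  have a1 : P / y ≤ 1 / y := by gcongr
  have a2 : Q / z ≤ 1 / z := by gcongr
  have a1' : 0 < P / y := by positivity
  have a2' : 0 < Q / z := by positivity
  have hsum1 : v * (1 / y + 1 / z) ≤ D * (y ^ (θ - 1) + z ^ (θ - 1)) := by
    rw [ey1, ez1, mul_add, mul_add, mul_one_div, mul_one_div, mul_div_assoc', mul_div_assoc']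
    gcongr
  have hsum2 : v * (1 / y ^ 2 + 1 / z ^ 2) ≤ D * (y ^ (θ - 2) + z ^ (θ - 2)) := by
    rw [ey2, ez2, mul_add, mul_add, mul_one_div, mul_one_div, mul_div_assoc', mul_div_assoc']
    gcongr
  constructor
  · have : |P / y - Q / z| ≤ 1 / y + 1 / z := by
      rw [abs_le]; constructor <;> linarith
    refine (mul_le_mul_of_nonneg_left this hv.le).trans (hsum1.trans ?_)
    gcongr
    linarith
  · have g2 : (P / y - Q / z) ^ 2 ≤ 2 * (1 / y ^ 2 + 1 / z ^ 2) := by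
      have e1 : (P / y) ^ 2 ≤ 1 / y ^ 2 := by
        rw [← one_div_pow]; gcongr
      have e2 : (Q / z) ^ 2 ≤ 1 / z ^ 2 := by
        rw [← one_div_pow]; gcongr
      nlinarith [sq_nonneg (P / y + Q / z)]
    have g3 : |-(P / y ^ 2) - Q / z ^ 2| ≤ 1 / y ^ 2 + 1 / z ^ 2 := by
      have e1 : P / y ^ 2 ≤ 1 / y ^ 2 := by gcongr
      have e2 : Q / z ^ 2 ≤ 1 / z ^ 2 := by gcongr
      have e3 : 0 < P / y ^ 2 := by positivity
      have e4 : 0 < Q / z ^ 2 := by positivity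
      rw [abs_le]; constructor <;> linarith
    refine (mul_le_mul_of_nonneg_left (by linarith :
      2 * (P / y - Q / z) ^ 2 + |-(P / y ^ 2) - Q / z ^ 2| ≤ 5 * (1 / y ^ 2 + 1 / z ^ 2))
      hv.le).trans ?_
    rw [mul_left_comm, mul_assoc]
    gcongr

/-- The part of the extended Jacobi weight below the level `δ`. -/
def jacobiTail (a b P Q δ x : ℝ) : ℝ := δ * cutProfile (jacobiExt a b P Q x / δ)

lemma continuous_jacobiTail (hP : 0 < P) (hQ : 0 < Q) (δ : ℝ) :
    Continuous (jacobiTail a b P Q δ) :=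
  continuous_const.mul (contDiff_cutProfile.continuous.comp
    ((continuous_jacobiExt hP hQ).div_const δ))

lemma jacobiTail_of_notMem (hP : 0 < P) (hQ : 0 < Q) (δ : ℝ) {x : ℝ} (hx : x ∉ Ioo a b) :
    jacobiTail a b P Q δ x = 0 := by
  simp [jacobiTail, jacobiExt_of_notMem hP hQ hx, cutProfile]

lemma abs_jacobiTail_le {δ : ℝ} (hδ : 0 < δ) (x : ℝ) : |jacobiTail a b P Q δ x| ≤ 2 * δ := by
  rw [jacobiTail, abs_mul, abs_of_pos hδ, mul_comm]
  exact mul_le_mul_of_nonneg_right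
    (abs_cutProfile_le (div_nonneg (jacobiExt_nonneg x) hδ.le)) hδ.le

lemma jacobiTail_eq {δ : ℝ} (hδ : 0 < δ) (x : ℝ) :
    jacobiTail a b P Q δ x = jacobiExt a b P Q x -
      jacobiExt a b P Q x * Real.smoothTransition (jacobiExt a b P Q x / δ - 1) := by
  rw [jacobiTail, cutProfile]
  field_simp

/-- The first entry of the minimum gives pointwise convergence as δ → 0, the second a majorant
independent of δ. -/
lemma exists_fourier_jacobiTail_bound (hab : a < b) (hP₁ : P < 1) (hQ₁ : Q < 1) {θ : ℝ}
    (hθ₀ : 0 < θ) (hθP : θ ≤ P) (hθQ : θ ≤ Q) :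
    ∃ K, ∀ δ ξ : ℝ, 0 < δ → δ ≤ 1 →
      ‖∫ x in a..b, (jacobiTail a b P Q δ x : ℂ) * fourierExp ξ x‖ ≤
        min (2 * δ * (b - a)) (K * (1 + |ξ|) ^ (-(1 + θ))) := by
  obtain ⟨D, hD, hDb⟩ := exists_jacobiWeight_bound hab hP₁.le hQ₁.le hθ₀ hθP hθQ
  obtain ⟨M, hM⟩ := exists_cutProfile_bound
  have hM0 : 0 ≤ M := (abs_nonneg _).trans (hM 0 le_rfl).1
  obtain ⟨K, hK⟩ := exists_fourier_decay hab hθ₀ (hθP.trans_lt hP₁)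
  have hP₀ : 0 < P := hθ₀.trans_le hθP
  have hQ₀ : 0 < Q := hθ₀.trans_le hθQ
  have hB : 0 < b - a := sub_pos.2 hab
  refine ⟨|M * D * K| + 2 * (b - a) * 2 ^ (1 + θ), fun δ ξ hδ hδ₁ => ?_⟩
  have hbound : ‖∫ x in a..b, (jacobiTail a b P Q δ x : ℂ) * fourierExp ξ x‖ ≤
      2 * δ * (b - a) := by
    refine (norm_integral_mul_fourierExp_le_of_bound hab.le (G := fun _ => 2 * δ) ξ
      (fun x _ => abs_jacobiTail_le hδ x) (by simp)).trans_eq ?_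
    rw [intervalIntegral.integral_const, smul_eq_mul, mul_comm]
  refine le_min hbound ?_
  -- For |ξ| < 1 the trivial bound suffices, since there (1+|ξ|)^(1+θ) ≤ 2^(1+θ); this is the origin
  -- of the second summand of the constant.
  rcases lt_or_ge |ξ| 1 with hξ | hξ
  · refine hbound.trans ?_
    have h1 : (1 : ℝ) ≤ 2 ^ (1 + θ) * (1 + |ξ|) ^ (-(1 + θ)) := by
      rw [Real.rpow_neg (by positivity), ← div_eq_mul_inv, one_le_div (by positivity)]
      exact Real.rpow_le_rpow (by positivity) (by linarith) (by linarith)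
    rw [add_mul]
    refine le_add_of_nonneg_of_le (by positivity) ?_
    rw [mul_assoc (2 * (b - a))]
    nlinarith
  · have hpos : 0 ≤ (1 + |ξ|) ^ (-(1 + θ)) := by positivity
    have hvd := fun x (hx : x ∈ Ioo a b) =>
      div_pos (jacobiWeight_pos P Q hx) hδ
    have hWe : ∀ x ∈ Ioo a b, jacobiTail a b P Q δ =ᶠ[nhds x]
        fun t => δ * cutProfile (jacobiWeight a b P Q t / δ) := by
      intro x hx
      filter_upwards [isOpen_Ioo.mem_nhds hx] with t ht
      rw [jacobiTail, jacobiExt_of_mem ht]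
    refine (hK (M * D) (jacobiTail a b P Q δ)
      (fun x => deriv cutProfile (jacobiWeight a b P Q x / δ) *
        (jacobiWeight a b P Q x * (P / (x - a) - Q / (b - x))))
      (fun x => deriv (deriv cutProfile) (jacobiWeight a b P Q x / δ) / δ *
          (jacobiWeight a b P Q x * (P / (x - a) - Q / (b - x))) ^ 2 +
        deriv cutProfile (jacobiWeight a b P Q x / δ) *
          (jacobiWeight a b P Q x * ((P / (x - a) - Q / (b - x)) ^ 2 +
            (-(P / (x - a) ^ 2) - Q / (b - x) ^ 2)))) ξ
      (continuous_jacobiTail hP₀ hQ₀ δ).continuousOn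
      (jacobiTail_of_notMem hP₀ hQ₀ δ (by simp)) (jacobiTail_of_notMem hP₀ hQ₀ δ (by simp))
      ?_ ?_ ?_ ?_ ?_ hξ).trans ?_
    · intro x hx
      have d := ((((contDiff_cutProfile.differentiable (by simp)) _).hasDerivAt.comp x
        ((hasDerivAt_jacobiWeight (P := P) (Q := Q) hx).div_const δ)).const_mul δ)
      refine (d.congr_deriv ?_).congr_of_eventuallyEq (hWe x hx)
      field_simp
    · intro x hx
      have h1 : x - a ≠ 0 := (sub_pos.2 hx.1).ne'
      have h2 : b - x ≠ 0 := (sub_pos.2 hx.2).ne'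
      have dv := hasDerivAt_jacobiWeight (P := P) (Q := Q) hx
      have dH := ((contDiff_deriv_cutProfile.differentiable (by simp)) _).hasDerivAt.comp x
        (dv.div_const δ)
      have dg : HasDerivAt (fun x => P / (x - a) - Q / (b - x))
          (-(P / (x - a) ^ 2) - Q / (b - x) ^ 2) x := by
        have e1 := ((hasDerivAt_const x P).div ((hasDerivAt_id x).sub_const a) h1).sub
          ((hasDerivAt_const x Q).div ((hasDerivAt_id x).const_sub b) h2)
        refine e1.congr_deriv ?_
        simp only [id]
        ring
      refine (dH.mul (dv.mul dg)).congr_deriv ?_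
      simp only [Function.comp_apply, Pi.mul_apply]
      ring
    · have hv : ContinuousOn (jacobiWeight a b P Q) (Ioo a b) :=
        (contDiffOn_jacobiWeight 0).continuousOn
      have hg : ContinuousOn (fun x => P / (x - a) - Q / (b - x)) (Ioo a b) :=
        (continuousOn_const.div (by fun_prop) fun x hx => (sub_pos.2 hx.1).ne').sub
          (continuousOn_const.div (by fun_prop) fun x hx => (sub_pos.2 hx.2).ne')
      have hg' : ContinuousOn (fun x => -(P / (x - a) ^ 2) - Q / (b - x) ^ 2) (Ioo a b) :=
        (continuousOn_const.div (by fun_prop) fun x hx =>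
          (pow_pos (sub_pos.2 hx.1) 2).ne').neg.sub
          (continuousOn_const.div (by fun_prop) fun x hx => (pow_pos (sub_pos.2 hx.2) 2).ne')
      have hH1 : ContinuousOn (fun x => deriv cutProfile (jacobiWeight a b P Q x / δ)) (Ioo a b) :=
        contDiff_deriv_cutProfile.continuous.comp_continuousOn (hv.div_const δ)
      have hH2 : ContinuousOn (fun x => deriv (deriv cutProfile) (jacobiWeight a b P Q x / δ))
          (Ioo a b) := continuous_deriv_deriv_cutProfile.comp_continuousOn (hv.div_const δ)
      exact ((hH2.div_const δ).mul ((hv.mul hg).pow 2)).add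
        (hH1.mul (hv.mul ((hg.pow 2).add hg')))
    · intro x hx
      have hv := jacobiWeight_pos P Q hx
      rw [abs_mul, abs_mul, abs_of_pos hv, mul_assoc M]
      exact mul_le_mul (hM _ (hvd x hx).le).1 (hDb x hx).1 (by positivity) hM0
    · intro x hx
      have hv := jacobiWeight_pos P Q hx
      obtain ⟨m1, m2⟩ := hM _ (hvd x hx).le
      rw [mul_assoc M]
      refine le_trans ?_ (mul_le_mul_of_nonneg_left (hDb x hx).2 hM0)
      set v := jacobiWeight a b P Q x
      set g := P / (x - a) - Q / (b - x)
      set g' := -(P / (x - a) ^ 2) - Q / (b - x) ^ 2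
      -- The 1/δ is absorbed into y = v/δ, so that the bound on y·H''(y) applies.
      have e : deriv (deriv cutProfile) (v / δ) / δ * (v * g) ^ 2 =
          (v / δ * deriv (deriv cutProfile) (v / δ)) * (v * g ^ 2) := by ring
      rw [e]
      refine (abs_add_le _ _).trans ?_
      rw [abs_mul, abs_mul (deriv cutProfile (v / δ)), abs_mul v, abs_mul v, abs_of_pos hv,
        abs_of_nonneg (sq_nonneg g)]
      have t1 : |g ^ 2 + g'| ≤ g ^ 2 + |g'| := by
        refine (abs_add_le _ _).trans_eq ?_
        rw [abs_of_nonneg (sq_nonneg g)]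
      calc _ ≤ M * (v * g ^ 2) + M * (v * (g ^ 2 + |g'|)) := by gcongr
        _ = _ := by ring
    · refine mul_le_mul_of_nonneg_right ?_ hpos
      have : 0 ≤ 2 * (b - a) * 2 ^ (1 + θ) := by positivity
      linarith [le_abs_self (M * D * K)]

lemma fourier_jacobiTail (hab : a < b) (hP : 0 < P) (hQ : 0 < Q) (c δ ξ : ℝ) :
    𝓕 (fun x => ((c * jacobiTail a b P Q δ x : ℝ) : ℂ)) ξ =
      c * ∫ x in a..b, (jacobiTail a b P Q δ x : ℂ) * fourierExp ξ x := by
  rw [Real.fourier_real_eq_integral_exp_smul, intervalIntegral.integral_of_le hab.le,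
    integral_Ioc_eq_integral_Ioo, ← integral_const_mul]
  rw [setIntegral_eq_integral_of_forall_compl_eq_zero fun x hx => by
    simp [jacobiTail_of_notMem hP hQ δ hx]]
  congr 1; ext x
  rw [smul_eq_mul, fourierExp]
  push_cast
  ring

/-- Around a point outside the open interval the weight is still below δ, so the truncated function
vanishes identically nearby; inside, the weight itself is smooth. -/
lemma jacobi_cutoff_smooth (hP : 0 < P) (hQ : 0 < Q) (c : ℝ) {δ : ℝ} (hδ : 0 < δ) :
    ContDiff ℝ ∞ (fun x => c * (jacobiExt a b P Q x *
      Real.smoothTransition (jacobiExt a b P Q x / δ - 1))) := by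
  rw [contDiff_iff_contDiffAt]
  intro x
  by_cases hx : x ∈ Ioo a b
  · have hv : ContDiffAt ℝ ∞ (jacobiWeight a b P Q) x :=
      (contDiffOn_jacobiWeight ∞).contDiffAt (isOpen_Ioo.mem_nhds hx)
    have h1 : ContDiffAt ℝ ∞ (fun x => c * (jacobiWeight a b P Q x *
        Real.smoothTransition (jacobiWeight a b P Q x / δ - 1))) x :=
      contDiffAt_const.mul (hv.mul (Real.smoothTransition.contDiffAt.comp x
        ((hv.div_const δ).sub contDiffAt_const)))
    refine h1.congr_of_eventuallyEq ?_
    filter_upwards [isOpen_Ioo.mem_nhds hx] with t ht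
    rw [jacobiExt_of_mem ht]
  · refine (contDiffAt_const (c := (0 : ℝ))).congr_of_eventuallyEq ?_
    have h0 := jacobiExt_of_notMem hP hQ hx
    filter_upwards [(continuous_jacobiExt hP hQ).continuousAt.eventually_lt continuousAt_const
      (by rw [h0]; exact hδ)] with t ht
    rw [Real.smoothTransition.zero_of_nonpos, mul_zero, mul_zero]
    rw [sub_nonpos, div_le_one hδ]
    exact le_of_lt ht

lemma jacobi_cutoff_tsupport (hP : 0 < P) (hQ : 0 < Q) (c : ℝ) {δ : ℝ} (hδ : 0 < δ) :
    tsupport (fun x => c * (jacobiExt a b P Q x *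
      Real.smoothTransition (jacobiExt a b P Q x / δ - 1))) ⊆ Ioo a b := by
  have hcl : IsClosed {x | δ ≤ jacobiExt a b P Q x} :=
    isClosed_le continuous_const (continuous_jacobiExt hP hQ)
  refine (closure_minimal (fun x hx => ?_) hcl).trans fun x hx => ?_
  · by_contra hlt
    refine hx ?_
    simp only
    rw [Real.smoothTransition.zero_of_nonpos, mul_zero, mul_zero]
    rw [sub_nonpos, div_le_one hδ]
    exact le_of_not_ge hlt
  · by_contra hn
    have : δ ≤ jacobiExt a b P Q x := hx
    rw [jacobiExt_of_notMem hP hQ hn] at this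
    linarith

/-- Dominated convergence on the Fourier side: the majorant decays with exponent 2 + 2θ - 2s, which
exceeds 1 by the assumption on s. -/
lemma tendsto_sobolevNormSq_jacobiTail (hab : a < b) (hP₁ : P < 1) (hQ₁ : Q < 1) {θ s : ℝ}
    (hθ₀ : 0 < θ) (hθP : θ ≤ P) (hθQ : θ ≤ Q) (hs₀ : 0 ≤ s) (hs : 2 * s < 1 + 2 * θ) (c : ℝ) :
    Filter.Tendsto (fun n : ℕ => sobolevNormSq s (fun x => c * jacobiTail a b P Q (1 / (n + 1)) x))
      Filter.atTop (nhds 0) := by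
  obtain ⟨K, hK⟩ := exists_fourier_jacobiTail_bound hab hP₁ hQ₁ hθ₀ hθP hθQ
  have hP₀ : 0 < P := hθ₀.trans_le hθP
  have hQ₀ : 0 < Q := hθ₀.trans_le hθQ
  have hB : 0 < b - a := sub_pos.2 hab
  have hδlim := tendsto_one_div_add_atTop_nhds_zero_nat (𝕜 := ℝ)
  have hδ : ∀ n : ℕ, 0 < 1 / ((n : ℝ) + 1) := fun n => by positivity
  have hδ₁ : ∀ n : ℕ, 1 / ((n : ℝ) + 1) ≤ 1 := fun n => by
    rw [div_le_one (by positivity)]; linarith [n.cast_nonneg (α := ℝ)]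
  set m : ℕ → ℝ → ℝ := fun n ξ =>
    min (2 * (1 / ((n : ℝ) + 1)) * (b - a)) (K * (1 + |ξ|) ^ (-(1 + θ)))
  have hm : ∀ n ξ, 0 ≤ m n ξ := fun n ξ => (norm_nonneg _).trans (hK _ ξ (hδ n) (hδ₁ n))
  set f : ℕ → ℝ → ℝ≥0∞ := fun n ξ =>
    ENNReal.ofReal (|2 * Real.pi * ξ| ^ (2 * s) * (|c| * m n ξ) ^ 2)
  have hK0 : 0 ≤ K := by
    have := (hm 0 0).trans (min_le_right _ _)
    simpa using this
  have hflim : Filter.Tendsto (fun n => ∫⁻ ξ, f n ξ) Filter.atTop (nhds 0) := by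
    rw [← lintegral_zero (μ := (volume : Measure ℝ))]
    refine tendsto_lintegral_of_dominated_convergence
      (fun ξ => ENNReal.ofReal ((2 * Real.pi) ^ (2 * s) * (|c| * K) ^ 2 *
        (1 + ‖ξ‖) ^ (-(2 + 2 * θ - 2 * s))))
      (fun n => ?_) (fun n => ?_) ?_ ?_
    · refine ENNReal.measurable_ofReal.comp (Measurable.mul (by fun_prop) ?_)
      refine (Measurable.const_mul (Measurable.min measurable_const ?_) _).pow_const 2
      fun_prop
    · refine Filter.Eventually.of_forall fun ξ => ENNReal.ofReal_le_ofReal ?_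
      have h1 : m n ξ ≤ K * (1 + |ξ|) ^ (-(1 + θ)) := min_le_right _ _
      have hpos : 0 < 1 + |ξ| := by positivity
      have h2 : |2 * Real.pi * ξ| ^ (2 * s) ≤ (2 * Real.pi) ^ (2 * s) * (1 + |ξ|) ^ (2 * s) := by
        rw [← Real.mul_rpow (by positivity) hpos.le, abs_mul, abs_of_pos Real.two_pi_pos]
        refine Real.rpow_le_rpow (by positivity) ?_ (by positivity)
        gcongr
        linarith
      have h3 : (|c| * m n ξ) ^ 2 ≤ (|c| * K) ^ 2 * ((1 + |ξ|) ^ (-(1 + θ))) ^ 2 := by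
        rw [← mul_pow, mul_assoc]
        have := hm n ξ
        gcongr
      refine (mul_le_mul h2 h3 (by positivity) (by positivity)).trans_eq ?_
      rw [Real.norm_eq_abs, show -(2 + 2 * θ - 2 * s) = 2 * s + -(1 + θ) + -(1 + θ) by ring,
        Real.rpow_add hpos, Real.rpow_add hpos]
      ring
    · refine ((Integrable.const_mul (integrable_one_add_norm ?_) _).lintegral_lt_top).ne
      rw [Module.finrank_self]
      push_cast
      linarith
    · refine Filter.Eventually.of_forall fun ξ => ?_
      have hm0 : Filter.Tendsto (fun n => m n ξ) Filter.atTop (nhds 0) := by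
        have : Filter.Tendsto (fun n : ℕ => 2 * (1 / ((n : ℝ) + 1)) * (b - a)) Filter.atTop
            (nhds (2 * 0 * (b - a))) := (hδlim.const_mul 2).mul_const _
        rw [mul_zero, zero_mul] at this
        exact squeeze_zero (fun n => hm n ξ) (fun n => min_le_left _ _) this
      have := ENNReal.tendsto_ofReal
        (((hm0.const_mul |c|).pow 2).const_mul (|2 * Real.pi * ξ| ^ (2 * s)))
      rwa [mul_zero, zero_pow two_ne_zero, mul_zero, ENNReal.ofReal_zero] at this
  have hglim : Filter.Tendsto (fun n : ℕ =>
      ENNReal.ofReal ((|c| * (2 * (1 / ((n : ℝ) + 1)))) ^ 2) * volume (Ioo a b))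
      Filter.atTop (nhds 0) := by
    have := ENNReal.tendsto_ofReal (((hδlim.const_mul 2).const_mul |c|).pow 2)
    have := ENNReal.Tendsto.mul_const (b := volume (Ioo a b)) this (Or.inr (by simp))
    simpa using this
  have hsum := hglim.add hflim
  rw [add_zero] at hsum
  refine tendsto_of_tendsto_of_tendsto_of_le_of_le tendsto_const_nhds hsum (fun _ => zero_le)
    fun n => ?_
  refine add_le_add ?_ (lintegral_mono fun ξ => ?_)
  · rw [← setLIntegral_const, ← lintegral_indicator measurableSet_Ioo]
    refine lintegral_mono fun x => ?_
    by_cases hx : x ∈ Ioo a b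
    · rw [indicator_of_mem hx, ← ofReal_norm, ← ENNReal.ofReal_pow (norm_nonneg _), norm_mul]
      refine ENNReal.ofReal_le_ofReal ?_
      exact pow_le_pow_left₀ (by positivity) (mul_le_mul_of_nonneg_left
        (abs_jacobiTail_le (hδ n) x) (abs_nonneg c)) 2
    · simp [indicator_of_notMem hx, jacobiTail_of_notMem hP₀ hQ₀ _ hx]
  · rw [fourier_jacobiTail hab hP₀ hQ₀, ← ofReal_norm, ← ENNReal.ofReal_pow (norm_nonneg _),
      ← ENNReal.ofReal_mul (by positivity), norm_mul, Complex.norm_real]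
    refine ENNReal.ofReal_le_ofReal (mul_le_mul_of_nonneg_left ?_ (by positivity))
    exact pow_le_pow_left₀ (by positivity) (mul_le_mul_of_nonneg_left
      (hK _ ξ (hδ n) (hδ₁ n)) (abs_nonneg c)) 2

theorem memSobolevZero_jacobi (hab : a < b) (hP₁ : P < 1) (hQ₁ : Q < 1) {θ s : ℝ}
    (hθ₀ : 0 < θ) (hθP : θ ≤ P) (hθQ : θ ≤ Q) (hs₀ : 0 ≤ s) (hs : 2 * s < 1 + 2 * θ) (c : ℝ) :
    MemSobolevZero a b s (fun x => c * (x - a) ^ P * (b - x) ^ Q) := by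
  have hP₀ : 0 < P := hθ₀.trans_le hθP
  have hQ₀ : 0 < Q := hθ₀.trans_le hθQ
  have hind : (Ioo a b).indicator (fun x => c * (x - a) ^ P * (b - x) ^ Q) =
      fun x => c * jacobiExt a b P Q x := by
    ext x
    by_cases hx : x ∈ Ioo a b
    · rw [indicator_of_mem hx, jacobiExt_of_mem hx, jacobiWeight, mul_assoc]
    · rw [indicator_of_notMem hx, jacobiExt_of_notMem hP₀ hQ₀ hx, mul_zero]
  have hcont : Continuous fun x => c * jacobiExt a b P Q x :=
    continuous_const.mul (continuous_jacobiExt hP₀ hQ₀)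
  refine ⟨?_, fun ε hε => ?_⟩
  · rw [hind]
    refine hcont.memLp_of_hasCompactSupport (HasCompactSupport.intro (isCompact_Icc (a := a) (b := b))
      fun x hx => ?_)
    rw [jacobiExt_of_notMem hP₀ hQ₀ fun h => hx (Ioo_subset_Icc_self h), mul_zero]
  · obtain ⟨n, hn⟩ := ((tendsto_sobolevNormSq_jacobiTail hab hP₁ hQ₁ hθ₀ hθP hθQ hs₀ hs
      c).eventually (gt_mem_nhds hε)).exists
    have hδ : 0 < 1 / ((n : ℝ) + 1) := by positivity
    refine ⟨_, jacobi_cutoff_smooth (a := a) (b := b) hP₀ hQ₀ c hδ, ?_,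
      jacobi_cutoff_tsupport hP₀ hQ₀ c hδ, ?_⟩
    · exact isCompact_Icc.of_isClosed_subset (isClosed_tsupport _)
        ((jacobi_cutoff_tsupport hP₀ hQ₀ c hδ).trans Ioo_subset_Icc_self)
    · rw [hind]
      convert hn using 2
      ext x
      rw [jacobiTail_eq hδ]
      ring

end

end FDARE

end

theorem mainTheorem2 (a b μ t t₀ : ℝ) (hab : a < b) (hμ₀ : 0 < μ) (hμ₁ : μ < 1)
    (ht : 1 + μ < t) (ht₀ : 1 + μ < t₀) (ht₀' : t₀ < min 2 t) :
    0 < FDARE.ratioBound μ t₀ ∧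
    ∀ α β : ℝ, 0 < α → 0 < β → α + β = 1 → β / α < FDARE.ratioBound μ t₀ →
      FDARE.MainConditions a b α β μ (fun _ => 1) (fun _ => 0) (fun _ => 0) (fun _ => -1) ∧
      ∃ p q : ℝ, FDARE.ExponentConditions α β μ p q ∧
        (∀ p' q' : ℝ, FDARE.ExponentConditions α β μ p' q' → p' = p ∧ q' = q) ∧
        -- the explicit function is the unique true solution in the Sobolev space
        FDARE.IsTrueSolution a b α β μ (fun _ => 1) (fun _ => 0) (fun _ => 0) (fun _ => -1)
          (FDARE.exampleSolution a b β μ p q) ∧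
        FDARE.MemSobolevZero a b ((1 + μ) / 2) (FDARE.exampleSolution a b β μ p q) ∧
        (∀ v : ℝ → ℝ,
          FDARE.IsTrueSolution a b α β μ (fun _ => 1) (fun _ => 0) (fun _ => 0) (fun _ => -1) v →
          FDARE.MemSobolevZero a b ((1 + μ) / 2) v →
          EqOn v (FDARE.exampleSolution a b β μ p q) (Icc a b)) ∧
        -- its derivative of order `t` exists pointwise but is not in `L¹(Ω)`
        FDARE.HasLeftDeriv a b t (FDARE.exampleSolution a b β μ p q) ∧
        ¬ IntegrableOn (FDARE.leftDeriv a t (FDARE.exampleSolution a b β μ p q)) (Ioo a b) ∧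
        -- and it is not a fractional integral of order `t` of a function in `H^*(Ω)`
        ∀ J : ℝ → ℝ, FDARE.MemHStar a b J →
          ¬ ∀ᵐ x ∂(volume.restrict (Ioo a b)),
            FDARE.exampleSolution a b β μ p q x = FDARE.leftInt a t J x := by
  have ht₁ : t₀ < 2 := ht₀'.trans_le (min_le_left _ _)
  have ht₂ : t₀ < t := ht₀'.trans_le (min_le_right _ _)
  refine ⟨FDARE.ratioBound_pos hμ₀ ht₀ ht₁, fun α β hα hβ hαβ hr =>
    ⟨FDARE.mainConditions_example hμ₀ hμ₁ hα hβ hαβ, ?_⟩⟩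
  obtain ⟨p, q, h⟩ := FDARE.exists_exponentConditions hα hβ hμ₀ hμ₁
  have hp := h.lt_of_ratio hα hμ₀ ht₀ ht₁ hr
  have hpq := h.2.2.2.2.1
  have hc := FDARE.exampleConst_ne_zero hβ hμ₀ hμ₁ h
  have hu := FDARE.isTrueSolution_exampleSolution hα hβ hμ₀ hμ₁ hab h
  refine ⟨p, q, h, fun p' q' h' => h.unique hα hμ₀ hμ₁ h', hu, ?_,
    fun v hv _ => FDARE.IsTrueSolution.eqOn hα hβ hμ₀ hμ₁ hab h hu hv,
    FDARE.hasLeftDeriv_exampleSolution hab (by linarith) h.1,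
    FDARE.not_integrableOn_leftDeriv hab (by linarith) h.1 h.2.2.1 h.2.2.2.1 (by linarith) hc,
    fun J hJ => FDARE.not_ae_eq_leftInt hab (by linarith) h.2.2.1 (by linarith) hc hJ⟩
  -- θ = μ is admissible because p + 1 = μ - q and q + 1 = μ - p both exceed μ, and it suffices
  -- because 2s = 1 + μ < 1 + 2μ.
  exact FDARE.memSobolevZero_jacobi (θ := μ) hab (by linarith [h.2.1]) (by linarith [h.2.2.2.1])
    hμ₀ (by linarith [h.2.2.2.1]) (by linarith [h.2.1]) (by linarith) (by linarith) _
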